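/- Let $(X,J)$ be a complex manifold of dimension $n\ge 3$ and $\omega$ a Hermitian metric on $X$, identified with its fundamental form (a smooth positive definite real $(1,1)$-form). Write $\omega_p=\omega^p/p!$, and let $\star$ be the Hodge star operator of $\omega$. Let $\rho_\omega$ be the unique smooth $(1,1)$-form with $i\partial\bar\partial\omega_{n-2}=\omega_{n-2}\wedge\rho_\omega$ and let $f_\omega=(\omega\wedge i\partial\bar\partial\omega_{n-2})/\omega_n$. The metric $\omega$ is called *closed star split* if $d(\star\rho_\omega)=0$, *pluriclosed star split* if $\partial\bar\partial(\star\rho_\omega)=0$, *balanced* if $d\omega_{n-1}=0$ and *SKT* if $\partial\bar\partial\omega=0$. The real $(n-1,n-1)$-form $\Gamma$ has eigenvalues $\lambda_1,\dots,\lambda_n$ with respect to $\omega$ if, at each point, $\omega=\sum_j i\theta_j\wedge\bar\theta_j$ and $\Gamma=\sum_j\lambda_j\prod_{l\ne j}i\theta_l\wedge\bar\theta_l$ for some basis $(\theta_j)$ of the $(1,0)$-forms. (1) Let $X=\Gamma\backslash G$ be the Iwasawa manifold, where $G=\mathbb C^3$ is the complex Heisenberg group of the matrices $\begin{pmatrix}1&z_1&z_3\\0&1&z_2\\0&0&1\end{pmatrix}$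 and $\Gamma$ is the subgroup of those with entries in $\mathbb Z[i]$. Let $\alpha,\beta,\gamma$ be the forms on $X$ induced by $dz_1$, $dz_2$, $dz_3-z_1dz_2$ (so $\partial\gamma=-\alpha\wedge\beta$). Then $\omega=i\alpha\wedge\bar\alpha+i\beta\wedge\bar\beta+i\gamma\wedge\bar\gamma$ is a balanced metric which is closed star split, hence also pluriclosed star split, $f_\omega\equiv 1$, and the eigenvalues of $\star\rho_\omega$ with respect to $\omega$ are $\frac12,\frac12,-\frac12$. (2) Let $X=\Gamma\backslash G$ be any Nakamura manifold: $G=\mathbb C^3$ with the product $a\cdot z=(a_1+z_1,\ a_2+e^{-a_1}z_2,\ a_3+e^{a_1}z_3)$ and $\Gamma$ is any discrete subgroup with compact quotient. Let $\varphi_1,\varphi_2,\varphi_3$ be the forms on $X$ induced by $dz_1$, $e^{z_1}dz_2$, $e^{-z_1}dz_3$ (so $\partial\varphi_2=\varphi_1\wedge\varphi_2$, $\partial\varphi_3=-\varphi_1\wedge\varphi_3$). Then $\omega=\sum_{j=1}^3 i\varphi_j\wedge\bar\varphi_j$ is a balanced metric which is closed star split, hence also pluriclosed star split, $f_\omega\equiv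 2$, and the eigenvalues of $\star\rho_\omega$ with respect to $\omega$ are $1,0,0$. (3) Let $X=I^{(5)}=\Gamma\backslash G$ be the five-dimensional Iwasawa manifold: $G=\mathbb C^5$ with the product $$a\cdot z=\Big(a_1+z_1,\ a_2+z_2,\ a_3+z_3-a_1z_2,\ a_4+z_4-a_1z_3+\tfrac{a_1^2}{2}z_2,\ a_5+z_5-a_2z_3+a_1a_2z_2+\tfrac{a_1}{2}z_2^2\Big)$$ and $\Gamma$ is any discrete subgroup with compact quotient. Let $\varphi_1,\dots,\varphi_5$ be the forms on $X$ induced by $dz_1$, $dz_2$, $dz_3+z_1dz_2$, $dz_4+z_1dz_3+\frac{z_1^2}{2}dz_2$, $dz_5+z_2dz_3$ (so $\partial\varphi_1=\partial\varphi_2=0$, $\partial\varphi_3=\varphi_1\wedge\varphi_2$, $\partial\varphi_4=\varphi_1\wedge\varphi_3$, $\partial\varphi_5=\varphi_2\wedge\varphi_3$). Then $\omega=\sum_{j=1}^5 i\varphi_j\wedge\bar\varphi_j$ is a balanced metric which is closed star split, hence also pluriclosed star split, $f_\omega\equiv 3$, and the eigenvalues of $\star\rho_\omega$ with respect to $\omega$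 are $\frac34,\frac34,-\frac14,-\frac14,-\frac14$. (4) On $S^3\times S^3$, with $S^3$ the group of unit quaternions, let $e_1,e_2,e_3$ and $f_1,f_2,f_3$ be the components along $i,j,k$ of the left-invariant forms $x^{-1}dx$ and $y^{-1}dy$ of the two factors. For $t\in\mathbb C$ with $|t|<1$ put $\varphi_t^1=e_1+ie_2$, $\varphi_t^2=f_1+if_2$, $\varphi_t^3=\varphi^3-t\,\overline{\varphi^3}$ where $\varphi^3=e_3+if_3$, and let $J_t$ be the almost complex structure for which these are of type $(1,0)$ (for $t=0$ this is the Calabi–Eckmann structure $J_{CE}$). Then $J_t$ is a complex structure: for each $j$, $\varphi_t^j$ is a smooth $(1,0)$-form and $d\varphi_t^j=\partial_t\varphi_t^j+\bar\partial_t\varphi_t^j$, where $$\partial_t\varphi_t^1=\tfrac{\bar t+1}{1-|t|^2}\,i\varphi_t^1\wedge\varphi_t^3,\qquad \bar\partial_t\varphi_t^1=\tfrac{t+1}{1-|t|^2}\,i\varphi_t^1\wedge\bar\varphi_t^3,$$ $$\partial_t\varphi_t^2=\tfrac{1-\bar t}{1-|t|^2}\,\varphi_t^2\wedge\varphi_t^3,\qquad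 \bar\partial_t\varphi_t^2=\tfrac{t-1}{1-|t|^2}\,\varphi_t^2\wedge\bar\varphi_t^3,$$ $$\partial_t\varphi_t^3=0,\qquad \bar\partial_t\varphi_t^3=(t-1)\,i\varphi_t^1\wedge\bar\varphi_t^1+(t+1)\,\varphi_t^2\wedge\bar\varphi_t^2.$$ The form $\omega_t=\frac12\sum_{j=1}^3 i\varphi_t^j\wedge\bar\varphi_t^j$ is a Hermitian metric on $X_t=(S^3\times S^3,J_t)$ which is pluriclosed star split, and $f_{\omega_t}\equiv 8\,\mathrm{Im}\,t$. It is closed star split if and only if $t\in\mathbb R$, in which case $\rho_{\omega_t}=0$ and $\omega_t$ is SKT. The eigenvalues of $\star\rho_{\omega_t}$ with respect to $\omega_t$ are $4\,\mathrm{Im}\,t,\ 4\,\mathrm{Im}\,t,\ -4\,\mathrm{Im}\,t$. -/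

import Mathlib

open scoped Manifold Quaternion Topology

noncomputable section

/-! ### Linear algebra: complex-valued alternating forms on a real vector space with a complex
structure -/

namespace PSS

section Pointwise

variable {V : Type*} [AddCommGroup V] [Module ℝ V] [TopologicalSpace V]

/-- The wedge product of two complex-valued alternating forms (sum over shuffles), so that
`(α ∧ β)(u, v) = α(u) β(v) - α(v) β(u)` for `1`-forms. -/
def wedge {p q : ℕ} (α : V [⋀^Fin p]→L[ℝ] ℂ) (β : V [⋀^Fin q]→L[ℝ] ℂ) :
    V [⋀^Fin (p + q)]→L[ℝ] ℂ :=
  { ((LinearMap.mul' ℝ ℂ).compAlternatingMap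
      (α.toAlternatingMap.domCoprod β.toAlternatingMap)).domDomCongr finSumFinEquiv with
    cont := by
      change Continuous fun v : Fin (p + q) → V =>
        LinearMap.mul' ℝ ℂ ((α.toAlternatingMap.domCoprod β.toAlternatingMap)
          (v ∘ finSumFinEquiv))
      simp only [AlternatingMap.domCoprod_apply, map_sum, sum_apply]
      refine continuous_finsetSum _ fun s _ => ?_
      induction s using Quotient.inductionOn' with | _ s
      have h : Continuous fun v : Fin (p + q) → V =>
          ((Equiv.Perm.sign s : ℤ) : ℂ) *
            (α (fun i => v (finSumFinEquiv (s (Sum.inl i)))) *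
              β (fun i => v (finSumFinEquiv (s (Sum.inr i))))) :=
        continuous_const.mul ((α.cont.comp (continuous_pi fun i => continuous_apply _)).mul
          (β.cont.comp (continuous_pi fun i => continuous_apply _)))
      convert h using 2 with v
      rw [AlternatingMap.domCoprod.summand_mk'', Units.smul_def, smul_apply, map_zsmul,
        zsmul_eq_mul]
      rfl }

/-- A complex-valued linear functional as a `1`-form. -/
def oneForm (f : V →L[ℝ] ℂ) : V [⋀^Fin 1]→L[ℝ] ℂ :=
  ContinuousAlternatingMap.ofSubsingleton ℝ V ℂ (0 : Fin 1) f

/-- The complex conjugate of a form. -/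
def conjForm {k : ℕ} (α : V [⋀^Fin k]→L[ℝ] ℂ) : V [⋀^Fin k]→L[ℝ] ℂ :=
  (Complex.conjCLE : ℂ →L[ℝ] ℂ).compContinuousAlternatingMap α

/-- The wedge product `a₀ ∧ a₁ ∧ ⋯ ∧ a_{k-1}` of a list of `2`-forms. -/
def wedgeProd : (k : ℕ) → (Fin k → V [⋀^Fin 2]→L[ℝ] ℂ) → V [⋀^Fin (2 * k)]→L[ℝ] ℂ
  | 0, _ => ContinuousAlternatingMap.constOfIsEmpty ℝ V (Fin 0) 1
  | k + 1, a => wedge (wedgeProd k fun j => a j.castSucc) (a (Fin.last k))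

/-- The divided power `α_k = α^k / k!` of a `2`-form. -/
def divPow (α : V [⋀^Fin 2]→L[ℝ] ℂ) (k : ℕ) : V [⋀^Fin (2 * k)]→L[ℝ] ℂ :=
  ((k.factorial : ℂ)⁻¹) • wedgeProd k fun _ => α

/-- The real endomorphism "multiplication by the complex number `c`" attached to `J`. -/
def cMul (J : V →L[ℝ] V) [IsTopologicalAddGroup V] [ContinuousConstSMul ℝ V] (c : ℂ) :
    V →L[ℝ] V :=
  c.re • ContinuousLinearMap.id ℝ V + c.im • J

variable [IsTopologicalAddGroup V] [ContinuousConstSMul ℝ V]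

/-- `α` is of bidegree `(p, q)` with respect to `J`. (For a form of degree `p + q` this is
equivalent to being a combination of wedge products of `p` functionals that are `J`-linear and `q`
functionals that are `J`-antilinear.) -/
def IsOfType (J : V →L[ℝ] V) (p q : ℕ) {k : ℕ} (α : V [⋀^Fin k]→L[ℝ] ℂ) : Prop :=
  k = p + q ∧ ∀ (c : ℂ) (v : Fin k → V),
    α (fun i => cMul J c (v i)) = c ^ p * (starRingEnd ℂ c) ^ q * α v

/-- The component of bidegree `(p, q)`, `p + q = k`, of a form of degree `k`. A rotation of angle
`t` multiplies a form of bidegree `(r, s)` by `exp (i (r - s) t)`, so that the component is obtained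
by Fourier averaging over the rotations of angles `2πj / (2k+1)`. -/
def typeProj (J : V →L[ℝ] V) (p q : ℕ) {k : ℕ} (α : V [⋀^Fin k]→L[ℝ] ℂ) :
    V [⋀^Fin k]→L[ℝ] ℂ :=
  ((2 * k + 1 : ℂ)⁻¹) • ∑ j ∈ Finset.range (2 * k + 1),
    Complex.exp (-(((p : ℂ) - q) * (2 * Real.pi * j / (2 * k + 1)) * Complex.I)) •
      α.compContinuousLinearMap
        (cMul J (Complex.exp ((2 * Real.pi * j / (2 * k + 1)) * Complex.I)))

/-- `σ = ⋆ α` for the Hodge star operator of the Hermitian metric whose fundamental `(1,1)`-form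
is `ω`, on a space of complex dimension `n`: `u ∧ ⋆ α = ⟨u, conj α⟩ ω_n` for all `u`, where the
inner product of `k`-forms is the Hermitian extension of the one induced by the Riemannian metric
`g(u, v) = ω(u, J v)`; it is computed in an orthonormal basis `e` of `g`. -/
def IsHodgeStar (J : V →L[ℝ] V) (ω : V [⋀^Fin 2]→L[ℝ] ℂ) (n : ℕ) {k l : ℕ}
    (h : 2 * n = k + l) (α : V [⋀^Fin k]→L[ℝ] ℂ) (σ : V [⋀^Fin l]→L[ℝ] ℂ) : Prop :=
  ∃ e : Fin (2 * n) → V,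
    (∀ a b, ω ![e a, J (e b)] = if a = b then 1 else 0) ∧
    Submodule.span ℝ (Set.range e) = ⊤ ∧
    ∀ (u : V [⋀^Fin k]→L[ℝ] ℂ) (v : Fin (2 * n) → V),
      wedge u σ (fun i => v (Fin.cast h.symm i)) =
        (((k.factorial : ℂ)⁻¹) * ∑ s : Fin k → Fin (2 * n), u (e ∘ s) * α (e ∘ s)) *
          divPow ω n v

/-- The `(n-1, n-1)`-form `Γ` (`n = m + 2`) has eigenvalues `lam j` with respect to `ω`: for some
basis `θ` of the space of `(1,0)`-forms one has `ω = ∑ⱼ i θⱼ ∧ conj θⱼ` and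
`Γ = ∑ⱼ lam j • ∏_{l ≠ j} i θₗ ∧ conj θₗ`. -/
def HasEigenvalues (J : V →L[ℝ] V) (ω : V [⋀^Fin 2]→L[ℝ] ℂ) {m : ℕ}
    (Γ : V [⋀^Fin (2 * (m + 1))]→L[ℝ] ℂ) (lam : Fin (m + 2) → ℝ) : Prop :=
  ∃ θ : Fin (m + 2) → V →L[ℝ] ℂ,
    (∀ j v, θ j (J v) = Complex.I * θ j v) ∧
    (∀ v, (∀ j, θ j v = 0) → v = 0) ∧
    ω = ∑ j, Complex.I • wedge (oneForm (θ j)) (conjForm (oneForm (θ j))) ∧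
    Γ = ∑ j, (lam j : ℂ) • wedgeProd (m + 1) fun l : Fin (m + 1) =>
      Complex.I • wedge (oneForm (θ (j.succAbove l))) (conjForm (oneForm (θ (j.succAbove l))))

end Pointwise

/-! ### Differential forms on manifolds without boundary -/

section Forms

variable {E : Type*} [NormedAddCommGroup E] [NormedSpace ℝ E] {H : Type*} [TopologicalSpace H]
  (I : ModelWithCorners ℝ E H) (M : Type*) [TopologicalSpace M] [ChartedSpace H M]

/-- Complex-valued differential forms of degree `k` (smoothness is a separate predicate). -/
abbrev DForm (k : ℕ) := ∀ x : M, TangentSpace I x [⋀^Fin k]→L[ℝ] ℂ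

/-- Fields of endomorphisms of the tangent spaces, such as almost complex structures. -/
abbrev EndField := ∀ x : M, TangentSpace I x →L[ℝ] TangentSpace I x

variable {I M} {k : ℕ}

/-- The expression of a form in the preferred chart at `x`. -/
def localRep (α : DForm I M k) (x : M) : E → E [⋀^Fin k]→L[ℝ] ℂ := fun y =>
  (α ((extChartAt I x).symm y)).compContinuousLinearMap
    (mfderiv 𝓘(ℝ, E) I (extChartAt I x).symm y)

/-- The form is `C^∞`. -/
def IsSmooth (α : DForm I M k) : Prop :=
  ∀ x, ContDiffOn ℝ ((⊤ : ℕ∞) : WithTop ℕ∞) (localRep α x) (extChartAt I x).target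

/-- The exterior derivative, computed at `x` in the preferred chart at `x`. -/
def extD (α : DForm I M k) : DForm I M (k + 1) := fun x =>
  ContinuousAlternatingMap.compContinuousLinearMap
    (extDeriv (localRep α x) (extChartAt I x x)) (mfderiv I 𝓘(ℝ, E) (extChartAt I x) x)

variable (J : EndField I M)

/-- The operator `∂ = ∑_{p+q=k} π^{p+1,q} ∘ d ∘ π^{p,q}`. -/
def del (α : DForm I M k) : DForm I M (k + 1) :=
  ∑ p ∈ Finset.range (k + 1), fun x =>
    typeProj (J x) (p + 1) (k - p) (extD (fun y => typeProj (J y) p (k - p) (α y)) x)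

/-- The operator `∂̄ = ∑_{p+q=k} π^{p,q+1} ∘ d ∘ π^{p,q}`. -/
def delbar (α : DForm I M k) : DForm I M (k + 1) :=
  ∑ p ∈ Finset.range (k + 1), fun x =>
    typeProj (J x) p (k - p + 1) (extD (fun y => typeProj (J y) p (k - p) (α y)) x)

/-- The operator `i ∂ ∂̄`. -/
def iDelDelbar (α : DForm I M k) : DForm I M (k + 1 + 1) :=
  Complex.I • del J (delbar J α)

/-- `ω` is (the fundamental form of) a Hermitian metric: a smooth, real, positive definite
`(1,1)`-form. -/
def IsHermitianMetric (ω : DForm I M 2) : Prop :=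
  IsSmooth ω ∧ ∀ x, IsOfType (J x) 1 1 (ω x) ∧ conjForm (ω x) = ω x ∧
    ∀ v : TangentSpace I x, v ≠ 0 → 0 < (ω x ![v, J x v]).re

/-- The divided power `ω_j = ω^j / j!`. -/
def metricPow (ω : DForm I M 2) (j : ℕ) : DForm I M (2 * j) := fun x => divPow (ω x) j

variable (m : ℕ)

/-! From here on the complex dimension of the manifold is `n = m + 2`. -/

/-- The metric is balanced: `d ω_{n-1} = 0`. -/
def IsBalanced (ω : DForm I M 2) : Prop := extD (metricPow ω (m + 1)) = 0

/-- `ρ` is the smooth `(1,1)`-form `ρ_ω` given by `i∂∂̄ω_{n-2} = ω_{n-2} ∧ ρ_ω`; it is unique since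
`ω_{n-2} ∧ ·` is pointwise injective on `(1,1)`-forms. -/
def IsRho (ω ρ : DForm I M 2) : Prop :=
  IsSmooth ρ ∧ (∀ x, IsOfType (J x) 1 1 (ρ x)) ∧
    ∀ x, iDelDelbar J (metricPow ω m) x = wedge (metricPow ω m x) (ρ x)

/-- `σ = ⋆ ρ_ω`. -/
def IsStarRho (ω : DForm I M 2) (σ : DForm I M (2 * (m + 1))) : Prop :=
  ∃ ρ : DForm I M 2, IsRho J m ω ρ ∧
    ∀ x, IsHodgeStar (J x) (ω x) (m + 2) (by omega) (ρ x) (σ x)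

/-- `ω` is pluriclosed star split: `∂∂̄(⋆ρ_ω) = 0`. -/
def IsPluriclosedStarSplit (ω : DForm I M 2) : Prop :=
  ∃ σ, IsStarRho J m ω σ ∧ del J (delbar J σ) = 0

/-- `ω` is closed star split: `d(⋆ρ_ω) = 0`. -/
def IsClosedStarSplit (ω : DForm I M 2) : Prop :=
  ∃ σ, IsStarRho J m ω σ ∧ extD σ = 0

/-- The eigenvalues of `⋆ρ_ω` with respect to `ω` are the constants `lam j`. -/
def StarRhoHasEigenvalues (ω : DForm I M 2) (lam : Fin (m + 2) → ℝ) : Prop :=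
  ∃ σ, IsStarRho J m ω σ ∧ ∀ x, HasEigenvalues (J x) (ω x) (σ x) lam

/-- `f = f_ω = (ω ∧ i∂∂̄ω_{n-2}) / ω_n`. -/
def IsAssociatedFunction (ω : DForm I M 2) (f : M → ℝ) : Prop :=
  ∀ (x : M) (v : Fin (2 * (m + 2)) → TangentSpace I x),
    wedge (ω x) (iDelDelbar J (metricPow ω m) x)
        (fun i => v (Fin.cast (by omega) i)) =
      (f x : ℂ) * metricPow ω (m + 2) x v

/-- The `(1,1)`-form `∑ⱼ i φⱼ ∧ conj φⱼ`. -/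
def stdMetric {n : ℕ} (φ : Fin n → DForm I M 1) : DForm I M 2 := fun x =>
  ∑ j, Complex.I • wedge (φ j x) (conjForm (φ j x))

/-- The wedge product of differential forms. -/
def formWedge {p q : ℕ} (α : DForm I M p) (β : DForm I M q) : DForm I M (p + q) := fun x =>
  wedge (α x) (β x)

/-- The complex conjugate of a differential form. -/
def formConj (α : DForm I M k) : DForm I M k := fun x => conjForm (α x)

/-- The metric is SKT: `∂∂̄ω = 0`. -/
def IsSKT (ω : DForm I M 2) : Prop := del J (delbar J ω) = 0

end Forms

/-- The pullback of a form by a map. -/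
def pullback {E : Type*} [NormedAddCommGroup E] [NormedSpace ℝ E]
    {H : Type*} [TopologicalSpace H] {I : ModelWithCorners ℝ E H}
    {M : Type*} [TopologicalSpace M] [ChartedSpace H M]
    {E' : Type*} [NormedAddCommGroup E'] [NormedSpace ℝ E']
    {H' : Type*} [TopologicalSpace H'] {I' : ModelWithCorners ℝ E' H'}
    {M' : Type*} [TopologicalSpace M'] [ChartedSpace H' M'] {k : ℕ}
    (f : M → M') (α : DForm I' M' k) : DForm I M k := fun x =>
  (α (f x)).compContinuousLinearMap (mfderiv I I' f x)

/-- The complex structure of a complex manifold, that is, of a manifold with charts in a complex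
vector space and holomorphic transition maps: multiplication by `i` on tangent vectors, read in the
preferred (holomorphic) chart. -/
def stdJ {E : Type*} [NormedAddCommGroup E] [NormedSpace ℂ E] (M : Type*) [TopologicalSpace M]
    [ChartedSpace E M] : EndField 𝓘(ℝ, E) M := fun _ =>
  (Complex.I • ContinuousLinearMap.id ℝ E : E →L[ℝ] E)

/-! ### Quotients of complex Lie groups by discrete subgroups -/

section Quotient

/-- The quotient of a manifold by a free, properly discontinuous group action by smooth (or
holomorphic, according to the model) maps is a manifold. -/
theorem isManifold_quotient {𝕜 : Type*} [NontriviallyNormedField 𝕜] {E : Type*}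
    [NormedAddCommGroup E] [NormedSpace 𝕜 E] {H : Type*} [TopologicalSpace H]
    (I : ModelWithCorners 𝕜 E H) (n : WithTop ℕ∞) {M : Type*} [TopologicalSpace M]
    [ChartedSpace H M] [IsManifold I n M] [T2Space M] [LocallyCompactSpace M]
    {Γ : Type*} [Group Γ] [MulAction Γ M] [ProperlyDiscontinuousSMul Γ M]
    [ContinuousConstSMul Γ M] [IsCancelSMul Γ M]
    (h : ∀ g : Γ, ContMDiff I I n (fun x : M => g • x)) :
    IsManifold I n (MulAction.orbitRel.Quotient Γ M) := by
  refine isManifold_of_contDiffOn I n _ ?_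
  rintro _ _ ⟨q, rfl⟩ ⟨q', rfl⟩
  generalize_proofs h1 h2
  generalize h2.choose q = a
  generalize h2.choose q' = b
  intro y hy
  set A := h1.localInverseAt a with hA
  set B := h1.localInverseAt b with hB
  have hAs : ∀ x, A.symm x = Quotient.mk (MulAction.orbitRel Γ M) x := fun x =>
    congrFun (h1.localInverseAt_symm (x := a)) x
  set S := I.symm ⁻¹' ((A ≫ₕ chartAt H a).symm ≫ₕ B ≫ₕ chartAt H b).source ∩ Set.range I with hS
  have hmem : ∀ z ∈ S, z ∈ (extChartAt I a).target ∧
      Quotient.mk (MulAction.orbitRel Γ M) ((extChartAt I a).symm z) ∈ B.source ∧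
      B (Quotient.mk (MulAction.orbitRel Γ M) ((extChartAt I a).symm z)) ∈
        (chartAt H b).source := by
    intro z hz
    have := hz.1
    simp only [Set.mem_preimage, OpenPartialHomeomorph.trans_source,
      OpenPartialHomeomorph.symm_source, Set.mem_inter_iff,
      OpenPartialHomeomorph.trans_symm_eq_symm_trans_symm, OpenPartialHomeomorph.coe_trans,
      Function.comp_apply, hAs] at this
    refine ⟨?_, ?_, ?_⟩
    · rw [extChartAt_target]
      exact ⟨this.1.1, hz.2⟩
    · simpa [extChartAt] using this.2.1
    · simpa [extChartAt] using this.2.2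
  obtain ⟨hy1, hy2, hy3⟩ := hmem y hy
  -- near `y` the transition map is the translation by a fixed element of the group
  obtain ⟨g, hg⟩ : ∃ g : Γ, g • (extChartAt I a).symm y =
      B (Quotient.mk (MulAction.orbitRel Γ M) ((extChartAt I a).symm y)) := by
    have h3 := h1.apply_localInverseAt_of_mem hy2
    obtain ⟨g, hg⟩ := Quotient.exact h3
    exact ⟨g, hg⟩
  have hca : ContMDiffOn 𝓘(𝕜, E) I n (extChartAt I a).symm (extChartAt I a).target :=
    contMDiffOn_extChartAt_symm a
  have hSt : S ⊆ (extChartAt I a).target := fun z hz => (hmem z hz).1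
  have hcont : ContMDiffWithinAt 𝓘(𝕜, E) I n (fun z => g • (extChartAt I a).symm z) S y :=
    (h g).contMDiffAt.comp_contMDiffWithinAt y ((hca y hy1).mono hSt)
  have hF : ContMDiffWithinAt 𝓘(𝕜, E) 𝓘(𝕜, E) n
      (fun z => extChartAt I b (g • (extChartAt I a).symm z)) S y := by
    refine ContMDiffAt.comp_contMDiffWithinAt y (contMDiffAt_extChartAt' ?_) hcont
    rw [hg]; exact hy3
  rw [← contMDiffWithinAt_iff_contDiffWithinAt]
  have hkey : ∀ z ∈ S, g • (extChartAt I a).symm z ∈ B.target →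
      B (Quotient.mk (MulAction.orbitRel Γ M) ((extChartAt I a).symm z)) =
        g • (extChartAt I a).symm z := by
    intro z hz hz'
    refine h1.injOn_localInverseAt_target (B.map_source (hmem z hz).2.1) hz' ?_
    rw [h1.apply_localInverseAt_of_mem (hmem z hz).2.1]
    exact (Quotient.sound ⟨g, rfl⟩ : (Quotient.mk (MulAction.orbitRel Γ M) _) = _).symm
  refine hF.congr_of_eventuallyEq ?_ ?_
  · have hnhds : ∀ᶠ z in 𝓝[S] y, g • (extChartAt I a).symm z ∈ B.target := by
      refine hcont.continuousWithinAt.eventually (B.open_target.mem_nhds ?_)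
      change g • _ ∈ B.target
      rw [hg]; exact B.map_source hy2
    filter_upwards [hnhds, self_mem_nhdsWithin] with z hz hzS
    rw [← hkey z hzS hz]
    simp [hAs, extChartAt]
  · rw [hg]
    simp [hAs, extChartAt]

variable {G : Type*} [TopologicalSpace G] [Group G] [IsTopologicalGroup G] [T2Space G]
  (Γ : Subgroup G)

/-- A discrete subgroup acts properly discontinuously by left translations. -/
instance properlyDiscontinuous_of_discrete [DiscreteTopology Γ] :
    ProperlyDiscontinuousSMul Γ G :=
  Γ.properlyDiscontinuousSMul_of_tendsto_cofinite
    (Γ.tendsto_coe_cofinite_of_discrete (isDiscrete_iff_discreteTopology.mpr inferInstance))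

/-- The space `Γ \ G` of the orbits of `Γ` acting on `G` by left translations. When `Γ` is discrete
it carries the charted space structure of a quotient by a free, properly discontinuous action. -/
abbrev LeftQuotient := MulAction.orbitRel.Quotient Γ G

/-- The projection `G → Γ \ G`. -/
def quotMap : G → LeftQuotient Γ := Quotient.mk (MulAction.orbitRel Γ G)

end Quotient

/-- The coordinate functional `dz_j` on `ℂⁿ`. -/
def dz {n : ℕ} (j : Fin n) : (Fin n → ℂ) →L[ℝ] ℂ := ContinuousLinearMap.proj j

/-! ### The Heisenberg group and the Iwasawa manifold -/

/-- The complex Heisenberg group of the matrices `(1, z₀, z₂; 0, 1, z₁; 0, 0, 1)`, in the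
coordinates `(z₀, z₁, z₂) ∈ ℂ³`. -/
def Heisenberg : Type := Fin 3 → ℂ

namespace Heisenberg

instance : TopologicalSpace Heisenberg := inferInstanceAs (TopologicalSpace (Fin 3 → ℂ))
instance : T2Space Heisenberg := inferInstanceAs (T2Space (Fin 3 → ℂ))
instance : LocallyCompactSpace Heisenberg := inferInstanceAs (LocallyCompactSpace (Fin 3 → ℂ))
instance : ChartedSpace (Fin 3 → ℂ) Heisenberg :=
  inferInstanceAs (ChartedSpace (Fin 3 → ℂ) (Fin 3 → ℂ))
instance : IsManifold 𝓘(ℂ, Fin 3 → ℂ) ((⊤ : ℕ∞) : WithTop ℕ∞) Heisenberg :=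
  inferInstanceAs (IsManifold 𝓘(ℂ, Fin 3 → ℂ) ((⊤ : ℕ∞) : WithTop ℕ∞) (Fin 3 → ℂ))

/-- The product, which is the product of matrices. -/
def mulFun (a z : Fin 3 → ℂ) : Fin 3 → ℂ := ![a 0 + z 0, a 1 + z 1, a 2 + z 2 + a 0 * z 1]

/-- The inverse. -/
def invFun (a : Fin 3 → ℂ) : Fin 3 → ℂ := ![-a 0, -a 1, -a 2 + a 0 * a 1]

instance : Mul Heisenberg := ⟨mulFun⟩
instance : Inv Heisenberg := ⟨invFun⟩
instance : One Heisenberg := ⟨(0 : Fin 3 → ℂ)⟩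

instance : Group Heisenberg :=
  Group.ofLeftAxioms
    (fun a b c => by
      change mulFun (mulFun a b) c = mulFun a (mulFun b c)
      ext j; fin_cases j <;> simp [mulFun] <;> ring)
    (fun a => by
      change mulFun 0 a = a
      ext j; fin_cases j <;> simp [mulFun])
    (fun a => by
      change mulFun (invFun a) a = 0
      ext j; fin_cases j <;> simp [mulFun, invFun])

instance : IsTopologicalGroup Heisenberg where
  continuous_mul := by
    change Continuous fun p : (Fin 3 → ℂ) × (Fin 3 → ℂ) => mulFun p.1 p.2
    refine continuous_pi fun j => ?_
    fin_cases j <;> simp [mulFun] <;> fun_prop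
  continuous_inv := by
    change Continuous invFun
    refine continuous_pi fun j => ?_
    fin_cases j <;> simp [invFun] <;> fun_prop

/-- The lattice of the matrices with entries in the Gaussian integers. -/
def gaussianLattice : Subgroup Heisenberg where
  carrier := {z | ∀ j : Fin 3, z j ∈ GaussianInt.toComplex.range}
  one_mem' := fun _ => zero_mem GaussianInt.toComplex.range
  mul_mem' := by
    intro a b ha hb j
    change mulFun a b j ∈ _
    fin_cases j
    · exact add_mem (ha 0) (hb 0)
    · exact add_mem (ha 1) (hb 1)
    · exact add_mem (add_mem (ha 2) (hb 2)) (mul_mem (ha 0) (hb 1))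
  inv_mem' := by
    intro a ha j
    change invFun a j ∈ _
    fin_cases j
    · exact neg_mem (ha 0)
    · exact neg_mem (ha 1)
    · exact add_mem (neg_mem (ha 2)) (mul_mem (ha 0) (ha 1))

instance : DiscreteTopology gaussianLattice := by
  refine discreteTopology_of_isOpen_singleton_one ?_
  have hopen : IsOpen {z : Fin 3 → ℂ | ∀ j, ‖z j‖ < 1} := by
    simp only [Set.ofPred_forall]
    exact isOpen_iInter_of_finite fun j => isOpen_lt (by fun_prop) continuous_const
  have h1 : IsOpen ((Subtype.val : gaussianLattice → Heisenberg) ⁻¹'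
      {z : Fin 3 → ℂ | ∀ j, ‖z j‖ < 1}) :=
    IsOpen.preimage continuous_subtype_val hopen
  convert h1
  ext ⟨z, hz⟩
  simp only [Set.mem_singleton_iff, Set.mem_preimage]
  constructor
  · intro h j
    have : z = (0 : Fin 3 → ℂ) := congrArg Subtype.val h
    rw [this]; simp
  · intro h
    apply Subtype.ext
    change z = (0 : Fin 3 → ℂ)
    refine funext fun j => ?_
    obtain ⟨w, hw⟩ := hz j
    have hj := h j
    rw [← hw] at hj ⊢
    have h2 : ((w.norm : ℤ) : ℝ) < 1 := by
      rw [GaussianInt.intCast_real_norm, Complex.normSq_eq_norm_sq]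
      nlinarith [norm_nonneg (GaussianInt.toComplex w)]
    have h3 : w.norm = 0 := by
      have := GaussianInt.norm_nonneg w
      have h4 : w.norm < 1 := by exact_mod_cast h2
      omega
    rw [GaussianInt.norm_eq_zero.mp h3]; simp

/-- The left-invariant forms `dz₀`, `dz₁`, `dz₂ - z₀ dz₁`. -/
def frame (j : Fin 3) : DForm 𝓘(ℝ, Fin 3 → ℂ) Heisenberg 1 := fun z =>
  oneForm (V := Fin 3 → ℂ) (![dz 0, dz 1, dz 2 - (z 0 : ℂ) • dz 1] j)

end Heisenberg

/-- The Iwasawa manifold. -/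
abbrev Iwasawa : Type := LeftQuotient Heisenberg.gaussianLattice

/-- The Iwasawa manifold is a complex manifold. -/
instance : IsManifold 𝓘(ℂ, Fin 3 → ℂ) ((⊤ : ℕ∞) : WithTop ℕ∞) Iwasawa := by
  refine isManifold_quotient _ _ fun g => ?_
  refine ContDiff.contMDiff (f := Heisenberg.mulFun (g : Heisenberg)) (contDiff_pi.mpr fun j => ?_)
  fin_cases j <;> simp [Heisenberg.mulFun] <;> fun_prop

/-! ### Nakamura manifolds -/

/-- The solvable complex Lie group `ℂ ⋉ ℂ²`, where `w ∈ ℂ` acts on `ℂ²` by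
`diag (exp (-w), exp w)`. -/
def NakamuraGroup : Type := Fin 3 → ℂ

namespace NakamuraGroup

instance : TopologicalSpace NakamuraGroup := inferInstanceAs (TopologicalSpace (Fin 3 → ℂ))
instance : T2Space NakamuraGroup := inferInstanceAs (T2Space (Fin 3 → ℂ))
instance : LocallyCompactSpace NakamuraGroup :=
  inferInstanceAs (LocallyCompactSpace (Fin 3 → ℂ))
instance : ChartedSpace (Fin 3 → ℂ) NakamuraGroup :=
  inferInstanceAs (ChartedSpace (Fin 3 → ℂ) (Fin 3 → ℂ))
instance : IsManifold 𝓘(ℂ, Fin 3 → ℂ) ((⊤ : ℕ∞) : WithTop ℕ∞) NakamuraGroup :=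
  inferInstanceAs (IsManifold 𝓘(ℂ, Fin 3 → ℂ) ((⊤ : ℕ∞) : WithTop ℕ∞) (Fin 3 → ℂ))

/-- The product. -/
def mulFun (a z : Fin 3 → ℂ) : Fin 3 → ℂ :=
  ![a 0 + z 0, a 1 + Complex.exp (-a 0) * z 1, a 2 + Complex.exp (a 0) * z 2]

/-- The inverse. -/
def invFun (a : Fin 3 → ℂ) : Fin 3 → ℂ :=
  ![-a 0, -(Complex.exp (a 0) * a 1), -(Complex.exp (-a 0) * a 2)]

instance : Mul NakamuraGroup := ⟨mulFun⟩
instance : Inv NakamuraGroup := ⟨invFun⟩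
instance : One NakamuraGroup := ⟨(0 : Fin 3 → ℂ)⟩

instance : Group NakamuraGroup :=
  Group.ofLeftAxioms
    (fun a b c => by
      change mulFun (mulFun a b) c = mulFun a (mulFun b c)
      ext j; fin_cases j <;> simp [mulFun, Complex.exp_add] <;> ring)
    (fun a => by
      change mulFun 0 a = a
      ext j; fin_cases j <;> simp [mulFun])
    (fun a => by
      change mulFun (invFun a) a = 0
      ext j; fin_cases j <;> simp [mulFun, invFun] )

instance : IsTopologicalGroup NakamuraGroup where
  continuous_mul := by
    change Continuous fun p : (Fin 3 → ℂ) × (Fin 3 → ℂ) => mulFun p.1 p.2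
    refine continuous_pi fun j => ?_
    fin_cases j <;> simp [mulFun] <;> fun_prop
  continuous_inv := by
    change Continuous invFun
    refine continuous_pi fun j => ?_
    fin_cases j <;> simp [invFun] <;> fun_prop

/-- The quotient of the group by a discrete subgroup is a complex manifold. -/
instance (Γ : Subgroup NakamuraGroup) [DiscreteTopology Γ] :
    IsManifold 𝓘(ℂ, Fin 3 → ℂ) ((⊤ : ℕ∞) : WithTop ℕ∞) (LeftQuotient Γ) := by
  refine isManifold_quotient _ _ fun g => ?_
  refine ContDiff.contMDiff (f := mulFun (g : NakamuraGroup)) (contDiff_pi.mpr fun j => ?_)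
  fin_cases j <;> simp [mulFun] <;> fun_prop

/-- The left-invariant forms `dz₀`, `exp(z₀) dz₁`, `exp(-z₀) dz₂`. -/
def frame (j : Fin 3) : DForm 𝓘(ℝ, Fin 3 → ℂ) NakamuraGroup 1 := fun z =>
  oneForm (V := Fin 3 → ℂ)
    (![dz 0, Complex.exp (z 0) • dz 1, Complex.exp (-(z 0)) • dz 2] j)

end NakamuraGroup

/-! ### The five-dimensional Iwasawa manifold -/

/-- The simply connected nilpotent complex Lie group of dimension `5` underlying the
five-dimensional Iwasawa manifold, in coordinates for which the forms of `I5Group.frame` are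
left-invariant. -/
def I5Group : Type := Fin 5 → ℂ

namespace I5Group

instance : TopologicalSpace I5Group := inferInstanceAs (TopologicalSpace (Fin 5 → ℂ))
instance : T2Space I5Group := inferInstanceAs (T2Space (Fin 5 → ℂ))
instance : LocallyCompactSpace I5Group :=
  inferInstanceAs (LocallyCompactSpace (Fin 5 → ℂ))
instance : ChartedSpace (Fin 5 → ℂ) I5Group :=
  inferInstanceAs (ChartedSpace (Fin 5 → ℂ) (Fin 5 → ℂ))
instance : IsManifold 𝓘(ℂ, Fin 5 → ℂ) ((⊤ : ℕ∞) : WithTop ℕ∞) I5Group :=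
  inferInstanceAs (IsManifold 𝓘(ℂ, Fin 5 → ℂ) ((⊤ : ℕ∞) : WithTop ℕ∞) (Fin 5 → ℂ))

/-- The product. -/
def mulFun (a z : Fin 5 → ℂ) : Fin 5 → ℂ :=
  ![a 0 + z 0, a 1 + z 1, a 2 + z 2 - a 0 * z 1,
    a 3 + z 3 - a 0 * z 2 + a 0 ^ 2 / 2 * z 1,
    a 4 + z 4 - a 1 * z 2 + a 0 * a 1 * z 1 + a 0 / 2 * z 1 ^ 2]

/-- The inverse. -/
def invFun (a : Fin 5 → ℂ) : Fin 5 → ℂ :=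
  ![-a 0, -a 1, -a 2 - a 0 * a 1, -a 3 - a 0 * a 2 - a 0 ^ 2 * a 1 / 2,
    -a 4 - a 1 * a 2 - a 0 * a 1 ^ 2 / 2]

instance : Mul I5Group := ⟨mulFun⟩
instance : Inv I5Group := ⟨invFun⟩
instance : One I5Group := ⟨(0 : Fin 5 → ℂ)⟩

instance : Group I5Group :=
  Group.ofLeftAxioms
    (fun a b c => by
      change mulFun (mulFun a b) c = mulFun a (mulFun b c)
      ext j; fin_cases j <;> simp [mulFun] <;> ring)
    (fun a => by
      change mulFun 0 a = a
      ext j; fin_cases j <;> simp [mulFun])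
    (fun a => by
      change mulFun (invFun a) a = 0
      ext j; fin_cases j <;> simp [mulFun, invFun] <;> ring)

instance : IsTopologicalGroup I5Group where
  continuous_mul := by
    change Continuous fun p : (Fin 5 → ℂ) × (Fin 5 → ℂ) => mulFun p.1 p.2
    refine continuous_pi fun j => ?_
    fin_cases j <;> simp [mulFun] <;> fun_prop
  continuous_inv := by
    change Continuous invFun
    refine continuous_pi fun j => ?_
    fin_cases j <;> simp [invFun] <;> fun_prop

/-- The quotient of the group by a discrete subgroup is a complex manifold. -/
instance (Γ : Subgroup I5Group) [DiscreteTopology Γ] :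
    IsManifold 𝓘(ℂ, Fin 5 → ℂ) ((⊤ : ℕ∞) : WithTop ℕ∞) (LeftQuotient Γ) := by
  refine isManifold_quotient _ _ fun g => ?_
  refine ContDiff.contMDiff (f := mulFun (g : I5Group)) (contDiff_pi.mpr fun j => ?_)
  fin_cases j <;> simp [mulFun] <;> fun_prop

/-- The left-invariant forms `dz₀`, `dz₁`, `dz₂ + z₀ dz₁`, `dz₃ + z₀ dz₂ + z₀²/2 dz₁`,
`dz₄ + z₁ dz₂`. -/
def frame (j : Fin 5) : DForm 𝓘(ℝ, Fin 5 → ℂ) I5Group 1 := fun z =>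
  oneForm (V := Fin 5 → ℂ)
    (![dz 0, dz 1, dz 2 + (z 0 : ℂ) • dz 1,
      dz 3 + (z 0 : ℂ) • dz 2 + ((z 0 : ℂ) ^ 2 / 2) • dz 1,
      dz 4 + (z 1 : ℂ) • dz 2] j)

end I5Group

/-! ### The Calabi-Eckmann manifold `S³ × S³` and its deformations -/

instance : Fact (Module.finrank ℝ ℍ[ℝ] = 3 + 1) := ⟨Quaternion.finrank_eq_four⟩

/-- The unit quaternions. -/
abbrev S3 : Type := Metric.sphere (0 : ℍ[ℝ]) 1

/-- The model with corners of `S³ × S³`. -/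
abbrev modelS3S3 := (𝓡 3).prod (𝓡 3)

/-- The left-invariant form `x⁻¹ dx` of the first factor of `S³ × S³`, with values in the
imaginary quaternions. -/
def maurerCartan₁ (p : S3 × S3) : TangentSpace modelS3S3 p →L[ℝ] ℍ[ℝ] :=
  (ContinuousLinearMap.mul ℝ ℍ[ℝ] (star (p.1 : ℍ[ℝ]))).comp
    (mfderiv modelS3S3 𝓘(ℝ, ℍ[ℝ]) (fun q : S3 × S3 => (q.1 : ℍ[ℝ])) p)

/-- The left-invariant form `y⁻¹ dy` of the second factor of `S³ × S³`, with values in the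
imaginary quaternions. -/
def maurerCartan₂ (p : S3 × S3) : TangentSpace modelS3S3 p →L[ℝ] ℍ[ℝ] :=
  (ContinuousLinearMap.mul ℝ ℍ[ℝ] (star (p.2 : ℍ[ℝ]))).comp
    (mfderiv modelS3S3 𝓘(ℝ, ℍ[ℝ]) (fun q : S3 × S3 => (q.2 : ℍ[ℝ])) p)

/-- `a ↦ a_i + i a_j` on quaternions `a = a_1 + a_i i + a_j j + a_k k`. -/
def quatIJ : ℍ[ℝ] →L[ℝ] ℂ := LinearMap.toContinuousLinearMap
  { toFun := fun a => ⟨a.imI, a.imJ⟩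
    map_add' := fun _ _ => rfl
    map_smul' := fun c a => by apply Complex.ext <;> simp }

/-- `a ↦ a_k` on quaternions `a = a_1 + a_i i + a_j j + a_k k`. -/
def quatK : ℍ[ℝ] →L[ℝ] ℂ := LinearMap.toContinuousLinearMap
  { toFun := fun a => (a.imK : ℂ)
    map_add' := fun _ _ => by simp
    map_smul' := fun c a => by simp }

/-- The coframe `φ_t¹ = e₁ + i e₂`, `φ_t² = f₁ + i f₂`, `φ_t³ = φ³ - t conj φ³` with
`φ³ = e₃ + i f₃`, where `e₁, e₂, e₃` (resp. `f₁, f₂, f₃`) are the components along `i, j, k` of the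
left-invariant form of the first (resp. second) factor. -/
def ceFunctional (t : ℂ) (j : Fin 3) (p : S3 × S3) : TangentSpace modelS3S3 p →L[ℝ] ℂ :=
  let φ : TangentSpace modelS3S3 p →L[ℝ] ℂ :=
    quatK.comp (maurerCartan₁ p) + Complex.I • quatK.comp (maurerCartan₂ p)
  ![quatIJ.comp (maurerCartan₁ p), quatIJ.comp (maurerCartan₂ p),
    φ - t • (Complex.conjCLE : ℂ →L[ℝ] ℂ).comp φ] j

/-- The `1`-forms `φ_t^j`. -/
def ceFrame (t : ℂ) (j : Fin 3) : DForm modelS3S3 (S3 × S3) 1 := fun p =>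
  oneForm (ceFunctional t j p)

/-- The almost complex structure `J_t` on `S³ × S³` for which `φ_t¹, φ_t², φ_t³` are of type
`(1,0)`, obtained by transporting the multiplication by `i` of `ℂ³` by means of the coframe. -/
def ceJ (t : ℂ) : EndField modelS3S3 (S3 × S3) := fun p =>
  let Φ : TangentSpace modelS3S3 p →L[ℝ] (Fin 3 → ℂ) :=
    ContinuousLinearMap.pi fun j => ceFunctional t j p
  Φ.inverse.comp ((Complex.I • ContinuousLinearMap.id ℝ (Fin 3 → ℂ)).comp Φ)

/-- The metric `ω_t = (1/2) ∑ⱼ i φ_t^j ∧ conj φ_t^j`. -/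
def ceMetric (t : ℂ) : DForm modelS3S3 (S3 × S3) 2 :=
  (1 / 2 : ℂ) • stdMetric (ceFrame t)

end PSS

end

set_option linter.unusedSectionVars false
set_option linter.unusedSimpArgs false

/-! ### The signed shuffle algebra of functions on lists -/

noncomputable section
namespace PSS

/-! In all four families the metric is `ω = ∑ ξ_j`, with `ξ_j = i θ_j ∧ conj θ_j`, for a global
smooth coframe `θ` of type `(1,0)` whose differentials have constant coefficients in the products of
the `θ_j` and their conjugates. Once the structure equations of the coframe are established on the
manifold, everything else is computation in an exterior algebra.

Reduction to numbers: suppose that `i∂∂̄ω_{n-2} = ω_{n-2} ∧ ∑ r_j ξ_j`. Then `ρ = ∑ r_j ξ_j`. Since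
`⋆ξ_j = ∏_{l ≠ j} ξ_l`, the numbers `r_j` are the eigenvalues of `⋆ρ`; and since `ω ∧ ω_{n-2} ∧ ξ_j
= (n-1) ω_n`, the associated function is `(n-1) ∑ r_j`. This is the content of
`IsCoframe.exists_star`, `IsCoframe.isRho` and `toSh_mul_divPow_mul`.

The three quotients: here `dθ_j = c_j` is of type `(2,0)`, whence `i∂∂̄ω = ∑ c_j ∧ conj c_j`. In
dimension three `ω ∧ ∑ r_j ξ_j = ∑_{j<k} (r_j + r_k) ξ_j ξ_k`, so the eigenvalues solve three linear
equations: the right-hand side is `ξ_0 ξ_1` for the Heisenberg coframe and `ξ_0 ξ_1 + ξ_0 ξ_2` for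
the Nakamura coframe. In dimension five `i∂∂̄ω_3 = (1/2) ω² ∧ i∂∂̄ω + i ω ∧ ∂ω ∧ ∂̄ω`, and the
factorisation by `ω_3` is the polynomial identity `sum_mul_five` between elements of square zero.
The structure equations descend to the quotient because the coframe is left-invariant
(`exists_coframe_quotient`).

The deformations of `S³ × S³`: the Maurer-Cartan equation of the unit quaternions
(`hasD_maurerCartan`) gives a coframe with `ξ_0`, `ξ_1` closed and `dθ_2 = p ξ_0 + q ξ_1`. Then
`i∂∂̄ω = 2l ξ_0 ξ_1` with `-2l = p conj q + q conj p`, the eigenvalues are `l, l, -l`, and `d⋆ρ = l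
(ξ_0 + ξ_1) ∧ dξ_2`, which vanishes only for `l = 0` when `p + q ≠ 0` (`IsCoframe.calabiEckmann`).
That last implication speaks of every admissible `⋆ρ`, so it needs the uniqueness of `ρ` and of the
Hodge star (`IsCoframe.isStarRho_unique`).

Formal device: forms of all degrees on a vector space are embedded by `toSh` in a single ring, the
functions on finite lists of vectors with the signed shuffle product. Degrees then disappear from
the types, associativity and graded commutativity are honest ring identities, and the computations
are done by `simp` and `module`. The relation `HasD k a b` says that the field `a` comes from a
smooth `k`-form with exterior derivative `b`; it is closed under sums, products and conjugation. -/

/-- Complex-valued functions on lists of vectors; a form of degree `k` becomes a function supported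
on the lists of length `k`. The wedge product becomes the signed shuffle product. -/
def Sh (V : Type*) : Type _ := List V → ℂ

namespace Sh

variable {V : Type*}

instance : AddCommGroup (Sh V) := inferInstanceAs (AddCommGroup (List V → ℂ))
instance : Module ℂ (Sh V) := inferInstanceAs (Module ℂ (List V → ℂ))

@[ext] theorem ext {F G : Sh V} (h : ∀ l, F l = G l) : F = G := funext h

@[simp] theorem add_apply (F G : Sh V) (l : List V) : (F + G) l = F l + G l := rfl
@[simp] theorem sub_apply (F G : Sh V) (l : List V) : (F - G) l = F l - G l := rfl
@[simp] theorem neg_apply (F : Sh V) (l : List V) : (-F) l = -F l := rfl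
@[simp] theorem zero_apply (l : List V) : (0 : Sh V) l = 0 := rfl
@[simp] theorem smul_apply (c : ℂ) (F : Sh V) (l : List V) : (c • F) l = c * F l := rfl

theorem sum_apply {ι : Type*} (s : Finset ι) (F : ι → Sh V) (l : List V) :
    (∑ i ∈ s, F i) l = ∑ i ∈ s, F i l := Finset.sum_apply (M := fun _ : List V => ℂ) l s F

/-- The contraction with a vector. -/
def ctr (v : V) : Sh V →ₗ[ℂ] Sh V where
  toFun F := fun l => F (v :: l)
  map_add' _ _ := rfl
  map_smul' _ _ := rfl

/-- The parity involution, which multiplies the component of degree `k` by `(-1)^k`. -/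
def par : Sh V →ₗ[ℂ] Sh V where
  toFun F := fun l => (-1) ^ l.length * F l
  map_add' _ _ := funext fun _ => mul_add _ _ _
  map_smul' _ _ := funext fun _ => mul_left_comm _ _ _

theorem ctr_apply (v : V) (F : Sh V) (l : List V) : ctr v F l = F (v :: l) := rfl
theorem par_apply (F : Sh V) (l : List V) : par F l = (-1) ^ l.length * F l := rfl

theorem ctr_par (v : V) (F : Sh V) : ctr v (par F) = -par (ctr v F) := by
  ext l; simp [ctr_apply, par_apply, pow_succ]

@[simp] theorem par_par (F : Sh V) : par (par F) = F := by
  ext l; simp [par_apply, ← mul_assoc, ← mul_pow]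

/-- The signed shuffle product evaluated on a list. -/
def mulAux : List V → Sh V → Sh V → ℂ
  | [], F, G => F [] * G []
  | v :: l, F, G => mulAux l (ctr v F) G + mulAux l (par F) (ctr v G)

instance : Mul (Sh V) := ⟨fun F G l => mulAux l F G⟩

instance : One (Sh V) := ⟨fun l => if l = [] then 1 else 0⟩

@[simp] theorem one_nil : (1 : Sh V) [] = 1 := rfl

@[simp] theorem ctr_one (v : V) : ctr v (1 : Sh V) = 0 := by
  ext l; rfl

@[simp] theorem par_one : par (1 : Sh V) = 1 := by
  ext l
  cases l with
  | nil => simp [par_apply]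
  | cons v l => rw [par_apply, ← ctr_apply v 1, ctr_one]; simp

@[simp] theorem mul_nil (F G : Sh V) : (F * G) [] = F [] * G [] := rfl

theorem mul_cons (F G : Sh V) (v : V) (l : List V) :
    (F * G) (v :: l) = (ctr v F * G) l + (par F * ctr v G) l := rfl

theorem mul_add' (F G H : Sh V) : F * (G + H) = F * G + F * H := by
  ext l
  induction l generalizing F G H with
  | nil => simp [mul_add]
  | cons v l ih => simp only [mul_cons, map_add, ih, add_apply]; ring

theorem add_mul' (F G H : Sh V) : (F + G) * H = F * H + G * H := by
  ext l
  induction l generalizing F G H with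
  | nil => simp [add_mul]
  | cons v l ih => simp only [mul_cons, map_add, ih, add_apply]; ring

theorem zero_mul' (F : Sh V) : 0 * F = 0 := by
  have := add_mul' 0 0 F
  simpa using this

theorem mul_zero' (F : Sh V) : F * 0 = 0 := by
  have := mul_add' F 0 0
  simpa using this

theorem smul_mul' (c : ℂ) (F G : Sh V) : (c • F) * G = c • (F * G) := by
  ext l
  induction l generalizing F G with
  | nil => simp [mul_assoc]
  | cons v l ih => simp only [mul_cons, map_smul, ih, smul_apply]; ring

theorem mul_smul' (c : ℂ) (F G : Sh V) : F * (c • G) = c • (F * G) := by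
  ext l
  induction l generalizing F G with
  | nil => simp; ring
  | cons v l ih => simp only [mul_cons, map_smul, ih, smul_apply]; ring

theorem par_mul (F G : Sh V) : par (F * G) = par F * par G := by
  ext l
  induction l generalizing F G with
  | nil => simp [par_apply]
  | cons v l ih =>
    have h1 := ih (ctr v F) G
    have h2 := ih (par F) (ctr v G)
    have e : ∀ A B : Sh V, (-A * B) = -(A * B) := fun A B => by
      rw [← neg_one_smul ℂ A, smul_mul', neg_one_smul]
    have e' : ∀ A B : Sh V, (A * -B) = -(A * B) := fun A B => by
      rw [← neg_one_smul ℂ B, mul_smul', neg_one_smul]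
    rw [mul_cons, ctr_par, ctr_par, e, e', neg_apply, neg_apply, ← h1, ← h2]
    simp only [par_apply, mul_cons, List.length_cons, pow_succ]
    ring

theorem ctr_mul (v : V) (F G : Sh V) : ctr v (F * G) = ctr v F * G + par F * ctr v G := rfl

/-- The product is defined so that every contraction is a graded derivation (`ctr_mul`); both
bracketings then obey the same recursion on the length of the list. Alternation plays no role here.
-/
theorem mul_assoc' (F G H : Sh V) : F * G * H = F * (G * H) := by
  ext l
  induction l generalizing F G H with
  | nil => simp [mul_assoc]
  | cons v l ih =>
    rw [mul_cons, mul_cons, ctr_mul, ctr_mul, add_mul', mul_add', par_mul]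
    simp only [add_apply, ih]
    ring

theorem one_mul' (F : Sh V) : 1 * F = F := by
  ext l
  induction l generalizing F with
  | nil => simp
  | cons v l ih => rw [mul_cons, ctr_one, par_one, zero_mul', ih]; simp [ctr_apply]

theorem mul_one' (F : Sh V) : F * 1 = F := by
  ext l
  induction l generalizing F with
  | nil => simp
  | cons v l ih => rw [mul_cons, ctr_one, mul_zero', ih]; simp [ctr_apply]

instance : Ring (Sh V) :=
  { (inferInstance : AddCommGroup (Sh V)) with
    mul_assoc := mul_assoc'
    one_mul := one_mul'
    mul_one := mul_one'
    left_distrib := mul_add'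
    right_distrib := add_mul'
    zero_mul := zero_mul'
    mul_zero := mul_zero' }

instance : Algebra ℂ (Sh V) := Algebra.ofModule smul_mul' mul_smul'

/-- Contraction exchanges even and odd elements, so neither parity can be treated alone: the
induction carries both statements at once. -/
theorem mul_comm_graded (l : List V) : ∀ F G : Sh V,
    (par F = F → (F * G) l = (G * F) l) ∧ (par F = -F → (F * G) l = (par G * F) l) := by
  induction l with
  | nil => exact fun F G => ⟨fun _ => by simp [mul_comm], fun _ => by simp [mul_comm, par_apply]⟩
  | cons v l ih =>
    intro F G
    constructor
    · intro h
      have h1 : par (ctr v F) = -ctr v F := by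
        rw [← neg_eq_iff_eq_neg, ← ctr_par, h]
      rw [mul_cons, mul_cons, (ih _ _).2 h1, h, (ih F _).1 h]
      ring
    · intro h
      have h1 : par (ctr v F) = ctr v F := by
        rw [← neg_inj, ← ctr_par, h, map_neg]
      rw [mul_cons, mul_cons, (ih _ _).1 h1, h, ctr_par, par_par, neg_mul, neg_mul, neg_apply,
        neg_apply, (ih F _).2 h]
      ring

theorem commute_of_even {F : Sh V} (h : par F = F) (G : Sh V) : F * G = G * F :=
  ext fun l => (mul_comm_graded l F G).1 h

theorem mul_eq_par_mul_of_odd {F : Sh V} (h : par F = -F) (G : Sh V) : F * G = par G * F :=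
  ext fun l => (mul_comm_graded l F G).2 h

theorem anticomm_of_odd {F G : Sh V} (hF : par F = -F) (hG : par G = -G) : F * G = -(G * F) := by
  rw [mul_eq_par_mul_of_odd hF, hG, neg_mul]

theorem mul_self_of_odd {F : Sh V} (hF : par F = -F) : F * F = 0 :=
  ext fun l => self_eq_neg.mp (congrFun (anticomm_of_odd hF hF) l)

/-- The action of a map on the arguments, as a linear map. -/
def pullLin {W : Type*} (f : W → V) : Sh V →ₗ[ℂ] Sh W where
  toFun F := fun l => F (l.map f)
  map_add' _ _ := rfl
  map_smul' _ _ := rfl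

theorem pullLin_apply {W : Type*} (f : W → V) (F : Sh V) (l : List W) :
    pullLin f F l = F (l.map f) := rfl

theorem pullLin_par {W : Type*} (f : W → V) (F : Sh V) :
    pullLin f (par F) = par (pullLin f F) := by
  ext l
  rw [pullLin_apply, par_apply, par_apply, pullLin_apply, List.length_map]

theorem pullLin_mul {W : Type*} (f : W → V) (F G : Sh V) :
    pullLin f (F * G) = pullLin f F * pullLin f G := by
  ext l
  rw [pullLin_apply]
  induction l generalizing F G with
  | nil => rfl
  | cons v l ih =>
    rw [List.map_cons, mul_cons, mul_cons, ih, ih, pullLin_par]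
    rfl

/-- The action of a map on the arguments. -/
def pull {W : Type*} (f : W → V) : Sh V →ₐ[ℂ] Sh W :=
  AlgHom.ofLinearMap (pullLin f) (by ext l; cases l <;> rfl) (pullLin_mul f)

theorem pull_apply {W : Type*} (f : W → V) (F : Sh V) (l : List W) : pull f F l = F (l.map f) :=
  rfl

/-- The complex conjugate. -/
def conj (F : Sh V) : Sh V := fun l => starRingEnd ℂ (F l)

theorem conj_apply (F : Sh V) (l : List V) : conj F l = starRingEnd ℂ (F l) := rfl

@[simp] theorem conj_add (F G : Sh V) : conj (F + G) = conj F + conj G := by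
  ext l; simp [conj_apply]

@[simp] theorem conj_smul (c : ℂ) (F : Sh V) : conj (c • F) = starRingEnd ℂ c • conj F := by
  ext l; simp [conj_apply]

@[simp] theorem conj_neg (F : Sh V) : conj (-F) = -conj F := by
  ext l; simp [conj_apply]

@[simp] theorem conj_conj (F : Sh V) : conj (conj F) = F := by
  ext l; simp [conj_apply]

@[simp] theorem conj_zero : conj (0 : Sh V) = 0 := by
  ext l; simp [conj_apply]

theorem conj_mul (F G : Sh V) : conj (F * G) = conj F * conj G := by
  ext l
  rw [conj_apply]
  induction l generalizing F G with
  | nil => simp [conj_apply]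
  | cons v l ih =>
    have h : conj (par F) = par (conj F) := by
      ext m
      simp [par_apply, conj_apply]
    rw [mul_cons, mul_cons, map_add, ih, ih, h]
    rfl

/-- The alternation of a family of elements depending on a vector. -/
def altAux : List V → (V → Sh V) → ℂ
  | [], _ => 0
  | v :: l, L => L v l - altAux l (fun u => ctr v (L u))

/-- The alternation of a family of elements depending on a vector. -/
def alt (L : V → Sh V) : Sh V := fun l => altAux l L

@[simp] theorem alt_nil (L : V → Sh V) : alt L [] = 0 := rfl

theorem ctr_alt (v : V) (L : V → Sh V) : ctr v (alt L) = L v - alt (fun u => ctr v (L u)) := rfl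

theorem alt_cons (v : V) (L : V → Sh V) (l : List V) :
    alt L (v :: l) = L v l - alt (fun u => ctr v (L u)) l := rfl

theorem alt_add (L K : V → Sh V) : alt (fun u => L u + K u) = alt L + alt K := by
  ext l
  induction l generalizing L K with
  | nil => simp
  | cons v l ih => simp only [alt_cons, map_add, ih, add_apply]; ring

theorem alt_smul (c : ℂ) (L : V → Sh V) : alt (fun u => c • L u) = c • alt L := by
  ext l
  induction l generalizing L with
  | nil => simp
  | cons v l ih => simp only [alt_cons, map_smul, ih, smul_apply]; ring

theorem alt_neg (L : V → Sh V) : alt (fun u => -L u) = -alt L := by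
  simpa using alt_smul (-1) L

theorem alt_par (L : V → Sh V) : alt (fun u => par (L u)) = -par (alt L) := by
  ext l
  induction l generalizing L with
  | nil => simp [par_apply]
  | cons v l ih =>
    simp only [alt_cons, ctr_par, alt_neg, ih, neg_apply, par_apply, List.length_cons]
    ring

/-- With `alt_mul_left`, this is the algebraic half of the Leibniz rule: `d` is the alternation of
the derivative, and the sign `par F` there comes from carrying the differentiation vector past the
arguments of `F`. -/
theorem alt_mul_right (L : V → Sh V) (G : Sh V) : alt (fun u => L u * G) = alt L * G := by
  ext l
  induction l generalizing L G with
  | nil => simp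
  | cons v l ih =>
    rw [alt_cons, mul_cons, ctr_alt, sub_mul]
    simp only [ctr_mul, alt_add, add_apply, ih, alt_par, neg_mul, neg_apply, sub_apply]
    ring

theorem alt_mul_left (F : Sh V) (L : V → Sh V) : alt (fun u => F * L u) = par F * alt L := by
  ext l
  induction l generalizing F L with
  | nil => simp
  | cons v l ih =>
    rw [alt_cons, mul_cons, ctr_alt, ctr_par, par_par, mul_sub]
    simp only [ctr_mul, alt_add, add_apply, ih, par_par, neg_mul, neg_apply, sub_apply]
    ring

end Sh
end PSS
end

/-! ### Shuffle products as signed sums over all permutations -/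

noncomputable section
namespace PSS

theorem ofFn_insertNth {V : Type*} {n : ℕ} (i : Fin (n + 1)) (v : V) (w : Fin n → V) :
    List.ofFn (i.insertNth (α := fun _ => V) v w) =
      (List.ofFn w).take i ++ v :: (List.ofFn w).drop i := by
  have hi := i.isLt
  apply List.ext_getElem
  · simp; omega
  · intro j h1 h2
    have h3 : j < n + 1 := by simpa using h1
    rw [List.getElem_ofFn]
    rcases lt_trichotomy j i with h | h | h
    · rw [List.getElem_append_left (by simp; omega)]
      rw [Fin.insertNth_apply_below (by simpa [Fin.lt_def] using h)]
      simp
      rfl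
    · have : (⟨j, h3⟩ : Fin (n + 1)) = i := Fin.ext h
      rw [List.getElem_append_right (by simp; omega)]
      have h6 : (i : ℕ) - min (i : ℕ) n = 0 := by omega
      simp [h, h6]
    · rw [List.getElem_append_right (by simp; omega)]
      rw [Fin.insertNth_apply_above (by simpa [Fin.lt_def] using h)]
      have h5 : j - min (i : ℕ) n = (j - i - 1) + 1 := by omega
      simp only [List.length_take, List.length_ofFn, h5, List.getElem_cons_succ, List.getElem_drop,
        List.getElem_ofFn, eq_rec_constant]
      congr 1
      ext
      simp
      omega

/-- The signed sum over all permutations of the arguments. -/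
def altSum {V : Type*} {n : ℕ} (f : (Fin n → V) → ℂ) (v : Fin n → V) : ℂ :=
  ∑ σ : Equiv.Perm (Fin n), ((Equiv.Perm.sign σ : ℤ) : ℂ) * f (v ∘ σ)

/-- Permutations are sorted by the place `i` that receives the first vector. Such a permutation is
the cycle bringing place `i` to the front, of sign `(-1) ^ i`, followed by a permutation of the
remaining arguments. -/
theorem altSum_cons {V : Type*} {n : ℕ} (f : (Fin (n + 1) → V) → ℂ) (v : V) (t : Fin n → V) :
    altSum f (Matrix.vecCons v t) =
      ∑ i : Fin (n + 1), (-1) ^ (i : ℕ) *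
        altSum (fun w => f (i.insertNth (α := fun _ => V) v w)) t := by
  simp only [altSum, Finset.mul_sum]
  rw [← Fintype.sum_prod_type']
  let g : Fin (n + 1) × Equiv.Perm (Fin n) → Equiv.Perm (Fin (n + 1)) := fun p =>
    Equiv.Perm.decomposeFin.symm (0, p.2) * p.1.cycleRange
  have hg0 : ∀ p, g p p.1 = 0 := fun p => by simp [g]
  have hg1 : ∀ p j, g p (p.1.succAbove j) = (p.2 j).succ := fun p j => by
    simp [g]
  have hg : Function.Bijective g := by
    rw [Fintype.bijective_iff_injective_and_card]
    constructor
    · intro p q hpq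
      have h1 : p.1 = q.1 := by
        apply (g q).injective
        rw [hg0, ← hpq, hg0]
      refine Prod.ext h1 (Equiv.ext fun j => ?_)
      have h2 := hg1 p j
      rw [hpq, h1, hg1] at h2
      exact (Fin.succ_injective _ h2).symm
    · simp [Fintype.card_perm, Nat.factorial_succ]
  rw [← hg.sum_comp]
  refine Finset.sum_congr rfl fun p _ => ?_
  have h1 : ((Equiv.Perm.sign (g p) : ℤ) : ℂ) =
      (-1) ^ (p.1 : ℕ) * ((Equiv.Perm.sign p.2 : ℤ) : ℂ) := by
    simp [g, Equiv.Perm.decomposeFin.symm_sign, mul_comm]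
  have h2 : Matrix.vecCons v t ∘ g p = p.1.insertNth (α := fun _ => V) v (t ∘ p.2) := by
    funext j
    refine Fin.succAboveCases p.1 ?_ (fun j => ?_) j
    · simp [hg0]
    · simp [hg1]
  rw [h1, h2, mul_assoc]

namespace Sh

variable {V : Type*}

/-- The element is alternating. -/
def IsAlt (F : Sh V) : Prop :=
  ∀ l m v, F (l ++ v :: m) = (-1) ^ l.length * F (v :: (l ++ m))

/-- The element is supported on the lists of length `k`. -/
def IsHom (k : ℕ) (F : Sh V) : Prop := ∀ l : List V, l.length ≠ k → F l = 0

theorem IsAlt.ctr {F : Sh V} (h : IsAlt F) (v : V) : IsAlt (ctr v F) := by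
  intro l m u
  have h1 := h (v :: l) m u
  have h2 := h [v] (l ++ m) u
  simp only [ctr_apply, List.cons_append, List.nil_append, List.length_cons, List.length_nil,
    pow_succ, pow_zero] at *
  rw [h1, h2]; ring

theorem IsHom.ctr {k : ℕ} {F : Sh V} (h : IsHom (k + 1) F) (v : V) : IsHom k (ctr v F) :=
  fun l hl => h _ (by simpa using hl)

theorem IsHom.par {k : ℕ} {F : Sh V} (h : IsHom k F) : par F = (-1 : ℂ) ^ k • F := by
  ext l
  rw [par_apply, smul_apply]
  by_cases hl : l.length = k
  · rw [hl]
  · rw [h l hl]; simp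

theorem IsHom.ctr_zero {F : Sh V} (h : IsHom 0 F) (v : V) : Sh.ctr v F = 0 := by
  ext l
  exact h _ (by simp)

/-- The identification of the wedge product with the shuffle product. The first vector lands in one
of the `p` arguments of `F` or one of the `q` arguments of `G`; alternation moves it to the front,
and the two groups reproduce the two terms of the recursion defining the product. -/
theorem altSum_cat {n : ℕ} : ∀ {p q : ℕ} {F G : Sh V}, p + q = n → IsHom p F → IsHom q G →
    IsAlt F → IsAlt G → ∀ v : Fin n → V,
    altSum (fun w => F ((List.ofFn w).take p) * G ((List.ofFn w).drop p)) v =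
      (p.factorial * q.factorial : ℂ) * (F * G) (List.ofFn v) := by
  induction n with
  | zero =>
    intro p q F G hn _ _ _ _ v
    obtain ⟨rfl, rfl⟩ : p = 0 ∧ q = 0 := by omega
    simp [altSum]
  | succ n ih =>
    intro p q F G hn hF hG aF aG v
    obtain ⟨x, t, rfl⟩ : ∃ x t, v = Matrix.vecCons x t := ⟨v 0, Fin.tail v, (Fin.cons_self_tail v).symm⟩
    have hlist : List.ofFn (Matrix.vecCons x t) = x :: List.ofFn t := by
      simp [List.ofFn_succ]
    rw [altSum_cons, hlist, mul_cons]
    have key : ∀ i : Fin (n + 1), ((-1) ^ (i : ℕ) * altSum (fun w =>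
        F ((List.ofFn (i.insertNth (α := fun _ => V) x w)).take p) *
        G ((List.ofFn (i.insertNth (α := fun _ => V) x w)).drop p)) t : ℂ) =
        if (i : ℕ) < p then (p - 1).factorial * q.factorial * (Sh.ctr x F * G) (List.ofFn t)
        else (-1) ^ p * (p.factorial * (q - 1).factorial) * (F * Sh.ctr x G) (List.ofFn t) := by
      intro i
      split_ifs with hi
      · obtain ⟨p, rfl⟩ : ∃ p', p = p' + 1 := ⟨p - 1, by omega⟩
        rw [Nat.add_sub_cancel, ← ih (by omega) (hF.ctr x) hG (aF.ctr x) aG]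
        simp only [altSum, Finset.mul_sum]
        refine Finset.sum_congr rfl fun σ _ => ?_
        rw [ofFn_insertNth]
        generalize hL : List.ofFn (t ∘ σ) = L
        have hLl : L.length = n := by rw [← hL]; simp
        have e1 : (L.take i ++ x :: L.drop i).take (p + 1) =
            L.take i ++ x :: (L.drop i).take (p - i) := by
          rw [List.take_append, List.take_of_length_le (by simp; omega)]
          have : p + 1 - (L.take i).length = (p - i) + 1 := by simp; omega
          rw [this, List.take_succ_cons]
        have e2 : (L.take i ++ x :: L.drop i).drop (p + 1) = L.drop p := by
          rw [List.drop_append, List.drop_of_length_le (by simp; omega)]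
          have : p + 1 - (L.take i).length = (p - i) + 1 := by simp; omega
          rw [this, List.drop_succ_cons, List.drop_drop, List.nil_append]
          congr 1; omega
        have e3 : L.take i ++ (L.drop i).take (p - i) = L.take p := by
          have := List.take_add (l := L) (i := i) (j := p - i)
          rw [← this]; congr 1; omega
        have e4 : (L.take i).length = i := by simp; omega
        rw [e1, e2, aF, e3, e4, Sh.ctr_apply]
        have : ((-1 : ℂ) ^ (i : ℕ)) * (-1) ^ (i : ℕ) = 1 := by rw [← mul_pow]; simp
        linear_combination ((Equiv.Perm.sign σ : ℤ) : ℂ) * F (x :: L.take p) * G (L.drop p) * this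
      · obtain ⟨q, rfl⟩ : ∃ q', q = q' + 1 := ⟨q - 1, by omega⟩
        rw [Nat.add_sub_cancel, mul_assoc, ← ih (by omega) hF (hG.ctr x) aF (aG.ctr x)]
        simp only [altSum, Finset.mul_sum]
        refine Finset.sum_congr rfl fun σ _ => ?_
        rw [ofFn_insertNth]
        generalize hL : List.ofFn (t ∘ σ) = L
        have hLl : L.length = n := by rw [← hL]; simp
        have e1 : (L.take i ++ x :: L.drop i).take p = L.take p := by
          rw [List.take_append_of_le_length (by simp; omega), List.take_take]
          congr 1; omega
        have e2 : (L.take i ++ x :: L.drop i).drop p = (L.take i).drop p ++ x :: L.drop i := by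
          rw [List.drop_append_of_le_length (by simp; omega)]
        have e3 : (L.take i).drop p ++ L.drop i = L.drop p := by
          conv_rhs => rw [← List.take_append_drop i L]
          rw [List.drop_append_of_le_length (by simp; omega)]
        have e4 : ((L.take i).drop p).length = i - p := by simp; omega
        rw [e1, e2, aG, e3, e4, Sh.ctr_apply]
        -- The place of the vector contributes `(-1) ^ i` and moving it to the front of `G`
        -- contributes `(-1) ^ (i - p)`; what is left is the parity sign of `F` in the recursion.
        have : ((-1 : ℂ) ^ (i : ℕ)) * (-1) ^ (i - p : ℕ) = (-1) ^ p := by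
          rw [← pow_add, show (i : ℕ) + (i - p) = p + 2 * (i - p) by omega, pow_add, pow_mul]; simp
        linear_combination ((Equiv.Perm.sign σ : ℤ) : ℂ) * F (L.take p) * G (x :: L.drop p) * this
    simp only [key]
    rw [Finset.sum_ite, Finset.sum_const, Finset.sum_const, hF.par, smul_mul_assoc, smul_apply]
    have c1 : (Finset.univ.filter fun i : Fin (n + 1) => (i : ℕ) < p).card = p := by
      rw [Fin.card_filter_val_lt]; omega
    have c2 : (Finset.univ.filter fun i : Fin (n + 1) => ¬(i : ℕ) < p).card = q := by
      have := Finset.card_filter_add_card_filter_not (s := (Finset.univ : Finset (Fin (n + 1))))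
        (fun i => (i : ℕ) < p)
      rw [c1, Finset.card_univ, Fintype.card_fin] at this
      omega
    rw [c1, c2, nsmul_eq_mul, nsmul_eq_mul]
    -- For `p = 0` the truncated `p - 1` carries no meaning, and both sides vanish because a form of
    -- degree zero has zero contraction.
    have f1 : (p : ℂ) * ((p - 1).factorial * q.factorial * (Sh.ctr x F * G) (List.ofFn t)) =
        p.factorial * q.factorial * (Sh.ctr x F * G) (List.ofFn t) := by
      cases p with
      | zero => rw [hF.ctr_zero]; simp
      | succ p => rw [Nat.add_sub_cancel, Nat.factorial_succ]; push_cast; ring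
    have f2 : (q : ℂ) * ((-1) ^ p * (p.factorial * (q - 1).factorial) *
        (F * Sh.ctr x G) (List.ofFn t)) =
        p.factorial * q.factorial * ((-1) ^ p * (F * Sh.ctr x G) (List.ofFn t)) := by
      cases q with
      | zero => rw [hG.ctr_zero]; simp
      | succ q => rw [Nat.add_sub_cancel, Nat.factorial_succ]; push_cast; ring
    rw [f1, f2]; ring

end Sh
end PSS
end

/-! ### Embedding alternating forms in the shuffle algebra -/

noncomputable section
namespace PSS

section ToSh

variable {V : Type*} [AddCommGroup V] [Module ℝ V] [TopologicalSpace V]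

/-- A form as an element of the shuffle algebra. -/
def toSh {k : ℕ} (α : V [⋀^Fin k]→L[ℝ] ℂ) : Sh V := fun l =>
  if h : l.length = k then α (fun i => l.get (i.cast h.symm)) else 0

theorem toSh_ofFn {k : ℕ} (α : V [⋀^Fin k]→L[ℝ] ℂ) (v : Fin k → V) :
    toSh α (List.ofFn v) = α v := by
  rw [toSh, dif_pos (List.length_ofFn)]
  congr 1
  funext i
  simp

theorem exists_ofFn {W : Type*} {k : ℕ} {l : List W} (h : l.length = k) :
    ∃ v : Fin k → W, l = List.ofFn v := by
  subst h
  exact ⟨l.get, (List.ofFn_get l).symm⟩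

theorem toSh_isHom {k : ℕ} (α : V [⋀^Fin k]→L[ℝ] ℂ) : (toSh α).IsHom k := fun _ hl =>
  dif_neg hl

theorem par_toSh {k : ℕ} (α : V [⋀^Fin k]→L[ℝ] ℂ) : Sh.par (toSh α) = (-1 : ℂ) ^ k • toSh α :=
  (toSh_isHom α).par

theorem Sh.IsHom.ext {V : Type*} {k : ℕ} {F G : Sh V} (hF : F.IsHom k) (hG : G.IsHom k)
    (h : ∀ v : Fin k → V, F (List.ofFn v) = G (List.ofFn v)) : F = G := by
  ext l
  by_cases hl : l.length = k
  · obtain ⟨v, rfl⟩ := exists_ofFn hl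
    exact h v
  · rw [hF l hl, hG l hl]

theorem toSh_injective {k : ℕ} : Function.Injective (toSh (V := V) (k := k)) := by
  intro α β h
  ext v
  rw [← toSh_ofFn, h, toSh_ofFn]

theorem toSh_inj {k : ℕ} {α β : V [⋀^Fin k]→L[ℝ] ℂ} : toSh α = toSh β ↔ α = β :=
  toSh_injective.eq_iff

theorem toSh_isAlt {k : ℕ} (α : V [⋀^Fin k]→L[ℝ] ℂ) : (toSh α).IsAlt := by
  intro l m v
  by_cases hk : (l ++ m).length + 1 = k
  · subst hk
    obtain ⟨w, hw⟩ := exists_ofFn (l := l ++ m) rfl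
    have hl : l.length < (l ++ m).length + 1 := by simp
    have h1 := ofFn_insertNth ⟨l.length, hl⟩ v w
    have h2 := ofFn_insertNth 0 v w
    rw [← hw] at h1 h2
    simp only [List.take_left', List.drop_left'] at h1
    simp only [Fin.val_zero, List.take_zero, List.drop_zero, List.nil_append] at h2
    rw [← h1, ← h2, toSh_ofFn, toSh_ofFn]
    have e1 := α.toAlternatingMap.map_insertNth ⟨l.length, hl⟩ v w
    have e2 := α.toAlternatingMap.map_insertNth 0 v w
    change α _ = _ at e1
    change α _ = _ at e2
    rw [e1, e2]
    simp
  · rw [toSh_isHom α _ (by simpa [add_assoc] using hk), toSh_isHom α _ (by simpa using hk)]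
    simp

@[simp] theorem toSh_add {k : ℕ} (α β : V [⋀^Fin k]→L[ℝ] ℂ) :
    toSh (α + β) = toSh α + toSh β := by
  ext l
  rw [Sh.add_apply]
  simp only [toSh]
  split_ifs <;> simp

@[simp] theorem toSh_smul {k : ℕ} (c : ℂ) (α : V [⋀^Fin k]→L[ℝ] ℂ) :
    toSh (c • α) = c • toSh α := by
  ext l
  rw [Sh.smul_apply]
  simp only [toSh]
  split_ifs <;> simp

/-- The map to the shuffle algebra, as a linear map. -/
def toShLin (V : Type*) [AddCommGroup V] [Module ℝ V] [TopologicalSpace V] (k : ℕ) :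
    (V [⋀^Fin k]→L[ℝ] ℂ) →ₗ[ℂ] Sh V where
  toFun := toSh
  map_add' := toSh_add
  map_smul' := toSh_smul

@[simp] theorem toSh_zero {k : ℕ} : toSh (0 : V [⋀^Fin k]→L[ℝ] ℂ) = 0 := (toShLin V k).map_zero

theorem toSh_sub {k : ℕ} (α β : V [⋀^Fin k]→L[ℝ] ℂ) : toSh (α - β) = toSh α - toSh β :=
  (toShLin V k).map_sub α β

theorem toSh_sum {k : ℕ} {ι : Type*} (s : Finset ι) (α : ι → V [⋀^Fin k]→L[ℝ] ℂ) :
    toSh (∑ i ∈ s, α i) = ∑ i ∈ s, toSh (α i) := map_sum (toShLin V k) α s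

theorem toSh_conj {k : ℕ} (α : V [⋀^Fin k]→L[ℝ] ℂ) : toSh (conjForm α) = (toSh α).conj := by
  ext l
  rw [Sh.conj_apply]
  simp only [toSh]
  split_ifs
  · rfl
  · simp

theorem toSh_comp {W : Type*} [AddCommGroup W] [Module ℝ W] [TopologicalSpace W] {k : ℕ}
    (α : V [⋀^Fin k]→L[ℝ] ℂ) (f : W →L[ℝ] V) :
    toSh (α.compContinuousLinearMap f) = Sh.pull f (toSh α) := by
  ext l
  rw [Sh.pull_apply]
  simp only [toSh, List.length_map]
  split_ifs
  · simp [Function.comp_def]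
  · rfl

theorem toSh_oneForm_apply (f : V →L[ℝ] ℂ) (v : V) : toSh (oneForm f) [v] = f v := by
  have := toSh_ofFn (oneForm f) (fun _ => v)
  exact this

/-- The wedge product is a sum over shuffles, and each shuffle is represented by `p! q!`
permutations; the factor is cancelled only in `toSh_wedge`. -/
theorem wedge_apply {p q : ℕ} (α : V [⋀^Fin p]→L[ℝ] ℂ) (β : V [⋀^Fin q]→L[ℝ] ℂ)
    (v : Fin (p + q) → V) : ((p.factorial * q.factorial : ℕ) : ℂ) * wedge α β v =
      altSum (fun w => α (fun i => w (Fin.castAdd q i)) * β (fun i => w (Fin.natAdd p i))) v := by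
  have h := congrArg (fun f => LinearMap.mul' ℝ ℂ (f (v ∘ finSumFinEquiv)))
    (MultilinearMap.domCoprod_alternization_eq α.toAlternatingMap β.toAlternatingMap)
  simp only [Fintype.card_fin, AlternatingMap.smul_apply, map_nsmul,
    MultilinearMap.alternatization_apply, map_sum] at h
  rw [nsmul_eq_mul] at h
  refine h.symm.trans ?_
  rw [altSum, ← (Equiv.permCongr finSumFinEquiv).sum_comp]
  refine Finset.sum_congr rfl fun σ _ => ?_
  rw [Units.smul_def, map_zsmul, zsmul_eq_mul, Equiv.Perm.sign_permCongr]
  congr 1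
  simp [Equiv.permCongr_apply, Function.comp_def]

theorem ofFn_take {W : Type*} {p q : ℕ} (w : Fin (p + q) → W) :
    (List.ofFn w).take p = List.ofFn fun i => w (Fin.castAdd q i) := by
  apply List.ext_getElem
  · simp
  · intro i h1 h2
    simp [Fin.castAdd, Fin.castLE]

theorem ofFn_drop {W : Type*} {p q : ℕ} (w : Fin (p + q) → W) :
    (List.ofFn w).drop p = List.ofFn fun i => w (Fin.natAdd p i) := by
  apply List.ext_getElem
  · simp
  · intro i h1 h2
    simp [Fin.natAdd]

theorem Sh.IsHom.mul {W : Type*} {p q : ℕ} {F G : Sh W} (hF : F.IsHom p) (hG : G.IsHom q) :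
    (F * G).IsHom (p + q) := by
  intro l
  induction l generalizing F G p q with
  | nil =>
    intro hl
    rw [Sh.mul_nil]
    by_cases hp : p = 0
    · rw [hG [] (by simp at hl ⊢; omega), mul_zero]
    · rw [hF [] (by simp; omega), zero_mul]
  | cons v l ih =>
    intro hl
    have h1 : (Sh.ctr v F * G) l = 0 := by
      cases p with
      | zero => rw [hF.ctr_zero]; simp
      | succ p => exact ih (hF.ctr v) hG (by simp at hl ⊢; omega)
    have h2 : (F * Sh.ctr v G) l = 0 := by
      cases q with
      | zero => rw [hG.ctr_zero]; simp
      | succ q => exact ih hF (hG.ctr v) (by simp at hl ⊢; omega)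
    rw [Sh.mul_cons, h1, hF.par, smul_mul_assoc, Sh.smul_apply, h2]
    simp

/-- The wedge product becomes the product of the shuffle algebra. -/
theorem toSh_wedge {p q : ℕ} (α : V [⋀^Fin p]→L[ℝ] ℂ) (β : V [⋀^Fin q]→L[ℝ] ℂ) :
    toSh (wedge α β) = toSh α * toSh β := by
  refine (toSh_isHom _).ext ((toSh_isHom α).mul (toSh_isHom β)) fun v => ?_
  have h1 := wedge_apply α β v
  have h2 := Sh.altSum_cat rfl (toSh_isHom α) (toSh_isHom β) (toSh_isAlt α) (toSh_isAlt β) v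
  simp only [ofFn_take, ofFn_drop, toSh_ofFn] at h2
  rw [← h1] at h2
  push_cast at h2
  rw [toSh_ofFn]
  refine mul_left_cancel₀ ?_ h2
  exact_mod_cast (Nat.mul_pos p.factorial_pos q.factorial_pos).ne'

theorem toSh_wedgeProd : ∀ (k : ℕ) (a : Fin k → V [⋀^Fin 2]→L[ℝ] ℂ),
    toSh (wedgeProd k a) = (List.ofFn fun j => toSh (a j)).prod
  | 0, a => by
    ext l
    cases l with
    | nil => rfl
    | cons v l => rfl
  | k + 1, a => by
    rw [wedgeProd, toSh_wedge, toSh_wedgeProd k, List.ofFn_succ', List.prod_concat]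

theorem toSh_divPow (α : V [⋀^Fin 2]→L[ℝ] ℂ) (k : ℕ) :
    toSh (divPow α k) = ((k.factorial : ℂ)⁻¹) • toSh α ^ k := by
  rw [divPow, toSh_smul, toSh_wedgeProd, List.ofFn_const, List.prod_replicate]

/-- Lists do not see equalities between degrees, so passing to them absorbs the casts occurring in
`IsHodgeStar` and `IsAssociatedFunction`. -/
theorem toSh_apply_cast {k k' : ℕ} (h : k = k') (α : V [⋀^Fin k]→L[ℝ] ℂ) (v : Fin k' → V) :
    α (fun i => v (Fin.cast h i)) = toSh α (List.ofFn v) := by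
  subst h
  rw [toSh_ofFn]
  rfl

end ToSh

end PSS
end

/-! ### The exterior derivative on a normed space and the Leibniz rule -/

noncomputable section
namespace PSS

theorem Sh.alt_ofFn {V : Type*} {n : ℕ} (L : V → Sh V) (v : Fin (n + 1) → V) :
    Sh.alt L (List.ofFn v) =
      ∑ i : Fin (n + 1), (-1) ^ (i : ℕ) * L (v i) (List.ofFn (i.removeNth v)) := by
  induction n generalizing L with
  | zero =>
    rw [List.ofFn_succ, Sh.alt_cons]
    simp
  | succ n ih =>
    rw [List.ofFn_succ, Sh.alt_cons, ih, sub_eq_add_neg, ← Finset.sum_neg_distrib]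
    conv_rhs => rw [Fin.sum_univ_succ]
    congr 1
    · simp
      rfl
    · refine Finset.sum_congr rfl fun i _ => ?_
      have : List.ofFn (i.succ.removeNth v) = v 0 :: List.ofFn (i.removeNth fun i => v i.succ) := by
        rw [List.ofFn_succ]
        simp [Fin.removeNth]
        rfl
      rw [this, Sh.ctr_apply, Fin.val_succ, pow_succ]
      ring

theorem toSh_real_smul {V : Type*} [AddCommGroup V] [Module ℝ V] [TopologicalSpace V] {k : ℕ}
    (r : ℝ) (α : V [⋀^Fin k]→L[ℝ] ℂ) : toSh (r • α) = (r : ℂ) • toSh α := by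
  rw [← toSh_smul]
  congr 1

section Normed

variable {E : Type*} [NormedAddCommGroup E] [NormedSpace ℝ E]

theorem toSh_alternatizeUncurryFin {k : ℕ} (L : E →L[ℝ] E [⋀^Fin k]→L[ℝ] ℂ) :
    toSh (ContinuousAlternatingMap.alternatizeUncurryFin L) = Sh.alt fun u => toSh (L u) := by
  ext l
  by_cases hl : l.length = k + 1
  · obtain ⟨v, rfl⟩ := exists_ofFn hl
    rw [toSh_ofFn, Sh.alt_ofFn, ContinuousAlternatingMap.alternatizeUncurryFin_apply]
    refine Finset.sum_congr rfl fun i _ => ?_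
    rw [toSh_ofFn]
    simp
  · rw [toSh_isHom _ l hl]
    -- Lists of the wrong length: alternation raises the degree by exactly one, so both sides take
    -- the default value zero there.
    have : ∀ (l : List E) (k : ℕ) (L : E → Sh E), (∀ u, (L u).IsHom k) → l.length ≠ k + 1 →
        Sh.alt L l = 0 := by
      intro l
      induction l with
      | nil => intros; rfl
      | cons v l ih =>
        intro k L h hl
        rw [Sh.alt_cons, h v l (by simpa using hl)]
        cases k with
        | zero =>
          rw [show (fun u => Sh.ctr v (L u)) = fun _ => (0 : ℂ) • (0 : Sh E) from
            funext fun u => by rw [(h u).ctr_zero]; simp, Sh.alt_smul]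
          simp
        | succ k => rw [ih k _ (fun u => (h u).ctr v) (by simpa using hl)]; simp
    exact (this l k _ (fun u => toSh_isHom _) hl).symm

theorem toSh_extDeriv {k : ℕ} (α : E → E [⋀^Fin k]→L[ℝ] ℂ) (x : E) :
    toSh (extDeriv α x) = Sh.alt fun u => toSh (fderiv ℝ α x u) :=
  toSh_alternatizeUncurryFin _

/-- Each of the `(p + q)!` terms of `wedge_apply` is at most the product of the norms, and dividing
by `p! q! ≥ 1` can only help. The crude constant suffices, since only the continuity of the bilinear
map `wedgeCLM` is wanted. -/
theorem norm_wedge_le {p q : ℕ} (α : E [⋀^Fin p]→L[ℝ] ℂ) (β : E [⋀^Fin q]→L[ℝ] ℂ) :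
    ‖wedge α β‖ ≤ (p + q).factorial * ‖α‖ * ‖β‖ := by
  refine ContinuousAlternatingMap.opNorm_le_bound _ (by positivity) fun v => ?_
  have h1 : ‖((p.factorial * q.factorial : ℕ) : ℂ) * wedge α β v‖ ≤
      (p + q).factorial * ‖α‖ * ‖β‖ * ∏ i, ‖v i‖ := by
    rw [wedge_apply, altSum]
    refine (norm_sum_le _ _).trans ?_
    have : ∀ σ ∈ (Finset.univ : Finset (Equiv.Perm (Fin (p + q)))),
        ‖((Equiv.Perm.sign σ : ℤ) : ℂ) * (α (fun i => (v ∘ σ) (Fin.castAdd q i)) *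
          β (fun i => (v ∘ σ) (Fin.natAdd p i)))‖ ≤ ‖α‖ * ‖β‖ * ∏ i, ‖v i‖ := by
      intro σ _
      have hs : ‖((Equiv.Perm.sign σ : ℤ) : ℂ)‖ = 1 := by
        rcases Int.units_eq_one_or (Equiv.Perm.sign σ) with h | h <;> simp [h]
      rw [norm_mul, hs, one_mul, norm_mul]
      refine (mul_le_mul (α.le_opNorm _) (β.le_opNorm _) (norm_nonneg _) (by positivity)).trans ?_
      rw [← Equiv.prod_comp σ fun i => ‖v i‖, Fin.prod_univ_add]
      simp only [Function.comp_apply]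
      apply le_of_eq
      ring
    refine (Finset.sum_le_card_nsmul _ _ _ this).trans ?_
    rw [Finset.card_univ, Fintype.card_perm, Fintype.card_fin, nsmul_eq_mul]
    apply le_of_eq
    ring
  refine le_trans ?_ h1
  rw [norm_mul, Complex.norm_natCast]
  have : (1 : ℝ) ≤ (p.factorial * q.factorial : ℕ) := by
    exact_mod_cast Nat.mul_pos p.factorial_pos q.factorial_pos
  nlinarith [norm_nonneg (wedge α β v)]

/-- The wedge product as a continuous bilinear map. -/
def wedgeCLM (E : Type*) [NormedAddCommGroup E] [NormedSpace ℝ E] (p q : ℕ) :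
    (E [⋀^Fin p]→L[ℝ] ℂ) →L[ℝ] (E [⋀^Fin q]→L[ℝ] ℂ) →L[ℝ] (E [⋀^Fin (p + q)]→L[ℝ] ℂ) :=
  LinearMap.mkContinuous₂
    (LinearMap.mk₂ ℝ wedge
      (fun a b c => toSh_injective (by simp [toSh_wedge, add_mul]))
      (fun r a b => toSh_injective (by simp [toSh_wedge, toSh_real_smul]))
      (fun a b c => toSh_injective (by simp [toSh_wedge, mul_add]))
      (fun r a b => toSh_injective (by simp [toSh_wedge, toSh_real_smul])))
    (p + q).factorial norm_wedge_le

/-- The Leibniz rule. -/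
theorem toSh_extDeriv_wedge {p q : ℕ} {α : E → E [⋀^Fin p]→L[ℝ] ℂ} {β : E → E [⋀^Fin q]→L[ℝ] ℂ}
    {x : E} (hα : DifferentiableAt ℝ α x) (hβ : DifferentiableAt ℝ β x) :
    toSh (extDeriv (fun y => wedge (α y) (β y)) x) =
      toSh (extDeriv α x) * toSh (β x) + Sh.par (toSh (α x)) * toSh (extDeriv β x) := by
  have h : HasFDerivAt (fun y => wedge (α y) (β y)) _ x :=
    (wedgeCLM E p q).hasFDerivAt_of_bilinear hα.hasFDerivAt hβ.hasFDerivAt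
  rw [toSh_extDeriv, toSh_extDeriv, toSh_extDeriv, h.fderiv, ← Sh.alt_mul_right, ← Sh.alt_mul_left,
    ← Sh.alt_add]
  congr 1
  funext u
  change toSh (wedge (α x) (fderiv ℝ β x u) + wedge (fderiv ℝ α x u) (β x)) = _
  rw [toSh_add, toSh_wedge, toSh_wedge, add_comm]

theorem Sh.conj_alt {V : Type*} (L : V → Sh V) : (Sh.alt L).conj = Sh.alt fun u => (L u).conj := by
  ext l
  rw [Sh.conj_apply]
  induction l generalizing L with
  | nil => simp
  | cons v l ih =>
    rw [Sh.alt_cons, Sh.alt_cons, map_sub, ih]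
    rfl

/-- Complex conjugation of forms as a continuous linear map. -/
def conjFormCLM (E : Type*) [NormedAddCommGroup E] [NormedSpace ℝ E] (k : ℕ) :
    (E [⋀^Fin k]→L[ℝ] ℂ) →L[ℝ] (E [⋀^Fin k]→L[ℝ] ℂ) :=
  ContinuousLinearMap.compContinuousAlternatingMapCLM ℝ E ℂ ℂ (ι := Fin k) (Complex.conjCLE : ℂ →L[ℝ] ℂ)

theorem toSh_extDeriv_conj {k : ℕ} {α : E → E [⋀^Fin k]→L[ℝ] ℂ} {x : E}
    (hα : DifferentiableAt ℝ α x) :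
    toSh (extDeriv (fun y => conjForm (α y)) x) = (toSh (extDeriv α x)).conj := by
  have h : HasFDerivAt (fun y => conjForm (α y)) ((conjFormCLM E k).comp (fderiv ℝ α x)) x :=
    (conjFormCLM E k).hasFDerivAt.comp x hα.hasFDerivAt
  rw [toSh_extDeriv, toSh_extDeriv, h.fderiv, Sh.conj_alt]
  congr 1
  funext u
  exact toSh_conj _

theorem toSh_extDeriv_smul {k : ℕ} {α : E → E [⋀^Fin k]→L[ℝ] ℂ} {x : E} (c : ℂ)
    (hα : DifferentiableAt ℝ α x) :
    toSh (extDeriv (fun y => c • α y) x) = c • toSh (extDeriv α x) := by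
  have h : HasFDerivAt (fun y => c • α y) (c • fderiv ℝ α x) x := hα.hasFDerivAt.const_smul c
  rw [toSh_extDeriv, toSh_extDeriv, h.fderiv, ← Sh.alt_smul]
  congr 1
  funext u
  exact toSh_smul _ _

end Normed
end PSS
end

/-! ### Forms on manifolds as fields in the shuffle algebra -/

noncomputable section
namespace PSS

theorem comp_wedge {V W : Type*} [AddCommGroup V] [Module ℝ V] [TopologicalSpace V]
    [AddCommGroup W] [Module ℝ W] [TopologicalSpace W] {k l : ℕ} (α : V [⋀^Fin k]→L[ℝ] ℂ)
    (β : V [⋀^Fin l]→L[ℝ] ℂ) (f : W →L[ℝ] V) :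
    (wedge α β).compContinuousLinearMap f =
      wedge (α.compContinuousLinearMap f) (β.compContinuousLinearMap f) := by
  refine toSh_injective ?_
  rw [toSh_comp, toSh_wedge, map_mul, toSh_wedge, toSh_comp, toSh_comp]

section Forms

variable {E : Type*} [NormedAddCommGroup E] [NormedSpace ℝ E] {H : Type*} [TopologicalSpace H]
  {I : ModelWithCorners ℝ E H} {M : Type*} [TopologicalSpace M] [ChartedSpace H M] {k l : ℕ}

/-- The tangent space at `x` is identified with `E` through the preferred chart at `x`, so the
derivative of the inverse chart at the centre is the identity. This turns an identity between local
expressions at the centre into an identity between forms. -/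
theorem localRep_self [I.Boundaryless] [IsManifold I 1 M] (α : DForm I M k) (x : M) :
    localRep α x (extChartAt I x x) = (α x : E [⋀^Fin k]→L[ℝ] ℂ) := by
  have h := mfderivWithin_range_extChartAt_symm (I := I) (x := x)
  rw [I.range_eq_univ, mfderivWithin_univ] at h
  unfold localRep
  rw [h]
  have e : (extChartAt I x).symm (extChartAt I x x) = x := extChartAt_to_inv x
  have : ∀ y : M, y = x → ((α y : E [⋀^Fin k]→L[ℝ] ℂ)).compContinuousLinearMap
      (ContinuousLinearMap.id ℝ E) = (α x : E [⋀^Fin k]→L[ℝ] ℂ) := by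
    rintro y rfl
    rfl
  exact this _ e

theorem extD_eq [IsManifold I 1 M] (α : DForm I M k) (x : M) :
    extD α x = (extDeriv (localRep α x) (extChartAt I x x) : E [⋀^Fin (k + 1)]→L[ℝ] ℂ) := by
  unfold extD
  rw [mfderiv_extChartAt_self]
  rfl

theorem toSh_extD [IsManifold I 1 M] (α : DForm I M k) (x : M) :
    toSh (extD α x) = (toSh (extDeriv (localRep α x) (extChartAt I x x)) : Sh E) := by
  rw [extD_eq]
  rfl

theorem toSh_localRep_self [I.Boundaryless] [IsManifold I 1 M] (α : DForm I M k) (x : M) :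
    (toSh (localRep α x (extChartAt I x x)) : Sh E) = toSh (α x) := by
  rw [localRep_self]
  rfl

theorem localRep_formWedge (α : DForm I M k) (β : DForm I M l) (x : M) :
    localRep (formWedge α β) x = fun y => wedge (localRep α x y) (localRep β x y) := by
  funext y
  exact comp_wedge _ _ _

theorem localRep_formConj (α : DForm I M k) (x : M) :
    localRep (formConj α) x = fun y => conjForm (localRep α x y) := rfl

theorem localRep_add (α β : DForm I M k) (x : M) :
    localRep (α + β) x = localRep α x + localRep β x := rfl

theorem localRep_smul (c : ℂ) (α : DForm I M k) (x : M) :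
    localRep (c • α) x = fun y => c • localRep α x y := rfl

theorem localRep_zero (x : M) : localRep (0 : DForm I M k) x = 0 := rfl

/-- The fields of elements of the shuffle algebra of the tangent spaces. -/
abbrev ShForm (I : ModelWithCorners ℝ E H) (M : Type*) [TopologicalSpace M] [ChartedSpace H M] :=
  ∀ x : M, Sh (TangentSpace I x)

/-- A form as a field of elements of the shuffle algebra. -/
def ofForm (α : DForm I M k) : ShForm I M := fun x => toSh (α x)

theorem ofForm_injective : Function.Injective (ofForm (I := I) (M := M) (k := k)) :=
  fun _ _ h => funext fun x => toSh_injective (congrFun h x)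

/-- The element `a` is a smooth form of degree `k` with exterior derivative `b`. -/
def HasD (k : ℕ) (a b : ShForm I M) : Prop :=
  ∃ α : DForm I M k, IsSmooth α ∧ ofForm α = a ∧ ofForm (extD α) = b

/-- The conjugate of a field. -/
def conjSh (a : ShForm I M) : ShForm I M := fun x => (a x).conj

theorem IsSmooth.differentiableAt [I.Boundaryless] {α : DForm I M k} (h : IsSmooth α) (x : M) :
    DifferentiableAt ℝ (localRep α x) (extChartAt I x x) :=
  ((h x).contDiffAt (extChartAt_target_mem_nhds x)).differentiableAt (by simp)

variable [I.Boundaryless] [IsManifold I 1 M] {a a' b b' : ShForm I M}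

-- By injectivity of `ofForm`, the form hidden in the existential of `HasD` is the given one.
omit [I.Boundaryless] [IsManifold I 1 M] in
theorem HasD.isSmooth (h : HasD k a b) {α : DForm I M k} (hα : ofForm α = a) : IsSmooth α := by
  obtain ⟨α', h, rfl, rfl⟩ := h
  rwa [ofForm_injective hα]

omit [I.Boundaryless] [IsManifold I 1 M] in
theorem HasD.extD (h : HasD k a b) {α : DForm I M k} (hα : ofForm α = a) :
    ofForm (extD α) = b := by
  obtain ⟨α', h, rfl, rfl⟩ := h
  rw [ofForm_injective hα]

theorem HasD.add (h : HasD k a b) (h' : HasD k a' b') : HasD k (a + a') (b + b') := by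
  obtain ⟨α, h, rfl, rfl⟩ := h
  obtain ⟨α', h', rfl, rfl⟩ := h'
  refine ⟨α + α', fun x => ?_, funext fun x => toSh_add _ _, funext fun x => ?_⟩
  · rw [localRep_add]
    exact (h x).add (h' x)
  · change toSh (PSS.extD (α + α') x) = toSh (PSS.extD α x) + toSh (PSS.extD α' x)
    rw [← toSh_add, extD_eq, extD_eq, extD_eq, localRep_add,
      extDeriv_add (h.differentiableAt x) (h'.differentiableAt x)]
    rfl

theorem HasD.smul (h : HasD k a b) (c : ℂ) : HasD k (c • a) (c • b) := by
  obtain ⟨α, h, rfl, rfl⟩ := h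
  refine ⟨c • α, fun x => ?_, funext fun x => toSh_smul _ _, funext fun x => ?_⟩
  · rw [localRep_smul]
    exact (h x).const_smul c
  · change toSh (PSS.extD (c • α) x) = c • toSh (PSS.extD α x)
    rw [toSh_extD, toSh_extD, localRep_smul, toSh_extDeriv_smul c (h.differentiableAt x)]
    rfl

omit [I.Boundaryless] in
theorem HasD.zero : HasD k (0 : ShForm I M) 0 := by
  refine ⟨0, fun x => ?_, funext fun x => toSh_zero, funext fun x => ?_⟩
  · rw [localRep_zero]
    exact contDiffOn_const
  · change toSh (PSS.extD 0 x) = 0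
    rw [toSh_extD, localRep_zero]
    -- Writing the zero form as `0 • 0` reduces the claim to the scalar rule.
    have h : toSh (extDeriv (fun y => (0 : ℂ) • (0 : E → E [⋀^Fin k]→L[ℝ] ℂ) y)
        (extChartAt I x x)) = _ := toSh_extDeriv_smul 0 (differentiableAt_const 0)
    rw [zero_smul] at h
    refine Eq.trans ?_ h
    congr 2
    funext y
    exact (zero_smul ℂ (0 : E [⋀^Fin k]→L[ℝ] ℂ)).symm

theorem HasD.neg (h : HasD k a b) : HasD k (-a) (-b) := by
  simpa using h.smul (-1)

theorem HasD.sum {ι : Type*} {s : Finset ι} {a b : ι → ShForm I M}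
    (h : ∀ i ∈ s, HasD k (a i) (b i)) : HasD k (∑ i ∈ s, a i) (∑ i ∈ s, b i) := by
  classical
  induction s using Finset.induction_on with
  | empty => exact HasD.zero
  | insert i s hi ih =>
    rw [Finset.sum_insert hi, Finset.sum_insert hi]
    exact (h i (Finset.mem_insert_self i s)).add
      (ih fun j hj => h j (Finset.mem_insert_of_mem hj))

theorem HasD.conj (h : HasD k a b) : HasD k (conjSh a) (conjSh b) := by
  obtain ⟨α, h, rfl, rfl⟩ := h
  refine ⟨formConj α, fun x => ?_, funext fun x => toSh_conj _, funext fun x => ?_⟩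
  · rw [localRep_formConj]
    exact (conjFormCLM E k).contDiff.comp_contDiffOn (h x)
  · change toSh (PSS.extD (formConj α) x) = (toSh (PSS.extD α x)).conj
    rw [toSh_extD, toSh_extD, localRep_formConj, toSh_extDeriv_conj (h.differentiableAt x)]
    rfl

theorem HasD.mul (h : HasD k a b) (h' : HasD l a' b') :
    HasD (k + l) (a * a') (b * a' + (-1 : ℂ) ^ k • (a * b')) := by
  obtain ⟨α, h, rfl, rfl⟩ := h
  obtain ⟨β, h', rfl, rfl⟩ := h'
  refine ⟨formWedge α β, fun x => ?_, funext fun x => toSh_wedge _ _, funext fun x => ?_⟩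
  · rw [localRep_formWedge]
    exact ((wedgeCLM E k l).contDiff.comp_contDiffOn (h x)).clm_apply (h' x)
  · change toSh (PSS.extD (formWedge α β) x) = toSh (PSS.extD α x) * toSh (β x) +
      (-1 : ℂ) ^ k • (toSh (α x) * toSh (PSS.extD β x))
    have hp := par_toSh (localRep α x (extChartAt I x x))
    rw [toSh_extD, toSh_extD, toSh_extD, localRep_formWedge,
      toSh_extDeriv_wedge (h.differentiableAt x) (h'.differentiableAt x), hp, smul_mul_assoc,
      toSh_localRep_self, toSh_localRep_self]
    rfl

end Forms
end PSS
end

/-! ### Bidegree and the operators `∂` and `∂̄` -/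

noncomputable section
namespace PSS

section Types

variable {V : Type*} [AddCommGroup V] [Module ℝ V] [TopologicalSpace V] [IsTopologicalAddGroup V]
  [ContinuousConstSMul ℝ V] {J : V →L[ℝ] V}

/-- The element of the shuffle algebra is of bidegree `(p, q)`. -/
def ShType (J : V →L[ℝ] V) (p q : ℕ) (F : Sh V) : Prop :=
  ∀ c : ℂ, Sh.pull (cMul J c) F = (c ^ p * (starRingEnd ℂ c) ^ q) • F

theorem isOfType_iff {p q k : ℕ} (hk : k = p + q) (α : V [⋀^Fin k]→L[ℝ] ℂ) :
    IsOfType J p q α ↔ ShType J p q (toSh α) := by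
  constructor
  · intro h c
    rw [← toSh_comp, ← toSh_smul]
    congr 1
    ext v
    exact h.2 c v
  · intro h
    refine ⟨hk, fun c v => ?_⟩
    have := h c
    rw [← toSh_comp, ← toSh_smul, toSh_inj] at this
    exact DFunLike.congr_fun this v

theorem ShType.mul {p q p' q' : ℕ} {F G : Sh V} (hF : ShType J p q F) (hG : ShType J p' q' G) :
    ShType J (p + p') (q + q') (F * G) := by
  intro c
  rw [map_mul, hF c, hG c, smul_mul_smul_comm, pow_add, pow_add]
  congr 1; ring

theorem ShType.add {p q : ℕ} {F G : Sh V} (hF : ShType J p q F) (hG : ShType J p q G) :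
    ShType J p q (F + G) := by
  intro c
  rw [map_add, hF c, hG c, smul_add]

theorem ShType.smul {p q : ℕ} {F : Sh V} (hF : ShType J p q F) (a : ℂ) :
    ShType J p q (a • F) := by
  intro c
  rw [map_smul, hF c, smul_comm]

theorem ShType.neg {p q : ℕ} {F : Sh V} (hF : ShType J p q F) : ShType J p q (-F) := by
  simpa using hF.smul (-1)

theorem ShType.sub {p q : ℕ} {F G : Sh V} (hF : ShType J p q F) (hG : ShType J p q G) :
    ShType J p q (F - G) := by
  simpa [sub_eq_add_neg] using hF.add hG.neg

theorem ShType.zero {p q : ℕ} : ShType J p q 0 := by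
  intro c
  rw [map_zero, smul_zero]

theorem ShType.sum {p q : ℕ} {ι : Type*} {s : Finset ι} {F : ι → Sh V}
    (h : ∀ i ∈ s, ShType J p q (F i)) : ShType J p q (∑ i ∈ s, F i) := by
  intro c
  rw [map_sum, Finset.smul_sum]
  exact Finset.sum_congr rfl fun i hi => h i hi c

theorem ShType.one : ShType J 0 0 1 := by
  intro c
  simp

theorem ShType.pow {p q : ℕ} {F : Sh V} (hF : ShType J p q F) (n : ℕ) :
    ShType J (n * p) (n * q) (F ^ n) := by
  intro c
  rw [map_pow, hF c, smul_pow, mul_pow, ← pow_mul, ← pow_mul, mul_comm n p, mul_comm n q]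

theorem ShType.conj {p q : ℕ} {F : Sh V} (hF : ShType J p q F) : ShType J q p F.conj := by
  intro c
  have h := congrArg Sh.conj (hF c)
  rw [Sh.conj_smul] at h
  refine Eq.trans ?_ (h.trans ?_)
  · rfl
  · congr 1
    simp [mul_comm]

theorem shType_oneForm {f : V →L[ℝ] ℂ} (h : ∀ v, f (J v) = Complex.I * f v) :
    ShType J 1 0 (toSh (oneForm f)) := by
  rw [← isOfType_iff rfl]
  refine ⟨rfl, fun c v => ?_⟩
  change f (c.re • v 0 + c.im • J (v 0)) = c ^ 1 * _ ^ 0 * f (v 0)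
  rw [map_add, map_smul, map_smul, h]
  simp only [Complex.real_smul, pow_one, pow_zero, mul_one]
  conv_rhs => rw [← Complex.re_add_im c]
  ring

theorem geom_sum_exp_eq_zero {N : ℕ} (hN : 0 < N) {d : ℤ} (hd : d ≠ 0) (hdN : |d| < N) :
    ∑ j ∈ Finset.range N, Complex.exp ((d : ℂ) * (2 * Real.pi * j / N) * Complex.I) = 0 := by
  have hN' : (N : ℂ) ≠ 0 := by exact_mod_cast hN.ne'
  set z : ℂ := Complex.exp ((d : ℂ) * (2 * Real.pi / N) * Complex.I) with hz
  have hz1 : z ≠ 1 := by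
    intro h
    rw [hz, Complex.exp_eq_one_iff] at h
    obtain ⟨n, hn⟩ := h
    have hpi : (2 * Real.pi * Complex.I : ℂ) ≠ 0 := Complex.two_pi_I_ne_zero
    have h1 : (d : ℂ) = n * N := by
      field_simp at hn
      have h2 : (2 * Real.pi * Complex.I : ℂ) * d = (2 * Real.pi * Complex.I) * (n * N) := by
        linear_combination (2 * Real.pi * Complex.I : ℂ) * hn
      exact mul_left_cancel₀ hpi h2
    have h3 : d = n * N := by exact_mod_cast h1
    have h4 : n ≠ 0 := by rintro rfl; simp at h3; exact hd h3
    have h5 : (N : ℤ) ≤ |d| := by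
      rw [h3, abs_mul, Nat.abs_cast]
      have : 1 ≤ |n| := Int.one_le_abs h4
      nlinarith
    omega
  have hzN : z ^ N = 1 := by
    rw [hz, ← Complex.exp_nat_mul, Complex.exp_eq_one_iff]
    exact ⟨d, by field_simp⟩
  have : ∀ j ∈ Finset.range N,
      Complex.exp ((d : ℂ) * (2 * Real.pi * j / N) * Complex.I) = z ^ j := by
    intro j _
    rw [hz, ← Complex.exp_nat_mul]
    congr 1
    ring
  rw [Finset.sum_congr rfl this, geom_sum_eq hz1, hzN]
  simp

/-- On a form of bidegree `(p', q')` the rotation of angle `s` acts by `exp (i (p' - q') s)`, and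
`(p' - q') - (p - q) = 2 (p' - p)` because both bidegrees have total degree `k`. This frequency is
at most `2k` in absolute value, hence not a nonzero multiple of `2k + 1`, and the average over the
rotations is `1` or `0`. -/
theorem typeProj_of_type {p q p' q' k : ℕ} (hk : k = p + q) (hk' : k = p' + q')
    {α : V [⋀^Fin k]→L[ℝ] ℂ} (hα : ShType J p' q' (toSh α)) :
    typeProj J p q α = if p = p' then α else 0 := by
  have hN : (2 * k + 1 : ℂ) ≠ 0 := by exact_mod_cast (Nat.succ_ne_zero (2 * k))
  have key : ∀ j : ℕ, Complex.exp (-(((p : ℂ) - q) * (2 * Real.pi * j / (2 * k + 1)) * Complex.I)) •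
      α.compContinuousLinearMap
        (cMul J (Complex.exp ((2 * Real.pi * j / (2 * k + 1)) * Complex.I))) =
      Complex.exp (((2 * ((p' : ℤ) - p) : ℤ) : ℂ) * (2 * Real.pi * j / (2 * k + 1 : ℕ)) *
        Complex.I) • α := by
    intro j
    refine toSh_injective ?_
    rw [toSh_smul, toSh_comp, hα, smul_smul, toSh_smul]
    congr 1
    have hc : (starRingEnd ℂ) (Complex.exp ((2 * Real.pi * j / (2 * k + 1)) * Complex.I)) =
        Complex.exp (-((2 * Real.pi * j / (2 * k + 1)) * Complex.I)) := by
      rw [← Complex.exp_conj]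
      congr 1
      simp [Complex.conj_ofReal, map_ofNat (starRingEnd ℂ) 2]
    rw [hc, ← Complex.exp_nat_mul, ← Complex.exp_nat_mul, ← Complex.exp_add, ← Complex.exp_add]
    congr 1
    have h1 : (q : ℂ) = k - p := by rw [hk]; push_cast; ring
    have h2 : (q' : ℂ) = k - p' := by rw [hk']; push_cast; ring
    rw [h1, h2]
    push_cast
    ring
  rw [typeProj, Finset.sum_congr rfl fun j _ => key j, ← Finset.sum_smul]
  split_ifs with h
  · subst h
    simp only [sub_self, mul_zero, Int.cast_zero, zero_mul, Complex.exp_zero, Finset.sum_const,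
      Finset.card_range, nsmul_eq_mul, mul_one, smul_smul]
    push_cast
    rw [inv_mul_cancel₀ hN, one_smul]
  · rw [geom_sum_exp_eq_zero (by omega) (by omega) (by rw [abs_lt]; omega), zero_smul, smul_zero]

theorem typeProj_add (p q : ℕ) {k : ℕ} (α β : V [⋀^Fin k]→L[ℝ] ℂ) :
    typeProj J p q (α + β) = typeProj J p q α + typeProj J p q β := by
  refine toSh_injective ?_
  simp only [typeProj, toSh_smul, toSh_sum, toSh_comp, toSh_add, map_add, smul_add,
    Finset.sum_add_distrib]

theorem typeProj_zero (p q : ℕ) {k : ℕ} :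
    typeProj J p q (0 : V [⋀^Fin k]→L[ℝ] ℂ) = 0 := by
  refine toSh_injective ?_
  simp [typeProj, toSh_sum, toSh_comp]

end Types

section Dolbeault

variable {E : Type*} [NormedAddCommGroup E] [NormedSpace ℝ E] {H : Type*} [TopologicalSpace H]
  {I : ModelWithCorners ℝ E H} {M : Type*} [TopologicalSpace M] [ChartedSpace H M] {k : ℕ}
  [I.Boundaryless] [IsManifold I 1 M] {J : EndField I M}

theorem extD_zero : extD (0 : DForm I M k) = 0 := by
  refine ofForm_injective ?_
  have h : ofForm (0 : DForm I M k) = 0 := funext fun x => toSh_zero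
  rw [(HasD.zero (k := k)).extD h]
  exact (funext fun x => toSh_zero).symm

/-- Only the projection to `(p, q)` is nonzero on `α`, so the sums defining `del` and `delbar` have
one surviving term, and the outer projection separates `β` from `γ`. All later values of `∂` and
`∂̄` are read off from a decomposition of `d` in this way. -/
theorem del_delbar_of_type {p q : ℕ} (hk : k = p + q) {α : DForm I M k} {β γ : DForm I M (k + 1)}
    (hα : ∀ x, ShType (J x) p q (toSh (α x))) (hβ : ∀ x, ShType (J x) (p + 1) q (toSh (β x)))
    (hγ : ∀ x, ShType (J x) p (q + 1) (toSh (γ x))) (h : extD α = β + γ) :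
    del J α = β ∧ delbar J α = γ := by
  have h1 : ∀ p' ∈ Finset.range (k + 1), (fun y => typeProj (J y) p' (k - p') (α y)) =
      if p' = p then α else 0 := by
    intro p' hp'
    have := Finset.mem_range.mp hp'
    funext y
    rw [typeProj_of_type (by omega) hk (hα y)]
    split_ifs <;> rfl
  constructor
  · rw [del, Finset.sum_eq_single p]
    · funext x
      rw [h1 p (by simp; omega), if_pos rfl, h, Pi.add_apply, typeProj_add,
        typeProj_of_type (by omega) (by omega) (hβ x),
        typeProj_of_type (by omega) (by omega) (hγ x), if_pos rfl, if_neg (by omega), add_zero]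
    · intro p' hp' hne
      funext x
      rw [h1 p' hp', if_neg hne, extD_zero]
      exact typeProj_zero _ _
    · intro hp
      simp at hp
      omega
  · rw [delbar, Finset.sum_eq_single p]
    · funext x
      rw [h1 p (by simp; omega), if_pos rfl, h, Pi.add_apply, typeProj_add,
        typeProj_of_type (by omega) (by omega) (hβ x),
        typeProj_of_type (by omega) (by omega) (hγ x), if_pos rfl, if_neg (by omega), zero_add]
    · intro p' hp' hne
      funext x
      rw [h1 p' hp', if_neg hne, extD_zero]
      exact typeProj_zero _ _
    · intro hp
      simp at hp
      omega

end Dolbeault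
end PSS
end

/-! ### Unitary coframes and the associated real orthonormal bases -/

noncomputable section
namespace PSS

open Complex

section Pointwise

variable {V : Type*} [AddCommGroup V] [Module ℝ V] [TopologicalSpace V]

/-- A linear functional as an element of the shuffle algebra. -/
abbrev sh1 (f : V →L[ℝ] ℂ) : Sh V := toSh (oneForm f)

/-- The `(1,1)`-form `i f ∧ conj f` as an element of the shuffle algebra. -/
def xi (f : V →L[ℝ] ℂ) : Sh V := I • (sh1 f * (sh1 f).conj)

theorem sh1_apply (f : V →L[ℝ] ℂ) (v : V) : sh1 f [v] = f v := toSh_oneForm_apply f v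

theorem sh1_isHom (f : V →L[ℝ] ℂ) : (sh1 f).IsHom 1 := toSh_isHom _

theorem sh1_odd (f : V →L[ℝ] ℂ) : Sh.par (sh1 f) = -sh1 f := by
  rw [par_toSh]; simp

theorem Sh.par_conj {V : Type*} (F : Sh V) : Sh.par F.conj = (Sh.par F).conj := by
  ext l; simp [Sh.par_apply, Sh.conj_apply]

theorem sh1_conj_odd (f : V →L[ℝ] ℂ) : Sh.par (sh1 f).conj = -(sh1 f).conj := by
  rw [Sh.par_conj, sh1_odd, Sh.conj_neg]

theorem sh1_conj (f : V →L[ℝ] ℂ) :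
    (sh1 f).conj = sh1 ((Complex.conjCLE : ℂ →L[ℝ] ℂ).comp f) := by
  rw [← toSh_conj]
  rfl

theorem sh1_add (f g : V →L[ℝ] ℂ) : sh1 (f + g) = sh1 f + sh1 g := by
  rw [sh1, sh1, sh1, ← toSh_add]; rfl

theorem sh1_smul (c : ℂ) (f : V →L[ℝ] ℂ) : sh1 (c • f) = c • sh1 f := by
  rw [sh1, sh1, ← toSh_smul]; rfl

theorem xi_even (f : V →L[ℝ] ℂ) : Sh.par (xi f) = xi f := by
  rw [xi, map_smul, Sh.par_mul, sh1_odd, sh1_conj_odd, neg_mul_neg]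

theorem xi_comm (f : V →L[ℝ] ℂ) (G : Sh V) : xi f * G = G * xi f :=
  Sh.commute_of_even (xi_even f) G

theorem sh1_mul_self (f : V →L[ℝ] ℂ) : sh1 f * sh1 f = 0 := Sh.mul_self_of_odd (sh1_odd f)

theorem sh1_conj_mul_self (f : V →L[ℝ] ℂ) : (sh1 f).conj * (sh1 f).conj = 0 :=
  Sh.mul_self_of_odd (sh1_conj_odd f)

theorem sh1_anticomm (f g : V →L[ℝ] ℂ) : sh1 f * sh1 g = -(sh1 g * sh1 f) :=
  Sh.anticomm_of_odd (sh1_odd f) (sh1_odd g)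

theorem sh1_mul_xi (f : V →L[ℝ] ℂ) : sh1 f * xi f = 0 := by
  rw [xi, mul_smul_comm, ← mul_assoc, sh1_mul_self, zero_mul, smul_zero]

theorem sh1_conj_mul_xi (f : V →L[ℝ] ℂ) : (sh1 f).conj * xi f = 0 := by
  rw [← xi_comm, xi, smul_mul_assoc, mul_assoc, sh1_conj_mul_self, mul_zero, smul_zero]

theorem xi_mul_self (f : V →L[ℝ] ℂ) : xi f * xi f = 0 := by
  nth_rw 1 [xi]
  rw [smul_mul_assoc, mul_assoc, sh1_conj_mul_xi, mul_zero, smul_zero]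

theorem conj_xi (f : V →L[ℝ] ℂ) : (xi f).conj = xi f := by
  rw [xi, Sh.conj_smul, Sh.conj_mul, Sh.conj_conj,
    Sh.anticomm_of_odd (sh1_conj_odd f) (sh1_odd f), conj_I, smul_neg, neg_smul, neg_neg]

theorem ctr_sh1 (f : V →L[ℝ] ℂ) (u : V) : Sh.ctr u (sh1 f) = f u • (1 : Sh V) := by
  ext l
  cases l with
  | nil => rw [Sh.ctr_apply, sh1_apply]; simp
  | cons w l =>
    rw [Sh.ctr_apply, sh1_isHom f _ (by simp), Sh.smul_apply, ← Sh.ctr_apply w 1, Sh.ctr_one]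
    simp

theorem sh1_mul_cons (f : V →L[ℝ] ℂ) (G : Sh V) (v : V) (l : List V) :
    (sh1 f * G) (v :: l) = f v * G l - (sh1 f * Sh.ctr v G) l := by
  rw [Sh.mul_cons, sh1_odd, ctr_sh1, neg_mul, smul_mul_assoc, one_mul, Sh.neg_apply,
    Sh.smul_apply]
  ring

theorem sh1_mul_eq_zero {f : V →L[ℝ] ℂ} {l : List V} (h : ∀ v ∈ l, f v = 0) (G : Sh V) :
    (sh1 f * G) l = 0 := by
  induction l generalizing G with
  | nil => rw [Sh.mul_nil, sh1_isHom f [] (by simp), zero_mul]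
  | cons v l ih =>
    rw [sh1_mul_cons, ih fun w hw => h w (List.mem_cons_of_mem v hw), h v List.mem_cons_self]
    ring

/-- Evaluates a product of dual functionals on basis vectors one factor at a time: of all the
shuffles, only the one giving the first vector to `f` survives. -/
theorem sh1_mul_cons_of_zero {f : V →L[ℝ] ℂ} {l : List V} (h : ∀ v ∈ l, f v = 0) (G : Sh V)
    (v : V) : (sh1 f * G) (v :: l) = f v * G l := by
  rw [sh1_mul_cons, sh1_mul_eq_zero h, sub_zero]

theorem sh1_mul_apply (f g : V →L[ℝ] ℂ) (u v : V) :
    (sh1 f * sh1 g) [u, v] = f u * g v - f v * g u := by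
  rw [sh1_mul_cons, ctr_sh1, mul_smul_comm, mul_one, Sh.smul_apply, sh1_apply, sh1_apply]
  ring

theorem xi_apply (f : V →L[ℝ] ℂ) (u v : V) :
    xi f [u, v] = I * (f u * starRingEnd ℂ (f v) - f v * starRingEnd ℂ (f u)) := by
  rw [xi, Sh.smul_apply, sh1_conj, sh1_mul_apply]
  rfl

theorem toSh_xi (f : V →L[ℝ] ℂ) :
    toSh (I • wedge (oneForm f) (conjForm (oneForm f))) = xi f := by
  rw [toSh_smul, toSh_wedge, toSh_conj, xi]

theorem toSh_pair (u : V [⋀^Fin 2]→L[ℝ] ℂ) (v w : V) : toSh u [v, w] = u ![v, w] := by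
  rw [← toSh_ofFn]
  simp

theorem pair_swap (u : V [⋀^Fin 2]→L[ℝ] ℂ) (v w : V) : u ![v, w] = -u ![w, v] := by
  have := u.toAlternatingMap.map_swap ![w, v] (i := 0) (j := 1) (by decide)
  refine Eq.trans ?_ this
  change u _ = u _
  congr 1
  funext i
  fin_cases i <;> rfl

/-- A `2`-form as a linear function of the first argument. -/
def pairLin (u : V [⋀^Fin 2]→L[ℝ] ℂ) (w : V) : V →ₗ[ℝ] ℂ where
  toFun v := u ![v, w]
  map_add' _ _ := u.toMultilinearMap.cons_add _ _ _
  map_smul' _ _ := u.toMultilinearMap.cons_smul _ _ _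

theorem pairLin_apply (u : V [⋀^Fin 2]→L[ℝ] ℂ) (v w : V) : pairLin u w v = u ![v, w] := rfl

variable {n : ℕ} {J : V →L[ℝ] V} {θ : Fin n → V →L[ℝ] ℂ}

/-- The right-hand side is `2 Re ∑ θ_j(u) conj (θ_j(v))`; the factor `2` is the reason for the `√2`
in the orthonormal basis and in its coordinates. -/
theorem sum_xi_apply_J (hJ : ∀ j v, θ j (J v) = I * θ j v) (u v : V) :
    (∑ j, xi (θ j)) [u, J v] =
      ∑ j, (θ j u * starRingEnd ℂ (θ j v) + θ j v * starRingEnd ℂ (θ j u)) := by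
  rw [Sh.sum_apply]
  refine Finset.sum_congr rfl fun j _ => ?_
  rw [xi_apply, hJ, map_mul, conj_I]
  linear_combination (-(θ j u * starRingEnd ℂ (θ j v) + θ j v * starRingEnd ℂ (θ j u))) * I_sq

theorem shType_xi [IsTopologicalAddGroup V] [ContinuousConstSMul ℝ V] {f : V →L[ℝ] ℂ}
    (hJ : ∀ v, f (J v) = I * f v) : ShType J 1 1 (xi f) :=
  ((shType_oneForm hJ).mul (shType_oneForm hJ).conj).smul I

/-- The vectors of the real orthonormal basis attached to a unitary coframe, `s = 0, 1`. -/
theorem exists_dual (hs : ∀ w : Fin n → ℂ, ∃ v, ∀ j, θ j v = w j) :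
    ∃ e : Fin 2 × Fin n → V, ∀ a j, θ j (e a) =
      if j = a.2 then ((√2 : ℝ) : ℂ)⁻¹ * (if a.1 = 0 then 1 else I) else 0 := by
  choose e he using fun a : Fin 2 × Fin n => hs fun j =>
    if j = a.2 then ((√2 : ℝ) : ℂ)⁻¹ * (if a.1 = 0 then 1 else I) else 0
  exact ⟨e, he⟩

/-- The real coordinates with respect to the orthonormal basis, as complex valued functionals. -/
def coord (θ : Fin n → V →L[ℝ] ℂ) (a : Fin 2 × Fin n) : V →L[ℝ] ℂ :=
  if a.1 = 0 then (((√2 : ℝ) : ℂ) / 2) • (θ a.2 + (Complex.conjCLE : ℂ →L[ℝ] ℂ).comp (θ a.2))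
  else (((√2 : ℝ) : ℂ) / (2 * I)) • (θ a.2 - (Complex.conjCLE : ℂ →L[ℝ] ℂ).comp (θ a.2))

/-- The real coordinates with respect to the orthonormal basis. -/
def rcoord (θ : Fin n → V →L[ℝ] ℂ) (a : Fin 2 × Fin n) (v : V) : ℝ :=
  if a.1 = 0 then √2 * (θ a.2 v).re else √2 * (θ a.2 v).im

theorem coord_eq (a : Fin 2 × Fin n) (v : V) : coord θ a v = rcoord θ a v := by
  unfold coord rcoord
  split_ifs
  · change ((√2 : ℝ) : ℂ) / 2 * (θ a.2 v + starRingEnd ℂ (θ a.2 v)) = _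
    rw [Complex.add_conj]
    push_cast
    ring
  · change ((√2 : ℝ) : ℂ) / (2 * I) * (θ a.2 v - starRingEnd ℂ (θ a.2 v)) = _
    rw [Complex.sub_conj]
    push_cast
    field_simp

theorem sqrt_two_sq : ((√2 : ℝ) : ℂ) * ((√2 : ℝ) : ℂ) = 2 := by
  rw [← ofReal_mul, Real.mul_self_sqrt (by norm_num)]
  norm_num

theorem sqrt_two_ne : ((√2 : ℝ) : ℂ) ≠ 0 := by
  intro h
  have := sqrt_two_sq
  rw [h] at this
  norm_num at this

theorem eq_sum_rcoord (hinj : ∀ v, (∀ j, θ j v = 0) → v = 0) {e : Fin 2 × Fin n → V}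
    (he : ∀ a j, θ j (e a) =
      if j = a.2 then ((√2 : ℝ) : ℂ)⁻¹ * (if a.1 = 0 then 1 else I) else 0) (v : V) :
    v = ∑ a, rcoord θ a v • e a := by
  rw [← sub_eq_zero]
  refine hinj _ fun j => ?_
  rw [map_sub, map_sum]
  simp only [map_smul, he]
  rw [Fintype.sum_prod_type, Fin.sum_univ_two]
  simp only [smul_ite, smul_zero, Finset.sum_ite_eq, Finset.mem_univ, if_true, rcoord,
    Complex.real_smul]
  have h2 := sqrt_two_ne
  simp only [Fin.isValue, one_ne_zero, if_false]
  push_cast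
  have h3 : ((√2 : ℝ) : ℂ) * ((√2 : ℝ) : ℂ)⁻¹ = 1 := mul_inv_cancel₀ h2
  linear_combination (-1 : ℂ) * Complex.re_add_im (θ j v) -
    ((θ j v).re + (θ j v).im * I) * h3

theorem rcoord_basis {e : Fin 2 × Fin n → V}
    (he : ∀ a j, θ j (e a) =
      if j = a.2 then ((√2 : ℝ) : ℂ)⁻¹ * (if a.1 = 0 then 1 else I) else 0)
    (a b : Fin 2 × Fin n) : rcoord θ a (e b) = if a = b then 1 else 0 := by
  have h3 : √2 * (√2)⁻¹ = (1 : ℝ) := mul_inv_cancel₀ (by positivity)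
  obtain ⟨s, j⟩ := a
  obtain ⟨t, k⟩ := b
  rw [rcoord, he, ← Complex.ofReal_inv]
  by_cases hjk : j = k
  · fin_cases s <;> fin_cases t <;> simp [hjk, -Complex.ofReal_inv]
  · simp [hjk]

theorem orthonormal_dual (hJ : ∀ j v, θ j (J v) = I * θ j v) {e : Fin 2 × Fin n → V}
    (he : ∀ a j, θ j (e a) =
      if j = a.2 then ((√2 : ℝ) : ℂ)⁻¹ * (if a.1 = 0 then 1 else I) else 0)
    (a b : Fin 2 × Fin n) :
    (∑ j, xi (θ j)) [e a, J (e b)] = if a = b then 1 else 0 := by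
  have h3 : ((√2 : ℝ) : ℂ)⁻¹ * ((√2 : ℝ) : ℂ)⁻¹ = 1 / 2 := by
    rw [← mul_inv, sqrt_two_sq]; norm_num
  obtain ⟨s, j⟩ := a
  obtain ⟨t, k⟩ := b
  rw [sum_xi_apply_J hJ]
  simp only [he]
  by_cases hjk : j = k
  · subst hjk
    rw [Finset.sum_eq_single j]
    · simp only [if_true, map_mul, map_inv₀, Complex.conj_ofReal]
      fin_cases s <;> fin_cases t <;> simp <;>
        first
        | ring1
        | linear_combination (2 : ℂ) * h3
        | linear_combination (2 : ℂ) * h3 - 2 * ((√2 : ℝ) : ℂ)⁻¹ ^ 2 * I_sq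
    · intro l _ hl
      simp [hl]
    · simp
  · rw [Finset.sum_eq_zero]
    · simp [hjk]
    · intro l _
      by_cases hl : l = j
      · subst hl; simp [hjk]
      · simp [hl]

/-- Expansion of a `2`-form in a basis. -/
theorem toSh_eq_sum_coord (hinj : ∀ v, (∀ j, θ j v = 0) → v = 0) {e : Fin 2 × Fin n → V}
    (he : ∀ a j, θ j (e a) =
      if j = a.2 then ((√2 : ℝ) : ℂ)⁻¹ * (if a.1 = 0 then 1 else I) else 0)
    (u : V [⋀^Fin 2]→L[ℝ] ℂ) :
    toSh u = (1 / 2 : ℂ) • ∑ a, ∑ b, u ![e a, e b] • (sh1 (coord θ a) * sh1 (coord θ b)) := by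
  have hbil : ∀ v w, u ![v, w] = ∑ a, ∑ b, coord θ a v * coord θ b w * u ![e a, e b] := by
    intro v w
    have h3 : ∀ v w, u ![v, w] = ∑ a, coord θ a v * u ![e a, w] := by
      intro v w
      conv_lhs => rw [eq_sum_rcoord hinj he v]
      rw [← pairLin_apply, map_sum]
      refine Finset.sum_congr rfl fun a _ => ?_
      rw [map_smul, pairLin_apply, coord_eq, Complex.real_smul]
    rw [h3]
    refine Finset.sum_congr rfl fun a _ => ?_
    rw [pair_swap, h3, ← Finset.sum_neg_distrib, Finset.mul_sum]
    refine Finset.sum_congr rfl fun b _ => ?_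
    rw [pair_swap u (e a)]
    ring
  have hh : ∀ a b, (sh1 (coord θ a) * sh1 (coord θ b)).IsHom 2 := fun a b =>
    (sh1_isHom _).mul (sh1_isHom _)
  refine (toSh_isHom u).ext ?_ fun v => ?_
  · intro l hl
    rw [Sh.smul_apply, Sh.sum_apply, Finset.sum_eq_zero, mul_zero]
    intro a _
    rw [Sh.sum_apply, Finset.sum_eq_zero]
    intro b _
    rw [Sh.smul_apply, hh a b l hl, mul_zero]
  · have hv : List.ofFn v = [v 0, v 1] := by simp
    rw [hv, toSh_pair, Sh.smul_apply, Sh.sum_apply]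
    simp only [Sh.sum_apply, Sh.smul_apply, sh1_mul_apply]
    rw [hbil]
    have e2 : ∑ a, ∑ b, u ![e a, e b] * (coord θ a (v 1) * coord θ b (v 0)) =
        -∑ a, ∑ b, coord θ a (v 0) * coord θ b (v 1) * u ![e a, e b] := by
      rw [Finset.sum_comm, ← Finset.sum_neg_distrib]
      refine Finset.sum_congr rfl fun a _ => ?_
      rw [← Finset.sum_neg_distrib]
      refine Finset.sum_congr rfl fun b _ => ?_
      rw [pair_swap u (e b)]
      ring
    have e1 : ∑ a, ∑ b, u ![e a, e b] * (coord θ a (v 0) * coord θ b (v 1)) =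
        ∑ a, ∑ b, coord θ a (v 0) * coord θ b (v 1) * u ![e a, e b] :=
      Finset.sum_congr rfl fun a _ => Finset.sum_congr rfl fun b _ => by ring
    simp only [mul_sub, Finset.sum_sub_distrib]
    rw [e1, e2]
    ring

end Pointwise
end PSS
end

/-! ### The Hodge star on diagonal `(1,1)`-forms -/

noncomputable section
namespace PSS

open Complex

section Star

variable {V : Type*} [AddCommGroup V] [Module ℝ V] [TopologicalSpace V]
  {n : ℕ} {J : V →L[ℝ] V} {θ : Fin n → V →L[ℝ] ℂ}

theorem sh1_coord_zero (j : Fin n) :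
    sh1 (coord θ (0, j)) = (((√2 : ℝ) : ℂ) / 2) • (sh1 (θ j) + (sh1 (θ j)).conj) := by
  have : coord θ (0, j) =
      (((√2 : ℝ) : ℂ) / 2) • (θ j + (Complex.conjCLE : ℂ →L[ℝ] ℂ).comp (θ j)) := rfl
  rw [this, sh1_smul, sh1_add, sh1_conj]

theorem sh1_coord_one (j : Fin n) :
    sh1 (coord θ (1, j)) = (((√2 : ℝ) : ℂ) / (2 * I)) • (sh1 (θ j) - (sh1 (θ j)).conj) := by
  have : coord θ (1, j) =
      (((√2 : ℝ) : ℂ) / (2 * I)) • (θ j + (-1 : ℂ) • (Complex.conjCLE : ℂ →L[ℝ] ℂ).comp (θ j)) := by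
    ext v
    rw [coord, if_neg (by simp)]
    change ((√2 : ℝ) : ℂ) / (2 * I) * (θ j v - starRingEnd ℂ (θ j v)) =
      ((√2 : ℝ) : ℂ) / (2 * I) * (θ j v + (-1) * starRingEnd ℂ (θ j v))
    ring
  rw [this, sh1_smul, sh1_add, sh1_smul, sh1_conj, neg_one_smul, sub_eq_add_neg]

/-- With `x = √2 Re θ_j` and `y = √2 Im θ_j`, the product `x ∧ y` is the area form of the `j`-th
complex line. -/
theorem xi_eq_coord (j : Fin n) :
    xi (θ j) = sh1 (coord θ (0, j)) * sh1 (coord θ (1, j)) := by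
  rw [sh1_coord_zero, sh1_coord_one, smul_mul_smul_comm, add_mul, mul_sub, mul_sub, sh1_mul_self,
    sh1_conj_mul_self, Sh.anticomm_of_odd (sh1_conj_odd (θ j)) (sh1_odd (θ j)), xi]
  have : ((√2 : ℝ) : ℂ) / 2 * (((√2 : ℝ) : ℂ) / (2 * I)) = -I / 2 := by
    rw [div_mul_div_comm, sqrt_two_sq]
    field_simp
    rw [I_sq]
    norm_num
  rw [this]
  module

theorem coord_mul_eq_zero {P : Sh V} {a : Fin 2 × Fin n} (h1 : sh1 (θ a.2) * P = 0)
    (h2 : (sh1 (θ a.2)).conj * P = 0) : sh1 (coord θ a) * P = 0 := by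
  obtain ⟨s, j⟩ := a
  fin_cases s
  · change sh1 (coord θ (0, j)) * P = 0
    rw [sh1_coord_zero, smul_mul_assoc, add_mul, h1, h2, add_zero, smul_zero]
  · change sh1 (coord θ (1, j)) * P = 0
    rw [sh1_coord_one, smul_mul_assoc, sub_mul, h1, h2, sub_zero, smul_zero]

theorem sum_fin_two_arrow {ι : Type*} [Fintype ι] (F : (Fin 2 → ι) → ℂ) :
    ∑ s, F s = ∑ a, ∑ b, F ![a, b] := by
  rw [← (finTwoArrowEquiv ι).symm.sum_comp, Fintype.sum_prod_type]
  rfl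

variable (hinj : ∀ v, (∀ j, θ j v = 0) → v = 0) {e : Fin 2 × Fin n → V}
  (he : ∀ a j, θ j (e a) =
    if j = a.2 then ((√2 : ℝ) : ℂ)⁻¹ * (if a.1 = 0 then 1 else I) else 0)

-- In the expansion of `u` in the real coordinates, a term with a coordinate outside the `j`-th
-- complex line is killed by `P`. What remains is the area component of `u` on that line.
include hinj he in
theorem toSh_mul_of_block (u : V [⋀^Fin 2]→L[ℝ] ℂ) {P : Sh V} {j : Fin n}
    (h1 : ∀ l, l ≠ j → sh1 (θ l) * P = 0) (h2 : ∀ l, l ≠ j → (sh1 (θ l)).conj * P = 0) :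
    toSh u * P = u ![e (0, j), e (1, j)] • (xi (θ j) * P) := by
  have hb : ∀ a b : Fin 2 × Fin n, a.2 ≠ j ∨ b.2 ≠ j →
      sh1 (coord θ a) * sh1 (coord θ b) * P = 0 := by
    rintro a b (h | h)
    · rw [sh1_anticomm, neg_mul, mul_assoc, coord_mul_eq_zero (h1 _ h) (h2 _ h), mul_zero, neg_zero]
    · rw [mul_assoc, coord_mul_eq_zero (h1 _ h) (h2 _ h), mul_zero]
  rw [toSh_eq_sum_coord hinj he u, smul_mul_assoc, Finset.sum_mul]
  simp only [Finset.sum_mul, smul_mul_assoc]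
  have h3 : ∀ F : Fin 2 × Fin n → Sh V, (∀ a, a.2 ≠ j → F a = 0) →
      ∑ a, F a = F (0, j) + F (1, j) := by
    intro F hF
    rw [Fintype.sum_prod_type, Fin.sum_univ_two]
    congr 1
    · exact Finset.sum_eq_single j (fun k _ hk => hF _ hk) (by simp)
    · exact Finset.sum_eq_single j (fun k _ hk => hF _ hk) (by simp)
  rw [h3 _ fun a ha => Finset.sum_eq_zero fun b _ => by rw [hb a b (Or.inl ha), smul_zero],
    h3 _ fun b hb' => by rw [hb _ b (Or.inr hb'), smul_zero],
    h3 _ fun b hb' => by rw [hb _ b (Or.inr hb'), smul_zero], sh1_mul_self, sh1_mul_self,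
    sh1_anticomm (coord θ (1, j)), pair_swap u (e (1, j)), xi_eq_coord, zero_mul, neg_mul]
  module

/-- The Hodge star operator of the metric `∑ⱼ i θⱼ ∧ conj θⱼ` on diagonal `(1,1)`-forms. -/
theorem isHodgeStar_of_coframe (hJ : ∀ j v, θ j (J v) = I * θ j v)
    (hinj : ∀ v, (∀ j, θ j v = 0) → v = 0) (hs : ∀ w : Fin n → ℂ, ∃ v, ∀ j, θ j v = w j)
    [IsTopologicalAddGroup V] [ContinuousConstSMul ℝ V]
    {ω : V [⋀^Fin 2]→L[ℝ] ℂ} (hω : toSh ω = ∑ j, xi (θ j)) {l : ℕ} (h : 2 * n = 2 + l)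
    {α : V [⋀^Fin 2]→L[ℝ] ℂ} {σ : V [⋀^Fin l]→L[ℝ] ℂ} {r : Fin n → ℂ} {P : Fin n → Sh V}
    (hα : toSh α = ∑ j, r j • xi (θ j)) (hσ : toSh σ = ∑ j, r j • P j)
    (h1 : ∀ j l, l ≠ j → sh1 (θ l) * P j = 0) (h2 : ∀ j l, l ≠ j → (sh1 (θ l)).conj * P j = 0)
    (hP : ∀ j, xi (θ j) * P j = toSh (divPow ω n)) : IsHodgeStar J ω n h α σ := by
  obtain ⟨e, he⟩ := exists_dual hs
  refine ⟨e ∘ finProdFinEquiv.symm, fun a b => ?_, ?_, fun u v => ?_⟩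
  · rw [← toSh_pair, hω, Function.comp_apply, Function.comp_apply, orthonormal_dual hJ he]
    simp only [finProdFinEquiv.symm.injective.eq_iff]
  · rw [eq_top_iff]
    intro v _
    rw [eq_sum_rcoord hinj he v]
    refine Submodule.sum_mem _ fun a _ => Submodule.smul_mem _ _ (Submodule.subset_span ?_)
    exact ⟨finProdFinEquiv a, by simp⟩
  · rw [toSh_apply_cast, ← toSh_ofFn (divPow ω n) v, toSh_wedge, ← Sh.smul_apply]
    refine congrFun (?_ : (_ : Sh V) = _) _
    rw [hσ, Finset.mul_sum]
    -- The factor `P j` detects only the component of `u` on the `j`-th line, and multiplying it by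
    -- `ξ_j` completes it to the volume form.
    have e1 : ∀ j, toSh u * r j • P j =
        (r j * u ![e (0, j), e (1, j)]) • toSh (divPow ω n) := by
      intro j
      rw [mul_smul_comm, toSh_mul_of_block hinj he u (h1 j) (h2 j), hP, smul_smul]
    rw [Finset.sum_congr rfl fun j _ => e1 j, ← Finset.sum_smul]
    congr 1
    -- It remains to compute the pairing. As `α` is diagonal, only the pairs formed by `e (0, j)`
    -- and `e (1, j)` contribute; each occurs in both orders, which compensates the factor `1 / 2!`.
    rw [sum_fin_two_arrow, ← finProdFinEquiv.sum_comp]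
    have e2 : ∀ a, ∑ b, u ((e ∘ finProdFinEquiv.symm) ∘ ![finProdFinEquiv a, b]) *
        α ((e ∘ finProdFinEquiv.symm) ∘ ![finProdFinEquiv a, b]) =
        ∑ b, u ![e a, e b] * ∑ j, r j * (((if (0, j) = a then 1 else 0) *
          (if (1, j) = b then 1 else 0)) -
          ((if (0, j) = b then 1 else 0) * (if (1, j) = a then 1 else 0))) := by
      intro a
      rw [← finProdFinEquiv.sum_comp]
      refine Finset.sum_congr rfl fun b _ => ?_
      have e3 : (e ∘ finProdFinEquiv.symm) ∘ ![finProdFinEquiv a, finProdFinEquiv b] =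
          ![e a, e b] := by
        funext i
        fin_cases i <;> simp
      rw [e3, ← toSh_pair α, hα, Sh.sum_apply]
      congr 1
      refine Finset.sum_congr rfl fun j _ => ?_
      rw [Sh.smul_apply, xi_eq_coord, sh1_mul_apply]
      simp only [coord_eq, rcoord_basis he]
      simp only [apply_ite Complex.ofReal, ofReal_one, ofReal_zero]
    rw [Finset.sum_congr rfl fun a _ => e2 a]
    have e4 : ∑ a, ∑ b, u ![e a, e b] * ∑ j, r j * (((if (0, j) = a then 1 else 0) *
          (if (1, j) = b then 1 else 0)) -
          ((if (0, j) = b then 1 else 0) * (if (1, j) = a then 1 else 0))) =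
        ∑ j, r j * (u ![e (0, j), e (1, j)] - u ![e (1, j), e (0, j)]) := by
      simp only [Finset.mul_sum]
      rw [Finset.sum_congr rfl fun a _ => Finset.sum_comm, Finset.sum_comm]
      refine Finset.sum_congr rfl fun j _ => ?_
      simp only [mul_sub, Finset.sum_sub_distrib, mul_ite, mul_one, mul_zero, Finset.sum_ite_eq, Finset.mem_univ, if_true, Finset.sum_ite_irrel, Finset.sum_const_zero]
      ring
    rw [e4, Finset.mul_sum]
    refine Finset.sum_congr rfl fun j _ => ?_
    rw [pair_swap u (e (1, j))]
    norm_num [Nat.factorial]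
    ring

end Star
end PSS
end

/-! ### Uniqueness of the Hodge star and expansion of `(1,1)`-forms -/

noncomputable section
namespace PSS

open Complex

section Unique

variable {V : Type*} [AddCommGroup V] [Module ℝ V] [TopologicalSpace V]
  {n : ℕ} {J : V →L[ℝ] V} {θ : Fin n → V →L[ℝ] ℂ}

theorem pair_add_right (u : V [⋀^Fin 2]→L[ℝ] ℂ) (v w w' : V) :
    u ![v, w + w'] = u ![v, w] + u ![v, w'] := by
  rw [pair_swap, ← pairLin_apply, map_add, pairLin_apply, pairLin_apply, pair_swap u w,
    pair_swap u w']
  ring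

theorem pair_smul_right (u : V [⋀^Fin 2]→L[ℝ] ℂ) (c : ℝ) (v w : V) :
    u ![v, c • w] = c • u ![v, w] := by
  rw [pair_swap, ← pairLin_apply, map_smul, pairLin_apply, pair_swap u w, smul_neg, neg_neg]

theorem pair_add_left (u : V [⋀^Fin 2]→L[ℝ] ℂ) (v v' w : V) :
    u ![v + v', w] = u ![v, w] + u ![v', w] := (pairLin u w).map_add v v'

theorem pair_smul_left (u : V [⋀^Fin 2]→L[ℝ] ℂ) (c : ℝ) (v w : V) :
    u ![c • v, w] = c • u ![v, w] := (pairLin u w).map_smul c v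

/-- The trace of a bilinear form does not depend on the orthonormal basis. -/
theorem trace_indep {N : ℕ} {g : V →ₗ[ℝ] V →ₗ[ℝ] ℂ} {e e' : Fin N → V}
    (he : ∀ a b, g (e a) (e b) = if a = b then 1 else 0)
    (he' : ∀ a b, g (e' a) (e' b) = if a = b then 1 else 0)
    (hs : Submodule.span ℝ (Set.range e') = ⊤) (B : V →ₗ[ℝ] V →ₗ[ℝ] ℂ) :
    ∑ a, B (e a) (e a) = ∑ a, B (e' a) (e' a) := by
  have h1 : ∀ a, ∃ c : Fin N → ℝ, ∑ i, c i • e' i = e a := fun a =>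
    (Submodule.mem_span_range_iff_exists_fun ℝ).1 (hs ▸ Submodule.mem_top)
  choose O hO using h1
  have hB : ∀ (B : V →ₗ[ℝ] V →ₗ[ℝ] ℂ) a b,
      B (e a) (e b) = ∑ c, ∑ d, (O a c * O b d : ℝ) * B (e' c) (e' d) := by
    intro B a b
    rw [← hO a, ← hO b, map_sum B, LinearMap.sum_apply]
    refine Finset.sum_congr rfl fun c _ => ?_
    rw [map_smul B, map_sum]
    refine Finset.sum_congr rfl fun d _ => ?_
    rw [map_smul, LinearMap.smul_apply, Complex.real_smul, Complex.real_smul]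
    push_cast
    ring
  have hOO : Matrix.of O * (Matrix.of O).transpose = 1 := by
    ext a b
    have h2 := (hB g a b).symm.trans (he a b)
    simp only [he', mul_ite, mul_one, mul_zero, Finset.sum_ite_eq, Finset.mem_univ, if_true] at h2
    rw [Matrix.mul_apply, Matrix.one_apply]
    simp only [Matrix.of_apply, Matrix.transpose_apply]
    apply Complex.ofReal_injective
    rw [Complex.ofReal_sum, h2]
    split_ifs <;> simp
  -- Orthonormality of `e` gives orthonormal rows of the transition matrix; the trace needs
  -- orthonormal columns, which follow because the matrix is square.
  have hOO' := mul_eq_one_comm.mp hOO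
  calc ∑ a, B (e a) (e a) = ∑ a, ∑ c, ∑ d, (O a c * O a d : ℝ) * B (e' c) (e' d) :=
        Finset.sum_congr rfl fun a _ => hB B a a
    _ = ∑ c, ∑ d, ∑ a, (O a c * O a d : ℝ) * B (e' c) (e' d) := by
        rw [Finset.sum_comm]
        exact Finset.sum_congr rfl fun c _ => Finset.sum_comm
    _ = ∑ c, B (e' c) (e' c) := by
        refine Finset.sum_congr rfl fun c _ => ?_
        have h3 : ∀ d, ∑ a, ((O a c * O a d : ℝ) : ℂ) * B (e' c) (e' d) =
            if c = d then B (e' c) (e' d) else 0 := by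
          intro d
          have h4 := congrFun (congrFun hOO' c) d
          rw [Matrix.mul_apply, Matrix.one_apply] at h4
          simp only [Matrix.of_apply, Matrix.transpose_apply] at h4
          rw [← Finset.sum_mul, ← Complex.ofReal_sum, h4]
          split_ifs <;> simp
        rw [Finset.sum_congr rfl fun d _ => h3 d]
        simp

/-- The real basis attached to a coframe. -/
def coframeBasis (hinj : ∀ v, (∀ j, θ j v = 0) → v = 0) {e : Fin 2 × Fin n → V}
    (he : ∀ a j, θ j (e a) =
      if j = a.2 then ((√2 : ℝ) : ℂ)⁻¹ * (if a.1 = 0 then 1 else I) else 0) :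
    Module.Basis (Fin 2 × Fin n) ℝ V :=
  Module.Basis.ofEquivFun
    { toFun := fun v a => rcoord θ a v
      invFun := fun c => ∑ a, c a • e a
      map_add' := fun v w => by
        funext a
        change rcoord θ a (v + w) = rcoord θ a v + rcoord θ a w
        apply Complex.ofReal_injective
        rw [Complex.ofReal_add, ← coord_eq, ← coord_eq, ← coord_eq, map_add]
      map_smul' := fun c v => by
        funext a
        change rcoord θ a (c • v) = c * rcoord θ a v
        apply Complex.ofReal_injective
        rw [Complex.ofReal_mul, ← coord_eq, ← coord_eq, map_smul, Complex.real_smul]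
      left_inv := fun v => (eq_sum_rcoord hinj he v).symm
      right_inv := fun c => by
        funext a
        apply Complex.ofReal_injective
        rw [← coord_eq, map_sum]
        simp only [map_smul, coord_eq, rcoord_basis he, apply_ite Complex.ofReal, ofReal_one,
          ofReal_zero, smul_ite, smul_zero, Finset.sum_ite_eq, Finset.mem_univ, if_true]
        simp }

theorem coframeBasis_apply (hinj : ∀ v, (∀ j, θ j v = 0) → v = 0) {e : Fin 2 × Fin n → V}
    (he : ∀ a j, θ j (e a) =
      if j = a.2 then ((√2 : ℝ) : ℂ)⁻¹ * (if a.1 = 0 then 1 else I) else 0) (a) :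
    coframeBasis hinj he a = e a := by
  rw [coframeBasis, Module.Basis.coe_ofEquivFun]
  change ∑ b, (Pi.single a (1 : ℝ) : Fin 2 × Fin n → ℝ) b • e b = e a
  simp [Pi.single_apply]

/-- A form of degree `2n - 2` that has zero product with all `2`-forms is zero. -/
theorem eq_zero_of_wedge_eq_zero (hinj : ∀ v, (∀ j, θ j v = 0) → v = 0)
    (hs : ∀ w : Fin n → ℂ, ∃ v, ∀ j, θ j v = w j) {l : ℕ} (h : 2 * n = 2 + l)
    {σ : V [⋀^Fin l]→L[ℝ] ℂ} (hσ : ∀ u : V [⋀^Fin 2]→L[ℝ] ℂ, toSh u * toSh σ = 0) : σ = 0 := by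
  obtain ⟨e, he⟩ := exists_dual hs
  apply ContinuousAlternatingMap.toAlternatingMap_injective
  refine (coframeBasis hinj he).ext_alternating fun s hsi => ?_
  simp only [coframeBasis_apply]
  change σ (fun i => e (s i)) = 0
  -- The `2n - 2` distinct basis vectors leave out exactly two, `a` and `b`. Testing against the
  -- product of their dual functionals isolates the value of `σ` on the given vectors.
  have hcard : (Finset.univ \ Finset.univ.image s).card = 2 := by
    rw [Finset.card_sdiff_of_subset (Finset.subset_univ _), Finset.card_image_of_injective _ hsi,
      Finset.card_univ, Finset.card_univ, Fintype.card_prod, Fintype.card_fin, Fintype.card_fin,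
      Fintype.card_fin]
    omega
  obtain ⟨a, b, hab, hset⟩ := Finset.card_eq_two.mp hcard
  have ha : ∀ i, a ≠ s i := by
    intro i hi
    have : a ∈ Finset.univ \ Finset.univ.image s := by rw [hset]; simp
    simp [hi] at this
  have hb : ∀ i, b ≠ s i := by
    intro i hi
    have : b ∈ Finset.univ \ Finset.univ.image s := by rw [hset]; simp
    simp [hi] at this
  have h1 := congrFun (hσ (wedge (oneForm (coord θ a)) (oneForm (coord θ b))))
    (e a :: e b :: List.ofFn fun i => e (s i))
  have hc : ∀ a b, coord θ a (e b) = if a = b then 1 else 0 := by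
    intro a b
    rw [coord_eq, rcoord_basis he]
    split_ifs <;> simp
  rw [toSh_wedge, mul_assoc, sh1_mul_cons_of_zero, sh1_mul_cons_of_zero, hc, hc, if_pos rfl,
    if_pos rfl, one_mul, one_mul, toSh_ofFn] at h1
  · exact h1
  · intro v hv
    obtain ⟨i, rfl⟩ := List.mem_ofFn.1 hv
    rw [hc, if_neg (hb i)]
  · intro v hv
    rcases List.mem_cons.1 hv with rfl | hv
    · rw [hc, if_neg hab]
    · obtain ⟨i, rfl⟩ := List.mem_ofFn.1 hv
      rw [hc, if_neg (ha i)]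

/-- The Hodge star of a `2`-form is unique. -/
theorem isHodgeStar_unique [IsTopologicalAddGroup V] [ContinuousConstSMul ℝ V]
    (hinj : ∀ v, (∀ j, θ j v = 0) → v = 0)
    (hs : ∀ w : Fin n → ℂ, ∃ v, ∀ j, θ j v = w j) {l : ℕ} {h : 2 * n = 2 + l}
    {ω α : V [⋀^Fin 2]→L[ℝ] ℂ} {σ σ' : V [⋀^Fin l]→L[ℝ] ℂ}
    (H : IsHodgeStar J ω n h α σ) (H' : IsHodgeStar J ω n h α σ') : σ = σ' := by
  obtain ⟨e, he, -, H⟩ := H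
  obtain ⟨e', he', hspan', H'⟩ := H'
  rw [← sub_eq_zero]
  refine eq_zero_of_wedge_eq_zero hinj hs h fun u => ?_
  have htr := trace_indep (g := LinearMap.mk₂ ℝ (fun u v => ω ![u, J v])
    (fun v v' w => pair_add_left ω v v' _) (fun c v w => pair_smul_left ω c v _)
    (fun v w w' => by rw [map_add, pair_add_right])
    (fun c v w => by rw [map_smul, pair_smul_right])) he he' hspan'
  -- The two defining conditions may use different orthonormal bases. The pairing is a trace in each
  -- of the two arguments separately, so the basis is changed in one argument at a time.
  have hT : ∑ s : Fin 2 → Fin (2 * n), u (e ∘ s) * α (e ∘ s) =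
      ∑ s : Fin 2 → Fin (2 * n), u (e' ∘ s) * α (e' ∘ s) := by
    rw [sum_fin_two_arrow, sum_fin_two_arrow]
    have hc : ∀ (e : Fin (2 * n) → V) a b, e ∘ ![a, b] = ![e a, e b] := by
      intro e a b
      funext i
      fin_cases i <;> rfl
    simp only [hc]
    have t1 : ∀ a, ∑ b, u ![e a, e b] * α ![e a, e b] =
        ∑ b, u ![e a, e' b] * α ![e a, e' b] := fun a =>
      htr (LinearMap.mk₂ ℝ (fun v w => u ![e a, v] * α ![e a, w])
        (fun v v' w => by rw [pair_add_right]; ring)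
        (fun c v w => by rw [pair_smul_right, smul_mul_assoc])
        (fun v w w' => by rw [pair_add_right]; ring)
        (fun c v w => by rw [pair_smul_right, mul_smul_comm]))
    have t2 : ∀ b, ∑ a, u ![e a, e' b] * α ![e a, e' b] =
        ∑ a, u ![e' a, e' b] * α ![e' a, e' b] := fun b =>
      htr (LinearMap.mk₂ ℝ (fun v w => u ![v, e' b] * α ![w, e' b])
        (fun v v' w => by rw [pair_add_left]; ring)
        (fun c v w => by rw [pair_smul_left, smul_mul_assoc])
        (fun v w w' => by rw [pair_add_left]; ring)
        (fun c v w => by rw [pair_smul_left, mul_smul_comm]))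
    rw [Finset.sum_congr rfl fun a _ => t1 a, Finset.sum_comm,
      Finset.sum_congr rfl fun b _ => t2 b, Finset.sum_comm]
  rw [toSh_sub, mul_sub, sub_eq_zero, ← toSh_wedge, ← toSh_wedge]
  ext l'
  by_cases hl : l'.length = 2 * n
  · obtain ⟨v, rfl⟩ := exists_ofFn hl
    rw [← toSh_apply_cast h.symm, ← toSh_apply_cast h.symm, H, H', hT]
  · rw [toSh_isHom _ _ (by omega), toSh_isHom _ _ (by omega)]

/-- Expansion of a `(1,1)`-form. -/
theorem exists_sum_of_type [IsTopologicalAddGroup V] [ContinuousConstSMul ℝ V]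
    (hJ : ∀ j v, θ j (J v) = I * θ j v) (hinj : ∀ v, (∀ j, θ j v = 0) → v = 0)
    (hs : ∀ w : Fin n → ℂ, ∃ v, ∀ j, θ j v = w j) {u : V [⋀^Fin 2]→L[ℝ] ℂ}
    (hu : ShType J 1 1 (toSh u)) :
    ∃ d : Fin n → Fin n → ℂ,
      toSh u = ∑ j, ∑ k, d j k • (sh1 (θ j) * (sh1 (θ k)).conj) := by
  choose b hb using fun j : Fin n => hs (Pi.single j 1)
  have hJJ : ∀ v, J (J v) = -v := by
    intro v
    rw [← sub_eq_zero]
    refine hinj _ fun j => ?_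
    rw [map_sub, hJ, hJ, map_neg, ← mul_assoc, I_mul_I]
    ring
  -- Bidegree `(1,1)` is used only through the scalar `c = i`.
  have hinv : ∀ v w, u ![J v, J w] = u ![v, w] := by
    intro v w
    have h1 := congrFun (hu I) [v, w]
    have h2 : cMul J I = J := by
      ext v
      simp [cMul]
    rw [h2, Sh.pull_apply, Sh.smul_apply, conj_I, pow_one, pow_one, mul_neg, I_mul_I, neg_neg,
      one_mul, List.map_cons, List.map_cons, List.map_nil, toSh_pair, toSh_pair] at h1
    exact h1
  have hJ1 : ∀ v w, u ![J v, w] = -u ![v, J w] := by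
    intro v w
    rw [← hinv (J v) w, hJJ, ← neg_one_smul ℝ v, pair_smul_left, neg_one_smul]
  have hv : ∀ v, v = ∑ j, ((θ j v).re • b j + (θ j v).im • J (b j)) := by
    intro v
    rw [← sub_eq_zero]
    refine hinj _ fun k => ?_
    rw [map_sub, map_sum]
    simp only [map_add, map_smul, hJ, hb, Pi.single_apply, Complex.real_smul]
    simp only [mul_ite, mul_one, mul_zero, Finset.sum_add_distrib, Finset.sum_ite_eq,
      Finset.mem_univ, if_true]
    linear_combination (-1 : ℂ) * Complex.re_add_im (θ k v)
  -- By invariance under `J`, this `h` is complex linear in `v` and antilinear in `w`, and `u(v, w)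
  -- = h(v, w) - h(w, v)`. The coefficients sought are the entries of the matrix of `h`.
  let h : V → V → ℂ := fun v w => (1 / 2 : ℂ) * (u ![v, w] + I * u ![v, J w])
  have hl : ∀ v w, h v w = ∑ j, θ j v * h (b j) w := by
    intro v w
    simp only [h]
    conv_lhs => rw [hv v]
    rw [← pairLin_apply, ← pairLin_apply, map_sum, map_sum, Finset.mul_sum, ← Finset.sum_add_distrib,
      Finset.mul_sum]
    refine Finset.sum_congr rfl fun j _ => ?_
    rw [map_add, map_add, map_smul, map_smul, map_smul, map_smul]
    simp only [pairLin_apply, hJ1, hJJ, Complex.real_smul]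
    rw [← neg_one_smul ℝ w, pair_smul_right, Complex.real_smul]
    push_cast
    conv_rhs => rw [← Complex.re_add_im (θ j v)]
    linear_combination (-(θ j v).im / 2 * u ![b j, J w] : ℂ) * I_sq
  have hr : ∀ v w, h v w = ∑ j, starRingEnd ℂ (θ j w) * h v (b j) := by
    intro v w
    simp only [h]
    conv_lhs => rw [hv w]
    rw [map_sum, pair_swap u v, pair_swap u v, ← pairLin_apply, ← pairLin_apply, map_sum, map_sum,
      ← Finset.sum_neg_distrib, ← Finset.sum_neg_distrib, Finset.mul_sum, ← Finset.sum_add_distrib,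
      Finset.mul_sum]
    refine Finset.sum_congr rfl fun j _ => ?_
    simp only [map_add, map_smul, hJJ, map_neg]
    simp only [pairLin_apply, Complex.real_smul, pair_swap u (b j), pair_swap u (J (b j))]
    have hc : starRingEnd ℂ (θ j w) = (θ j w).re - (θ j w).im * I := by
      apply Complex.ext <;> simp
    rw [hc]
    linear_combination ((θ j w).im / 2 * u ![v, J (b j)] : ℂ) * I_sq
  have hh : ∀ v w, u ![v, w] = h v w - h w v := by
    intro v w
    simp only [h]
    rw [pair_swap u w v, pair_swap u w (J v), hJ1 v w]
    ring
  refine ⟨fun j k => h (b j) (b k), (toSh_isHom u).ext ?_ fun v => ?_⟩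
  · intro l hl
    rw [Sh.sum_apply, Finset.sum_eq_zero]
    intro j _
    rw [Sh.sum_apply, Finset.sum_eq_zero]
    intro k _
    rw [Sh.smul_apply, sh1_conj, (sh1_isHom _).mul (sh1_isHom _) l hl, mul_zero]
  · have hv2 : List.ofFn v = [v 0, v 1] := by simp
    rw [hv2, toSh_pair, hh, Sh.sum_apply, hl (v 0), hl (v 1), ← Finset.sum_sub_distrib]
    refine Finset.sum_congr rfl fun j _ => ?_
    rw [Sh.sum_apply, hr (b j), hr (b j) (v 0), Finset.mul_sum, Finset.mul_sum,
      ← Finset.sum_sub_distrib]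
    refine Finset.sum_congr rfl fun k _ => ?_
    rw [Sh.smul_apply, sh1_conj, sh1_mul_apply]
    change _ = _ * (_ * starRingEnd ℂ (θ k (v 1)) - _ * starRingEnd ℂ (θ k (v 0)))
    ring

end Unique
end PSS
end

/-! ### Products of commuting elements of square zero -/

noncomputable section
namespace PSS

open Complex

section SquareZero

variable {S : Type*} [CommRing S]

theorem add_pow_succ_of_mul_self_eq_zero {x : S} (hx : x * x = 0) (a : S) (k : ℕ) :
    (a + x) ^ (k + 1) = a ^ (k + 1) + (k + 1) * a ^ k * x := by
  induction k with
  | zero => simp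
  | succ k ih =>
    rw [pow_succ, ih]
    push_cast
    linear_combination ((k + 1) * a ^ k) * hx

/-- Only squarefree monomials survive in the power of a sum. Adding one more element produces the
next power of the shorter sum, whose vanishing is therefore proved in the same induction. -/
theorem sum_pow_of_mul_self_eq_zero {n : ℕ} (x : Fin n → S) (hx : ∀ j, x j * x j = 0) :
    (∑ j, x j) ^ n = n.factorial * ∏ j, x j ∧ (∑ j, x j) ^ (n + 1) = 0 := by
  induction n with
  | zero => simp
  | succ n ih =>
    obtain ⟨h1, h2⟩ := ih (fun j => x j.castSucc) fun j => hx _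
    rw [Fin.sum_univ_castSucc, Fin.prod_univ_castSucc,
      add_pow_succ_of_mul_self_eq_zero (hx (Fin.last n)),
      add_pow_succ_of_mul_self_eq_zero (hx (Fin.last n)), pow_succ _ (n + 1), h1, h2,
      Nat.factorial_succ]
    push_cast
    constructor <;> ring

theorem mul_sum_pow_of_mul_self_eq_zero {n : ℕ} (x : Fin (n + 1) → S) (hx : ∀ j, x j * x j = 0)
    (j : Fin (n + 1)) : x j * (∑ l, x l) ^ n = n.factorial * ∏ l, x l := by
  cases n with
  | zero =>
    have h : j = 0 := Subsingleton.elim (α := Fin 1) _ _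
    rw [h]
    simp
  | succ n =>
    have h := (sum_pow_of_mul_self_eq_zero (fun l => x (j.succAbove l)) fun l => hx _).1
    rw [Fin.sum_univ_succAbove x j, Fin.prod_univ_succAbove x j, add_comm (x j),
      add_pow_succ_of_mul_self_eq_zero (hx j), h]
    linear_combination ((n + 1) * (∑ l, x (j.succAbove l)) ^ n) * hx j

end SquareZero

section Coframe

variable {V : Type*} [AddCommGroup V] [Module ℝ V] [TopologicalSpace V] {n m : ℕ}

/-- The form `i f ∧ conj f` as an element of the center of the shuffle algebra. -/
def xiC (f : V →L[ℝ] ℂ) : Subalgebra.center ℂ (Sh V) :=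
  ⟨xi f, Subalgebra.mem_center_iff.2 fun G => (xi_comm f G).symm⟩

theorem coe_xiC (f : V →L[ℝ] ℂ) : (xiC f : Sh V) = xi f := rfl

theorem xiC_mul_self (f : V →L[ℝ] ℂ) : xiC f * xiC f = 0 := Subtype.ext (xi_mul_self f)

/-- The product of the `i θₗ ∧ conj θₗ` with `l ≠ j`. -/
def coprod (θ : Fin (n + 1) → V →L[ℝ] ℂ) (j : Fin (n + 1)) : Sh V :=
  (List.ofFn fun l : Fin n => xi (θ (j.succAbove l))).prod

theorem coprod_eq (θ : Fin (n + 1) → V →L[ℝ] ℂ) (j : Fin (n + 1)) :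
    coprod θ j = ((∏ l : Fin n, xiC (θ (j.succAbove l)) : Subalgebra.center ℂ (Sh V)) : Sh V) := by
  rw [← List.prod_ofFn, ← Subalgebra.coe_val, map_list_prod, List.map_ofFn]
  rfl

theorem mul_coprod_eq_zero (θ : Fin (n + 1) → V →L[ℝ] ℂ) {j l : Fin (n + 1)} (h : l ≠ j) {F : Sh V}
    (hF : F * xi (θ l) = 0) : F * coprod θ j = 0 := by
  obtain ⟨i, rfl⟩ := Fin.exists_succAbove_eq h
  rw [coprod_eq, Finset.prod_eq_mul_prod_sdiff_singleton_of_mem (Finset.mem_univ i),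
    Subalgebra.coe_mul, coe_xiC, ← mul_assoc, hF, zero_mul]

variable {θ : Fin n → V →L[ℝ] ℂ} {ω : V [⋀^Fin 2]→L[ℝ] ℂ}

theorem toSh_divPow_eq (hω : toSh ω = ∑ j, xi (θ j)) (k : ℕ) :
    toSh (divPow ω k) = (((k.factorial : ℂ)⁻¹ • (∑ j, xiC (θ j)) ^ k :
      Subalgebra.center ℂ (Sh V)) : Sh V) := by
  rw [toSh_divPow, hω, Subalgebra.coe_smul, Subalgebra.coe_pow, AddSubmonoidClass.coe_finsetSum]
  rfl

theorem toSh_divPow_top (hω : toSh ω = ∑ j, xi (θ j)) :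
    toSh (divPow ω n) = ((∏ j, xiC (θ j) : Subalgebra.center ℂ (Sh V)) : Sh V) := by
  rw [toSh_divPow_eq hω, (sum_pow_of_mul_self_eq_zero _ fun j => xiC_mul_self (θ j)).1,
    ← nsmul_eq_mul, ← Nat.cast_smul_eq_nsmul ℂ,
    inv_smul_smul₀ (Nat.cast_ne_zero.2 n.factorial_ne_zero)]

theorem xi_mul_coprod {θ : Fin (n + 1) → V →L[ℝ] ℂ} (hω : toSh ω = ∑ j, xi (θ j))
    (j : Fin (n + 1)) : xi (θ j) * coprod θ j = toSh (divPow ω (n + 1)) := by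
  rw [toSh_divPow_top hω, coprod_eq, Fin.prod_univ_succAbove _ j, Subalgebra.coe_mul]
  rfl

/-- With `n = m + 2`, one has `ω ∧ ω_m ∧ ξ_j = ω^{m+1} ∧ ξ_j / m! = ((m+1)! / m!) ω_n` for every
`j`. This is the trace formula behind the associated function. -/
theorem toSh_mul_divPow_mul {θ : Fin (m + 2) → V →L[ℝ] ℂ} (hω : toSh ω = ∑ j, xi (θ j))
    (r : Fin (m + 2) → ℂ) :
    toSh ω * (toSh (divPow ω m) * ∑ j, r j • xi (θ j)) =
      (((m : ℂ) + 1) * ∑ j, r j) • toSh (divPow ω (m + 2)) := by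
  have h : ∀ j, toSh ω * (toSh (divPow ω m) * xi (θ j)) =
      ((m : ℂ) + 1) • toSh (divPow ω (m + 2)) := by
    intro j
    have h1 := mul_sum_pow_of_mul_self_eq_zero (fun l => xiC (θ l)) (fun j => xiC_mul_self (θ j)) j
    have h2 : (((∑ j, xiC (θ j)) * (((m.factorial : ℂ)⁻¹ • (∑ j, xiC (θ j)) ^ m) * xiC (θ j)) :
        Subalgebra.center ℂ (Sh V)) : Sh V) = (((m : ℂ) + 1) • ∏ j, xiC (θ j) :
        Subalgebra.center ℂ (Sh V)) := by
      congr 1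
      rw [smul_mul_assoc, mul_smul_comm, ← mul_assoc, ← pow_succ', mul_comm, h1, ← nsmul_eq_mul,
        ← Nat.cast_smul_eq_nsmul ℂ, smul_smul, Nat.factorial_succ, mul_comm (m + 1)]
      congr 1
      push_cast
      rw [← mul_assoc, inv_mul_cancel₀ (Nat.cast_ne_zero.2 m.factorial_ne_zero), one_mul]
    rw [toSh_divPow_top hω, ← Subalgebra.coe_smul, ← h2, toSh_divPow_eq hω, hω, Subalgebra.coe_mul,
      Subalgebra.coe_mul, AddSubmonoidClass.coe_finsetSum]
    rfl
  rw [Finset.mul_sum, Finset.mul_sum, Finset.mul_sum, Finset.sum_smul]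
  refine Finset.sum_congr rfl fun j _ => ?_
  rw [mul_smul_comm, mul_smul_comm, h, smul_smul, mul_comm]

end Coframe

section Threefold

variable {V : Type*} [AddCommGroup V] [Module ℝ V] [TopologicalSpace V]
  {θ : Fin 3 → V →L[ℝ] ℂ}

theorem sh1_conj_anticomm (f g : V →L[ℝ] ℂ) : (sh1 f).conj * sh1 g = -(sh1 g * (sh1 f).conj) :=
  Sh.anticomm_of_odd (sh1_conj_odd f) (sh1_odd g)

/-- The volume form takes the value `1` on the dual real basis, taken in the order of its factors.
-/
theorem prod_xi_ne_zero (hs : ∀ w : Fin 3 → ℂ, ∃ v, ∀ j, θ j v = w j) :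
    xi (θ 0) * xi (θ 1) * xi (θ 2) ≠ 0 := by
  obtain ⟨e, he⟩ := exists_dual hs
  intro h
  have hc : ∀ a b, coord θ a (e b) = if a = b then 1 else 0 := by
    intro a b
    rw [coord_eq, rcoord_basis he]
    split_ifs <;> simp
  have h1 := congrFun h [e (0, 0), e (1, 0), e (0, 1), e (1, 1), e (0, 2), e (1, 2)]
  simp only [xi_eq_coord, mul_assoc] at h1
  rw [sh1_mul_cons_of_zero, sh1_mul_cons_of_zero, sh1_mul_cons_of_zero, sh1_mul_cons_of_zero,
    sh1_mul_cons_of_zero, sh1_apply] at h1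
  · simp [hc] at h1
  all_goals simp [hc]

/-- The product `f ∧ conj g` as an element of the center. -/
def pairC (f g : V →L[ℝ] ℂ) : Subalgebra.center ℂ (Sh V) :=
  ⟨sh1 f * (sh1 g).conj, Subalgebra.mem_center_iff.2 fun G => (Sh.commute_of_even (by
    rw [Sh.par_mul, sh1_odd, sh1_conj_odd, neg_mul_neg]) G).symm⟩

theorem pairC_mul_left (f g g' : V →L[ℝ] ℂ) : pairC f g * pairC f g' = 0 := by
  apply Subtype.ext
  change sh1 f * (sh1 g).conj * (sh1 f * (sh1 g').conj) = 0
  rw [mul_assoc, ← mul_assoc _ (sh1 f), sh1_conj_anticomm, ← mul_assoc, mul_neg, ← mul_assoc,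
    sh1_mul_self]
  simp

theorem pairC_mul_right (f f' g : V →L[ℝ] ℂ) : pairC f g * pairC f' g = 0 := by
  apply Subtype.ext
  change sh1 f * (sh1 g).conj * (sh1 f' * (sh1 g).conj) = 0
  rw [mul_assoc, ← mul_assoc _ (sh1 f'), sh1_conj_anticomm, neg_mul, mul_assoc, sh1_conj_mul_self]
  simp

theorem pairC_mul_swap (f g : V →L[ℝ] ℂ) : pairC f g * pairC g f = -(pairC f f * pairC g g) := by
  have h : (sh1 g).conj * sh1 g = -(pairC g g : Subalgebra.center ℂ (Sh V)) :=
    sh1_conj_anticomm g g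
  apply Subtype.ext
  change sh1 f * (sh1 g).conj * (sh1 g * (sh1 f).conj) =
    -(sh1 f * (sh1 f).conj * (pairC g g : Subalgebra.center ℂ (Sh V)))
  rw [mul_assoc, ← mul_assoc _ (sh1 g), h, neg_mul, mul_neg, mul_assoc,
    Subalgebra.mem_center_iff.1 (pairC g g).2]

theorem xiC_eq (f : V →L[ℝ] ℂ) : xiC f = I • pairC f f := rfl

/-- Here `y j k` stands for `θ_j ∧ conj θ_k`. Multiplication by `y q p` with `p ≠ q` leaves only the
multiple `d p q` of the volume element, up to sign. Multiplication by a diagonal `y p p` leaves the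
sum of the other two diagonal coefficients, and the three such sums determine the diagonal. -/
theorem eq_zero_of_sum_mul_eq_zero {S : Type*} [CommRing S] [Algebra ℂ S] {y : Fin 3 → Fin 3 → S}
    (hl : ∀ j k l, y j k * y j l = 0) (hr : ∀ j k l, y j k * y l k = 0)
    (hsw : ∀ j k, y j k * y k j = -(y j j * y k k)) (hT : y 0 0 * (y 1 1 * y 2 2) ≠ 0)
    {d : Fin 3 → Fin 3 → ℂ} (h0 : (∑ j, y j j) * (∑ j, ∑ k, d j k • y j k) = 0) : d = 0 := by
  have hz : ∀ c : ℂ, c • (y 0 0 * (y 1 1 * y 2 2)) = 0 → c = 0 := fun c hc =>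
    (smul_eq_zero.1 hc).resolve_right hT
  have hl1 : ∀ j k l z, y j k * (y j l * z) = 0 := fun j k l z => by rw [← mul_assoc, hl, zero_mul]
  have hr1 : ∀ j k l z, y j k * (y l k * z) = 0 := fun j k l z => by rw [← mul_assoc, hr, zero_mul]
  have hl2 : ∀ j k l z, y j k * (z * y j l) = 0 := fun j k l z => by rw [mul_comm z, hl1]
  have hr2 : ∀ j k l z, y j k * (z * y l k) = 0 := fun j k l z => by rw [mul_comm z, hr1]
  have h01 : ∀ p q, ∑ l, ∑ j, ∑ k, d j k • (y l l * (y q p * y j k)) = 0 := by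
    intro p q
    have h1 := congrArg (y q p * ·) h0
    simp only [mul_zero] at h1
    rw [← h1, mul_left_comm, Finset.sum_mul]
    simp only [Finset.mul_sum, mul_smul_comm]
  have e1 : y 0 0 * (y 2 2 * y 1 1) = y 0 0 * (y 1 1 * y 2 2) := by ring
  have e2 : y 1 1 * (y 0 0 * y 2 2) = y 0 0 * (y 1 1 * y 2 2) := by ring
  have e3 : y 1 1 * (y 2 2 * y 0 0) = y 0 0 * (y 1 1 * y 2 2) := by ring
  have e4 : y 2 2 * (y 0 0 * y 1 1) = y 0 0 * (y 1 1 * y 2 2) := by ring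
  have e5 : y 2 2 * (y 1 1 * y 0 0) = y 0 0 * (y 1 1 * y 2 2) := by ring
  have g00 := h01 0 0
  have g11 := h01 1 1
  have g22 := h01 2 2
  have g01 := h01 0 1
  have g02 := h01 0 2
  have g10 := h01 1 0
  have g12 := h01 1 2
  have g20 := h01 2 0
  have g21 := h01 2 1
  simp only [Fin.sum_univ_three, hl, hr, hl1, hr1, hl2, hr2, hsw, e1, e2, e3, e4, e5, mul_neg,
    mul_zero, smul_zero, neg_zero, add_zero, zero_add, smul_neg, neg_eq_zero, ← add_smul]
    at g00 g11 g22 g01 g02 g10 g12 g20 g21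
  have k00 := hz _ g00
  have k11 := hz _ g11
  have k22 := hz _ g22
  funext p q
  fin_cases p <;> fin_cases q <;> dsimp
  · linear_combination (k11 + k22 - k00) / 2
  · exact hz _ g01
  · exact hz _ g02
  · exact hz _ g10
  · linear_combination (k00 + k22 - k11) / 2
  · exact hz _ g12
  · exact hz _ g20
  · exact hz _ g21
  · linear_combination (k00 + k11 - k22) / 2

/-- In dimension `3` the product with the metric is injective on forms of type `(1,1)`. -/
theorem eq_zero_of_sum_xi_mul_eq_zero (hs : ∀ w : Fin 3 → ℂ, ∃ v, ∀ j, θ j v = w j)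
    {d : Fin 3 → Fin 3 → ℂ}
    (h : (∑ j, xi (θ j)) * (∑ j, ∑ k, d j k • (sh1 (θ j) * (sh1 (θ k)).conj)) = 0) :
    d = 0 := by
  refine eq_zero_of_sum_mul_eq_zero (y := fun j k => pairC (θ j) (θ k))
    (fun j k l => pairC_mul_left _ _ _) (fun j k l => pairC_mul_right _ _ _)
    (fun j k => pairC_mul_swap _ _) ?_ ?_
  · intro h0
    apply prod_xi_ne_zero hs
    have h1 : xiC (θ 0) * xiC (θ 1) * xiC (θ 2) = 0 := by
      rw [xiC_eq, xiC_eq, xiC_eq, smul_mul_smul_comm, smul_mul_smul_comm, mul_assoc (pairC _ _), h0,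
        smul_zero]
    exact congrArg Subtype.val h1
  · have h1 : (∑ j, xiC (θ j)) * (∑ j, ∑ k, d j k • pairC (θ j) (θ k)) = 0 := by
      apply Subtype.ext
      rw [Subalgebra.coe_mul, AddSubmonoidClass.coe_finsetSum, AddSubmonoidClass.coe_finsetSum]
      simp only [AddSubmonoidClass.coe_finsetSum]
      exact h
    simp only [xiC_eq, ← Finset.smul_sum, smul_mul_assoc] at h1
    exact (smul_eq_zero.1 h1).resolve_left I_ne_zero

end Threefold

end PSS
end

/-! ### From a unitary coframe to `ρ`, `⋆ρ` and its eigenvalues -/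

noncomputable section
namespace PSS

open Complex

theorem Sh.conj_sum {V ι : Type*} (s : Finset ι) (F : ι → Sh V) :
    (∑ i ∈ s, F i).conj = ∑ i ∈ s, (F i).conj := by
  ext l
  rw [Sh.conj_apply, Sh.sum_apply, Sh.sum_apply, map_sum]
  rfl

section Split

variable {E : Type*} [NormedAddCommGroup E] [NormedSpace ℝ E] {H : Type*} [TopologicalSpace H]
  {I : ModelWithCorners ℝ E H} {M : Type*} [TopologicalSpace M] [ChartedSpace H M]
  {J : EndField I M} {n m : ℕ}

/-- The `1`-forms of a coframe as fields of elements of the shuffle algebra. -/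
def frameSh (θ : Fin n → ∀ x : M, TangentSpace I x →L[ℝ] ℂ) (j : Fin n) : ShForm I M := fun x =>
  sh1 (θ j x)

/-- The forms `i θⱼ ∧ conj θⱼ` as fields of elements of the shuffle algebra. -/
def xiSh (θ : Fin n → ∀ x : M, TangentSpace I x →L[ℝ] ℂ) (j : Fin n) : ShForm I M := fun x =>
  xi (θ j x)

/-- The products of the `i θₗ ∧ conj θₗ` with `l ≠ j`. -/
def coprodSh (θ : Fin (n + 1) → ∀ x : M, TangentSpace I x →L[ℝ] ℂ) (j : Fin (n + 1)) :
    ShForm I M := fun x => coprod (fun j => θ j x) j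

theorem xiSh_eq (θ : Fin n → ∀ x : M, TangentSpace I x →L[ℝ] ℂ) (j : Fin n) :
    xiSh θ j = Complex.I • (frameSh θ j * conjSh (frameSh θ j)) := rfl

/-- A smooth coframe of forms of type `(1,0)`. -/
structure IsCoframe (J : EndField I M) (θ : Fin n → ∀ x : M, TangentSpace I x →L[ℝ] ℂ) :
    Prop where
  map_J : ∀ x j v, θ j x (J x v) = Complex.I * θ j x v
  inj : ∀ x v, (∀ j, θ j x v = 0) → v = 0
  surj : ∀ x, ∀ w : Fin n → ℂ, ∃ v, ∀ j, θ j x v = w j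
  smooth : ∀ j, ∃ c, HasD 1 (frameSh θ j) c

theorem ofForm_sum_apply {ω : DForm I M 2} {θ : Fin n → ∀ x : M, TangentSpace I x →L[ℝ] ℂ}
    {r : Fin n → ℂ} (h : ofForm ω = ∑ j, r j • xiSh θ j) (x : M) :
    toSh (ω x) = ∑ j, r j • xi (θ j x) := by
  refine (congrFun h x).trans ?_
  rw [Finset.sum_apply]
  rfl

theorem ofForm_metric_apply {ω : DForm I M 2} {θ : Fin n → ∀ x : M, TangentSpace I x →L[ℝ] ℂ}
    (h : ofForm ω = ∑ j, xiSh θ j) (x : M) : toSh (ω x) = ∑ j, xi (θ j x) := by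
  refine (congrFun h x).trans ?_
  rw [Finset.sum_apply]
  rfl

variable [I.Boundaryless] [IsManifold I 1 M]

theorem HasD.xiSh {θ : Fin n → ∀ x : M, TangentSpace I x →L[ℝ] ℂ} {j : Fin n} {c : ShForm I M}
    (h : HasD 1 (frameSh θ j) c) : HasD 2 (xiSh θ j)
      (Complex.I • (c * conjSh (frameSh θ j) - frameSh θ j * conjSh c)) := by
  have := (h.mul h.conj).smul Complex.I
  rwa [pow_one, neg_one_smul, ← sub_eq_add_neg] at this

/-- The value of the derivative is irrelevant here: the point is that the product is realised by a
smooth form, from which `IsCoframe.exists_star` obtains `⋆ρ`. -/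
theorem exists_hasD_list_prod (l : List (ShForm I M)) (h : ∀ a ∈ l, ∃ b, HasD 2 a b) (ne : l ≠ []) :
    ∃ b, HasD (2 * l.length) l.prod b := by
  induction l with
  | nil => exact absurd rfl ne
  | cons a l ih =>
    obtain ⟨b, hb⟩ := h a List.mem_cons_self
    by_cases hl : l = []
    · subst hl
      exact ⟨b, by simpa using hb⟩
    · obtain ⟨c, hc⟩ := ih (fun a ha => h a (List.mem_cons_of_mem _ ha)) hl
      have h1 := hb.mul hc
      rw [add_comm 2] at h1
      exact ⟨_, by rw [List.prod_cons]; exact h1⟩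

theorem IsCoframe.isHermitianMetric {θ : Fin n → ∀ x : M, TangentSpace I x →L[ℝ] ℂ}
    (hc : IsCoframe J θ) {ω : DForm I M 2} (hω : ofForm ω = ∑ j, PSS.xiSh θ j) :
    IsHermitianMetric J ω := by
  choose c hcd using hc.smooth
  refine ⟨(HasD.sum fun j _ => (hcd j).xiSh).isSmooth hω, fun x => ?_⟩
  have hx := ofForm_metric_apply hω x
  refine ⟨?_, ?_, fun v hv => ?_⟩
  · rw [isOfType_iff rfl, hx]
    exact ShType.sum fun j _ => shType_xi (hc.map_J x j)
  · apply toSh_injective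
    rw [toSh_conj, hx]
    rw [Sh.conj_sum]
    exact Finset.sum_congr rfl fun j _ => conj_xi _
  · rw [← toSh_pair, hx, sum_xi_apply_J (hc.map_J x)]
    have h1 : ∀ j, θ j x v * starRingEnd ℂ (θ j x v) + θ j x v * starRingEnd ℂ (θ j x v) =
        ((2 * normSq (θ j x v) : ℝ) : ℂ) := by
      intro j
      rw [Complex.mul_conj]
      push_cast
      ring
    rw [Finset.sum_congr rfl fun j _ => h1 j, ← Complex.ofReal_sum, Complex.ofReal_re]
    have h2 : ∃ j, θ j x v ≠ 0 := by
      by_contra! h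
      exact hv (hc.inj x v h)
    obtain ⟨j, hj⟩ := h2
    refine Finset.sum_pos' (fun j _ => mul_nonneg two_pos.le (normSq_nonneg _)) ⟨j, Finset.mem_univ j, ?_⟩
    have := normSq_pos.2 hj
    positivity

variable {θ : Fin (m + 2) → ∀ x : M, TangentSpace I x →L[ℝ] ℂ} {ω : DForm I M 2}

omit [I.Boundaryless] [IsManifold I 1 M] in
theorem ofForm_metricPow (k : ℕ) (ω : DForm I M 2) :
    ofForm (metricPow ω k) = ((k.factorial : ℂ)⁻¹) • ofForm ω ^ k := funext fun x =>
  toSh_divPow (ω x) k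

theorem IsCoframe.exists_hasD_coprodSh (hc : IsCoframe J θ) (j : Fin (m + 2)) :
    ∃ b, HasD (2 * (m + 1)) (coprodSh θ j) b := by
  have h : coprodSh θ j = (List.ofFn fun l : Fin (m + 1) => PSS.xiSh θ (j.succAbove l)).prod := by
    funext x
    rw [Pi.list_prod_apply, List.map_ofFn]
    rfl
  have h2 := exists_hasD_list_prod (List.ofFn fun l : Fin (m + 1) => PSS.xiSh θ (j.succAbove l))
    (fun a ha => by
      obtain ⟨l, rfl⟩ := List.mem_ofFn.1 ha
      obtain ⟨c, hcd⟩ := hc.smooth (j.succAbove l)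
      exact ⟨_, hcd.xiSh⟩) (by simp)
  rwa [List.length_ofFn, ← h] at h2

/-- The star of `ξ_j` is the product of the other `ξ_l`, so the coframe `θ` itself witnesses both
the star relation and the eigenvalues. -/
theorem IsCoframe.exists_star (hc : IsCoframe J θ) (hω : ofForm ω = ∑ j, PSS.xiSh θ j)
    (r : Fin (m + 2) → ℝ) : ∃ (ρ : DForm I M 2) (σ : DForm I M (2 * (m + 1))),
      ofForm ρ = ∑ j, (r j : ℂ) • PSS.xiSh θ j ∧
      ofForm σ = ∑ j, (r j : ℂ) • coprodSh θ j ∧ IsSmooth ρ ∧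
      (∀ x, IsHodgeStar (J x) (ω x) (m + 2) (by omega) (ρ x) (σ x)) ∧
      (∀ x, HasEigenvalues (J x) (ω x) (σ x) r) := by
  choose c hcd using hc.smooth
  choose p hp using hc.exists_hasD_coprodSh
  obtain ⟨ρ, hρs, hρ, -⟩ := HasD.sum (s := Finset.univ) fun j _ => (hcd j).xiSh.smul (r j : ℂ)
  obtain ⟨σ, -, hσ, -⟩ := HasD.sum (s := Finset.univ) fun j _ => (hp j).smul (r j : ℂ)
  have hσx : ∀ x, toSh (σ x) = ∑ j, (r j : ℂ) • coprod (fun j => θ j x) j := by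
    intro x
    refine (congrFun hσ x).trans ?_
    rw [Finset.sum_apply]
    rfl
  refine ⟨ρ, σ, hρ, hσ, hρs, fun x => ?_, fun x => ?_⟩
  · refine isHodgeStar_of_coframe (hc.map_J x) (hc.inj x) (hc.surj x) (ofForm_metric_apply hω x)
      _ (ofForm_sum_apply hρ x) (hσx x) ?_ ?_ ?_
    · exact fun j l h => mul_coprod_eq_zero (fun j => θ j x) h (sh1_mul_xi _)
    · exact fun j l h => mul_coprod_eq_zero (fun j => θ j x) h (sh1_conj_mul_xi _)
    · exact fun j => xi_mul_coprod (ofForm_metric_apply hω x) j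
  · refine ⟨fun j => θ j x, hc.map_J x, hc.inj x, ?_, ?_⟩
    · apply toSh_injective
      rw [ofForm_metric_apply hω x, toSh_sum]
      exact Finset.sum_congr rfl fun j _ => (toSh_xi _).symm
    · apply toSh_injective
      rw [hσx, toSh_sum]
      refine Finset.sum_congr rfl fun j _ => ?_
      rw [toSh_smul, toSh_wedgeProd]
      simp only [toSh_xi]
      rfl

/-- The hypothesis on `g` says that `d∂̄α` has no component of bidegree `(p, q + 2)`. Then `∂∂̄α` is
the exterior derivative of `∂̄α`, and only `d` has to be computed. -/
theorem ofForm_del_delbar {k p q : ℕ} (hk : k = p + q) {α : DForm I M k}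
    (tα : ∀ x, ShType (J x) p q (toSh (α x))) {b₁ b₂ g : ShForm I M}
    (h₁ : HasD k (ofForm α) (b₁ + b₂)) (t₁ : ∀ x, ShType (J x) (p + 1) q (b₁ x))
    (t₂ : ∀ x, ShType (J x) p (q + 1) (b₂ x)) (h₂ : HasD (k + 1) b₂ g)
    (t : ∀ x, ShType (J x) (p + 1) (q + 1) (g x)) : ofForm (del J (delbar J α)) = g := by
  have hd := h₁.extD rfl
  obtain ⟨β, -, rfl, rfl⟩ := h₂
  have e1 : delbar J α = β := by
    refine (del_delbar_of_type hk (β := extD α - β) tα (fun x => ?_) t₂ (by abel)).2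
    have h := congrFun hd x
    change toSh (extD α x - β x) |> ShType _ _ _
    rw [toSh_sub]
    have h' : toSh (extD α x) = b₁ x + toSh (β x) := h
    rw [h', add_sub_cancel_right]
    exact t₁ x
  rw [e1, (del_delbar_of_type (p := p) (q := q + 1) (by omega) (γ := 0) t₂ t (fun x => ?_)
    (by simp)).1]
  change ShType _ _ _ (toSh 0)
  rw [toSh_zero]
  exact ShType.zero

/-- Guessing `r` with `i∂∂̄ω_m = ω_m ∧ ∑ r_j ξ_j` is enough: it gives `ρ` directly, and wedging once
more with `ω` gives the function by `toSh_mul_divPow_mul`. -/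
theorem IsCoframe.isRho (hc : IsCoframe J θ) (hω : ofForm ω = ∑ j, PSS.xiSh θ j)
    {r : Fin (m + 2) → ℝ} {b₁ b₂ g : ShForm I M}
    (h₁ : HasD (2 * m) (ofForm (metricPow ω m)) (b₁ + b₂))
    (t₁ : ∀ x, ShType (J x) (m + 1) m (b₁ x)) (t₂ : ∀ x, ShType (J x) m (m + 1) (b₂ x))
    (h₂ : HasD (2 * m + 1) b₂ g) (t : ∀ x, ShType (J x) (m + 1) (m + 1) (g x))
    (hg : Complex.I • g = ofForm (metricPow ω m) * ∑ j, (r j : ℂ) • PSS.xiSh θ j)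
    {ρ : DForm I M 2} (hρ : ofForm ρ = ∑ j, (r j : ℂ) • PSS.xiSh θ j) :
    IsRho J m ω ρ ∧ IsAssociatedFunction J m ω fun _ => (m + 1) * ∑ j, r j := by
  choose c hcd using hc.smooth
  have e3 : ofForm (iDelDelbar J (metricPow ω m)) =
      ofForm (metricPow ω m) * ∑ j, (r j : ℂ) • PSS.xiSh θ j := by
    rw [iDelDelbar, ← hg]
    refine Eq.trans (funext fun x => toSh_smul _ _) (congrArg (Complex.I • ·)
      (ofForm_del_delbar (p := m) (q := m) (by omega) (fun x => ?_) h₁ t₁ t₂ h₂ t))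
    have h := (ShType.sum fun j (_ : j ∈ Finset.univ) =>
      shType_xi (hc.map_J x j)).pow m
    rw [← ofForm_metric_apply hω x, mul_one] at h
    have := h.smul ((m.factorial : ℂ)⁻¹)
    rwa [← toSh_divPow] at this
  have e4 : ∀ x, toSh (iDelDelbar J (metricPow ω m) x) =
      toSh (metricPow ω m x) * ∑ j, (r j : ℂ) • xi (θ j x) := by
    intro x
    refine (congrFun e3 x).trans ?_
    rw [Pi.mul_apply, Finset.sum_apply]
    rfl
  refine ⟨⟨(HasD.sum fun j _ => (hcd j).xiSh.smul (r j : ℂ)).isSmooth hρ, fun x => ?_,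
    fun x => ?_⟩, fun x v => ?_⟩
  · rw [isOfType_iff rfl, ofForm_sum_apply hρ x]
    exact ShType.sum fun j _ => (shType_xi (hc.map_J x j)).smul _
  · apply toSh_injective
    rw [e4, toSh_wedge, ofForm_sum_apply hρ x]
  · have h1 := toSh_mul_divPow_mul (ofForm_metric_apply hω x) fun j => (r j : ℂ)
    rw [toSh_apply_cast, toSh_wedge, e4]
    refine (congrFun h1 _).trans ?_
    rw [Sh.smul_apply, toSh_ofFn]
    push_cast
    rfl

theorem isPluriclosedStarSplit_of_hasD {σ : DForm I M (2 * (m + 1))} (h : IsStarRho J m ω σ)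
    (t : ∀ x, ShType (J x) (m + 1) (m + 1) (toSh (σ x))) {s₁ s₂ : ShForm I M}
    (h₁ : HasD (2 * (m + 1)) (ofForm σ) (s₁ + s₂))
    (t₁ : ∀ x, ShType (J x) (m + 2) (m + 1) (s₁ x)) (t₂ : ∀ x, ShType (J x) (m + 1) (m + 2) (s₂ x))
    (h₂ : HasD (2 * (m + 1) + 1) s₂ 0) : IsPluriclosedStarSplit J m ω := by
  refine ⟨σ, h, ofForm_injective ?_⟩
  rw [ofForm_del_delbar (p := m + 1) (q := m + 1) (by omega) t h₁ t₁ t₂ h₂ fun x => ShType.zero]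
  exact (funext fun x => toSh_zero).symm

theorem IsCoframe.shType_coprod (hc : IsCoframe J θ) {σ : DForm I M (2 * (m + 1))}
    {r : Fin (m + 2) → ℝ} (hσ : ofForm σ = ∑ j, (r j : ℂ) • coprodSh θ j) (x : M) :
    ShType (J x) (m + 1) (m + 1) (toSh (σ x)) := by
  have hσx : toSh (σ x) = ∑ j, (r j : ℂ) • coprod (fun j => θ j x) j := by
    refine (congrFun hσ x).trans ?_
    rw [Finset.sum_apply]
    rfl
  rw [hσx]
  refine ShType.sum fun j _ => ShType.smul ?_ _
  have h : ∀ k (f : Fin k → TangentSpace I x →L[ℝ] ℂ), (∀ l v, f l (J x v) = Complex.I * f l v) →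
      ShType (J x) k k (List.ofFn fun l => xi (f l)).prod := by
    intro k
    induction k with
    | zero => exact fun f hf => by simpa using ShType.one
    | succ k ih =>
      intro f hf
      have h := (shType_xi (hf 0)).mul (ih _ fun l => hf l.succ)
      rw [List.ofFn_succ, List.prod_cons]
      rwa [add_comm 1 k] at h
  exact h _ _ fun l => hc.map_J x _

end Split

end PSS
end

/-! ### Coframes with differentials of type `(2,0)`; the two threefolds -/

noncomputable section
namespace PSS

open Complex

/-- The relations of an exterior algebra with generators `e j` and `f j`. -/
structure Anticomm {R : Type*} [Ring R] {n : ℕ} (e f : Fin n → R) : Prop where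
  ee : ∀ i j, e i * e j = -(e j * e i)
  ff : ∀ i j, f i * f j = -(f j * f i)
  fe : ∀ i j, f i * e j = -(e j * f i)
  e_sq : ∀ i, e i * e i = 0
  f_sq : ∀ i, f i * f i = 0

namespace Anticomm

variable {R : Type*} [Ring R] {n : ℕ} {e f : Fin n → R} (A : Anticomm e f)
include A

/-- The condition on the indices orients anticommutativity, so that `simp` can use it without
looping. With its companions it sorts monomials: all `e` before all `f`, indices increasing, zero on
repetition. -/
theorem ee_lt (i j : Fin n) (_ : j < i) : e i * e j = -(e j * e i) := A.ee i j

theorem ff_lt (i j : Fin n) (_ : j < i) : f i * f j = -(f j * f i) := A.ff i j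

theorem ee_mul (i j : Fin n) (_ : j < i) (z : R) : e i * (e j * z) = -(e j * (e i * z)) := by
  rw [← mul_assoc, A.ee, neg_mul, mul_assoc]

theorem ff_mul (i j : Fin n) (_ : j < i) (z : R) : f i * (f j * z) = -(f j * (f i * z)) := by
  rw [← mul_assoc, A.ff, neg_mul, mul_assoc]

theorem fe_mul (i j : Fin n) (z : R) : f i * (e j * z) = -(e j * (f i * z)) := by
  rw [← mul_assoc, A.fe, neg_mul, mul_assoc]

theorem e_sq_mul (i : Fin n) (z : R) : e i * (e i * z) = 0 := by
  rw [← mul_assoc, A.e_sq, zero_mul]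

theorem f_sq_mul (i : Fin n) (z : R) : f i * (f i * z) = 0 := by
  rw [← mul_assoc, A.f_sq, zero_mul]

end Anticomm

section Invariant

variable {E : Type*} [NormedAddCommGroup E] [NormedSpace ℝ E] {H : Type*} [TopologicalSpace H]
  {I : ModelWithCorners ℝ E H} {M : Type*} [TopologicalSpace M] [ChartedSpace H M]
  {J : EndField I M} {n m : ℕ}

/-- The properties of a balanced metric that is closed star split with constant eigenvalues. -/
structure IsSplitMetric (J : EndField I M) (m : ℕ) (ω : DForm I M 2) (r : Fin (m + 2) → ℝ) :
    Prop where
  hermitian : IsHermitianMetric J ω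
  balanced : IsBalanced m ω
  closed : IsClosedStarSplit J m ω
  pluriclosed : IsPluriclosedStarSplit J m ω
  function : IsAssociatedFunction J m ω fun _ => (m + 1) * ∑ j, r j
  eigenvalues : StarRhoHasEigenvalues J m ω r

theorem anticomm_frameSh (θ : Fin n → ∀ x : M, TangentSpace I x →L[ℝ] ℂ) :
    Anticomm (frameSh θ) fun j => conjSh (frameSh θ j) where
  ee _ _ := funext fun _ => sh1_anticomm _ _
  ff _ _ := funext fun _ => Sh.anticomm_of_odd (sh1_conj_odd _) (sh1_conj_odd _)
  fe _ _ := funext fun _ => sh1_conj_anticomm _ _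
  e_sq _ := funext fun _ => sh1_mul_self _
  f_sq _ := funext fun _ => sh1_conj_mul_self _

theorem sum_xiSh_mul_comm (θ : Fin n → ∀ x : M, TangentSpace I x →L[ℝ] ℂ) (a : ShForm I M) :
    (∑ j, xiSh θ j) * a = a * ∑ j, xiSh θ j := by
  rw [Finset.sum_mul, Finset.mul_sum]
  exact Finset.sum_congr rfl fun j _ => funext fun x => xi_comm _ _

theorem conjSh_zero : conjSh (0 : ShForm I M) = 0 := funext fun _ => Sh.conj_zero

theorem conjSh_neg (a : ShForm I M) : conjSh (-a) = -conjSh a := funext fun _ => Sh.conj_neg _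

theorem conjSh_mul (a b : ShForm I M) : conjSh (a * b) = conjSh a * conjSh b :=
  funext fun _ => Sh.conj_mul _ _

/-- The `∂`-part of the derivative of `∑ⱼ i θⱼ ∧ conj θⱼ` for a coframe with `dθⱼ = cⱼ` of type
`(2,0)`. -/
def delPart (θ : Fin n → ∀ x : M, TangentSpace I x →L[ℝ] ℂ) (c : Fin n → ShForm I M) :
    ShForm I M := Complex.I • ∑ j, c j * conjSh (frameSh θ j)

/-- The `∂̄`-part of the derivative of `∑ⱼ i θⱼ ∧ conj θⱼ` for a coframe with `dθⱼ = cⱼ` of type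
`(2,0)`. -/
def delbarPart (θ : Fin n → ∀ x : M, TangentSpace I x →L[ℝ] ℂ) (c : Fin n → ShForm I M) :
    ShForm I M := -(Complex.I • ∑ j, frameSh θ j * conjSh (c j))

section

variable {θ : Fin n → ∀ x : M, TangentSpace I x →L[ℝ] ℂ} {c : Fin n → ShForm I M}

theorem IsCoframe.shType_delPart (hc : IsCoframe J θ) (tc : ∀ j x, ShType (J x) 2 0 (c j x))
    (x : M) : ShType (J x) 2 1 (delPart θ c x) := by
  rw [delPart, Pi.smul_apply, Finset.sum_apply]
  exact ShType.smul (ShType.sum fun j _ => (tc j x).mul (shType_oneForm (hc.map_J x j)).conj) _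

theorem IsCoframe.shType_delbarPart (hc : IsCoframe J θ) (tc : ∀ j x, ShType (J x) 2 0 (c j x))
    (x : M) : ShType (J x) 1 2 (delbarPart θ c x) := by
  rw [delbarPart, Pi.neg_apply, Pi.smul_apply, Finset.sum_apply]
  exact ShType.neg (ShType.smul
    (ShType.sum fun j _ => (shType_oneForm (hc.map_J x j)).mul (tc j x).conj) _)

theorem IsCoframe.shType_frameSh_mul (hc : IsCoframe J θ) (i j : Fin n) (x : M) :
    ShType (J x) 2 0 ((frameSh θ i * frameSh θ j) x) :=
  (shType_oneForm (hc.map_J x i)).mul (shType_oneForm (hc.map_J x j))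

end

variable [I.Boundaryless] [IsManifold I 1 M]

/-- Collects what must be checked in each balanced example. The pluriclosed condition costs nothing:
when `d⋆ρ = 0`, both of its components may be taken to be zero. -/
theorem IsCoframe.isSplitMetric {θ : Fin (m + 2) → ∀ x : M, TangentSpace I x →L[ℝ] ℂ}
    (hc : IsCoframe J θ) {ω : DForm I M 2} (hω : ofForm ω = ∑ j, xiSh θ j)
    {r : Fin (m + 2) → ℝ} {b₁ b₂ g : ShForm I M}
    (h₁ : HasD (2 * m) (ofForm (metricPow ω m)) (b₁ + b₂))
    (t₁ : ∀ x, ShType (J x) (m + 1) m (b₁ x)) (t₂ : ∀ x, ShType (J x) m (m + 1) (b₂ x))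
    (h₂ : HasD (2 * m + 1) b₂ g) (t : ∀ x, ShType (J x) (m + 1) (m + 1) (g x))
    (hg : Complex.I • g = ofForm (metricPow ω m) * ∑ j, (r j : ℂ) • xiSh θ j)
    (hbal : HasD (2 * (m + 1)) (ofForm (metricPow ω (m + 1))) 0)
    (hcl : HasD (2 * (m + 1)) (∑ j, (r j : ℂ) • coprodSh θ j) 0) : IsSplitMetric J m ω r := by
  obtain ⟨ρ, σ, hρ, hσ, -, hstar, heig⟩ := hc.exists_star hω r
  obtain ⟨hrho, hf⟩ := hc.isRho hω h₁ t₁ t₂ h₂ t hg hρ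
  have h0 : ∀ k, ofForm (0 : DForm I M k) = 0 := fun k => funext fun x => toSh_zero
  have hs : IsStarRho J m ω σ := ⟨ρ, hrho, hstar⟩
  refine ⟨hc.isHermitianMetric hω, ?_, ⟨σ, hs, ?_⟩, ?_, hf, σ, hs, heig⟩
  · exact ofForm_injective ((hbal.extD rfl).trans (h0 _).symm)
  · exact ofForm_injective ((hcl.extD hσ).trans (h0 _).symm)
  · refine isPluriclosedStarSplit_of_hasD hs (hc.shType_coprod hσ) (s₁ := 0) (s₂ := 0) ?_
      (fun x => ShType.zero) (fun x => ShType.zero) HasD.zero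
    rw [hσ, add_zero]
    exact hcl

variable {θ : Fin n → ∀ x : M, TangentSpace I x →L[ℝ] ℂ} {c : Fin n → ShForm I M}

theorem hasD_sum_xiSh (hd : ∀ j, HasD 1 (frameSh θ j) (c j)) :
    HasD 2 (∑ j, xiSh θ j) (delPart θ c + delbarPart θ c) := by
  have h := HasD.sum (s := Finset.univ) fun j _ => (hd j).xiSh
  rwa [← Finset.smul_sum, Finset.sum_sub_distrib, smul_sub, sub_eq_add_neg] at h

/-- Since `c_j` is closed, so is its conjugate, and only the derivative of `θ_j` in `θ_j ∧ conj c_j`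
contributes. The result has pure type `(2,2)` when the `c_j` have type `(2,0)`. -/
theorem hasD_delbarPart (hd : ∀ j, HasD 1 (frameSh θ j) (c j)) (hcc : ∀ j, HasD 2 (c j) 0) :
    HasD 3 (delbarPart θ c) (-(Complex.I • ∑ j, c j * conjSh (c j))) := by
  have h := ((HasD.sum (s := Finset.univ) fun j _ => (hd j).mul (hcc j).conj).smul Complex.I).neg
  simp only [conjSh_zero, mul_zero, smul_zero, add_zero] at h
  exact h

end Invariant

section Threefold

variable {E : Type*} [NormedAddCommGroup E] [NormedSpace ℝ E] {H : Type*} [TopologicalSpace H]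
  {I : ModelWithCorners ℝ E H} {M : Type*} [TopologicalSpace M] [ChartedSpace H M]
  {J : EndField I M} {θ : Fin 3 → ∀ x : M, TangentSpace I x →L[ℝ] ℂ} {c : Fin 3 → ShForm I M}

theorem coprodSh_three (θ : Fin 3 → ∀ x : M, TangentSpace I x →L[ℝ] ℂ) :
    coprodSh θ 0 = xiSh θ 1 * xiSh θ 2 ∧ coprodSh θ 1 = xiSh θ 0 * xiSh θ 2 ∧
      coprodSh θ 2 = xiSh θ 0 * xiSh θ 1 := by
  refine ⟨?_, ?_, ?_⟩ <;>
  · funext x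
    simp [coprodSh, coprod, xiSh, List.ofFn_succ, Fin.succAbove, Pi.mul_apply]

variable [I.Boundaryless] [IsManifold I 1 M]

/-- In dimension three `ω_{n-2}` is `ω` itself, so `i∂∂̄ω = ∑ c_j ∧ conj c_j` has to be divided by
`ω`, and balancedness amounts to `ω ∧ dω = 0`. -/
theorem IsCoframe.isSplitMetric_three (hc : IsCoframe J θ) {ω : DForm I M 2}
    (hω : ofForm ω = ∑ j, xiSh θ j) (hd : ∀ j, HasD 1 (frameSh θ j) (c j))
    (hcc : ∀ j, HasD 2 (c j) 0) (tc : ∀ j x, ShType (J x) 2 0 (c j x)) {r : Fin 3 → ℝ}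
    (hbal : (∑ j, xiSh θ j) * (delPart θ c + delbarPart θ c) = 0)
    (hg : ∑ j, c j * conjSh (c j) = (∑ j, xiSh θ j) * ∑ j, (r j : ℂ) • xiSh θ j)
    (hcl : HasD 4 (∑ j, (r j : ℂ) • coprodSh θ j) 0) : IsSplitMetric J 1 ω r := by
  have h1 : ofForm (metricPow ω 1) = ∑ j, xiSh θ j := by
    rw [ofForm_metricPow, hω]
    simp
  refine hc.isSplitMetric hω (b₁ := delPart θ c) (b₂ := delbarPart θ c)
    (g := -(Complex.I • ∑ j, c j * conjSh (c j))) ?_ (hc.shType_delPart tc)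
    (hc.shType_delbarPart tc) (hasD_delbarPart hd hcc) ?_ ?_ ?_ hcl
  · rw [h1]
    exact hasD_sum_xiSh hd
  · intro x
    rw [Pi.neg_apply, Pi.smul_apply, Finset.sum_apply]
    exact ShType.neg (ShType.smul (ShType.sum fun j _ => (tc j x).mul (tc j x).conj) _)
  · rw [smul_neg, smul_smul, Complex.I_mul_I, neg_one_smul, neg_neg, hg, h1]
  · rw [ofForm_metricPow, hω, pow_two]
    have h2 := ((hasD_sum_xiSh hd).mul (hasD_sum_xiSh hd)).smul ((Nat.factorial 2 : ℂ)⁻¹)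
    rw [neg_one_sq, one_smul, hbal, ← sum_xiSh_mul_comm θ (delPart θ c + delbarPart θ c), hbal,
      add_zero, smul_zero] at h2
    exact h2

/-- Here `∑ c_j ∧ conj c_j = ξ_0 ξ_1`, so `r_0 + r_1 = 1` and `r_0 + r_2 = r_1 + r_2 = 0`. The
monomials of `dω = dξ_2` involve all three indices, so each `ξ_j` kills them; this gives
balancedness and the closedness of `⋆ρ`. -/
theorem IsCoframe.isSplitMetric_heisenberg (hc : IsCoframe J θ) {ω : DForm I M 2}
    (hω : ofForm ω = ∑ j, xiSh θ j) (h0 : HasD 1 (frameSh θ 0) 0) (h1 : HasD 1 (frameSh θ 1) 0)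
    (h2 : HasD 1 (frameSh θ 2) (-(frameSh θ 0 * frameSh θ 1))) :
    IsSplitMetric J 1 ω ![1 / 2, 1 / 2, -1 / 2] := by
  have A := anticomm_frameSh θ
  have hd : ∀ j, HasD 1 (frameSh θ j) (![0, 0, -(frameSh θ 0 * frameSh θ 1)] j) := by
    intro j
    fin_cases j
    exacts [h0, h1, h2]
  have hcc : HasD 2 (frameSh θ 0 * frameSh θ 1) 0 := by simpa using h0.mul h1
  refine hc.isSplitMetric_three hω hd ?_ ?_ ?_ ?_ ?_
  · intro j
    fin_cases j
    exacts [HasD.zero, HasD.zero, by simpa using hcc.neg]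
  · intro j x
    fin_cases j
    exacts [ShType.zero, ShType.zero, (hc.shType_frameSh_mul 0 1 x).neg]
  · simp [Fin.sum_univ_three, delPart, delbarPart, conjSh_zero, conjSh_neg, conjSh_mul, xiSh_eq,
      mul_add, add_mul, mul_assoc, A.fe, A.fe_mul, A.ee_lt, A.ee_mul, A.ff_lt, A.ff_mul, A.e_sq,
      A.e_sq_mul, A.f_sq, A.f_sq_mul]
  · simp [Fin.sum_univ_three, conjSh_zero, conjSh_neg, conjSh_mul, xiSh_eq, mul_add, add_mul,
      mul_assoc, A.fe, A.fe_mul, A.ee_lt, A.ee_mul, A.ff_lt, A.ff_mul, A.e_sq, A.e_sq_mul, A.f_sq,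
      A.f_sq_mul, smul_smul]
    module
  · obtain ⟨p0, p1, p2⟩ := coprodSh_three θ
    rw [Fin.sum_univ_three, p0, p1, p2]
    have h := ((((h1.xiSh.mul h2.xiSh).smul ((1 / 2 : ℝ) : ℂ)).add
      ((h0.xiSh.mul h2.xiSh).smul ((1 / 2 : ℝ) : ℂ))).add
      ((h0.xiSh.mul h1.xiSh).smul ((-1 / 2 : ℝ) : ℂ)))
    convert h using 1
    · simp
    simp [conjSh_zero, conjSh_neg, conjSh_mul, xiSh_eq, mul_add, add_mul, mul_sub, sub_mul,
      mul_assoc, A.fe, A.fe_mul, A.ee_lt, A.ee_mul, A.ff_lt, A.ff_mul, A.e_sq, A.e_sq_mul, A.f_sq,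
      A.f_sq_mul, smul_smul]

/-- Here `∑ c_j ∧ conj c_j = ξ_0 ξ_1 + ξ_0 ξ_2`, so `r_0 + r_1 = r_0 + r_2 = 1` and `r_1 + r_2 = 0`.
With `τ = θ_0 + conj θ_0`, one has `dξ_1 = τ ∧ ξ_1` and `dξ_2 = -τ ∧ ξ_2`; the opposite signs give
balancedness. -/
theorem IsCoframe.isSplitMetric_nakamura (hc : IsCoframe J θ) {ω : DForm I M 2}
    (hω : ofForm ω = ∑ j, xiSh θ j) (h0 : HasD 1 (frameSh θ 0) 0)
    (h1 : HasD 1 (frameSh θ 1) (frameSh θ 0 * frameSh θ 1))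
    (h2 : HasD 1 (frameSh θ 2) (-(frameSh θ 0 * frameSh θ 2))) :
    IsSplitMetric J 1 ω ![1, 0, 0] := by
  have A := anticomm_frameSh θ
  have hd : ∀ j, HasD 1 (frameSh θ j) (![0, frameSh θ 0 * frameSh θ 1,
      -(frameSh θ 0 * frameSh θ 2)] j) := by
    intro j
    fin_cases j
    exacts [h0, h1, h2]
  have hc1 : HasD 2 (frameSh θ 0 * frameSh θ 1) 0 := by
    simpa [A.e_sq_mul] using h0.mul h1
  have hc2 : HasD 2 (frameSh θ 0 * frameSh θ 2) 0 := by
    simpa [A.e_sq_mul] using h0.mul h2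
  refine hc.isSplitMetric_three hω hd ?_ ?_ ?_ ?_ ?_
  · intro j
    fin_cases j
    exacts [HasD.zero, hc1, by simpa using hc2.neg]
  · intro j x
    fin_cases j
    exacts [ShType.zero, hc.shType_frameSh_mul 0 1 x, (hc.shType_frameSh_mul 0 2 x).neg]
  · simp [Fin.sum_univ_three, delPart, delbarPart, conjSh_zero, conjSh_neg, conjSh_mul, xiSh_eq,
      mul_add, add_mul, mul_assoc, A.fe, A.fe_mul, A.ee_lt, A.ee_mul, A.ff_lt, A.ff_mul, A.e_sq,
      A.e_sq_mul, A.f_sq, A.f_sq_mul]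
  · simp [Fin.sum_univ_three, conjSh_zero, conjSh_neg, conjSh_mul, xiSh_eq, mul_add, add_mul,
      mul_assoc, A.fe, A.fe_mul, A.ee_lt, A.ee_mul, A.ff_lt, A.ff_mul, A.e_sq, A.e_sq_mul, A.f_sq,
      A.f_sq_mul, smul_smul]
  · obtain ⟨p0, p1, p2⟩ := coprodSh_three θ
    rw [Fin.sum_univ_three, p0, p1, p2]
    -- With these eigenvalues `⋆ρ` is `ξ_1 ∧ ξ_2`, whose two derivative terms cancel.
    have h := (h1.xiSh.mul h2.xiSh).smul ((1 : ℝ) : ℂ)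
    convert h using 1
    · simp
    simp [conjSh_zero, conjSh_neg, conjSh_mul, xiSh_eq, mul_add, add_mul, mul_sub, sub_mul,
      mul_assoc, A.fe, A.fe_mul, A.ee_lt, A.ee_mul, A.ff_lt, A.ff_mul, A.e_sq, A.e_sq_mul, A.f_sq,
      A.f_sq_mul, smul_smul]

end Threefold

end PSS
end

/-! ### The five-dimensional Iwasawa coframe -/

noncomputable section
namespace PSS

open Complex

section Fivefold

/-- The equation `i∂∂̄ω_3 = ω_3 ∧ ρ` with `x j` in place of `ξ_j`. Multiplied by `24` it has integer
coefficients and is checked on squarefree monomials. -/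
theorem sum_mul_five {S : Type*} [CommRing S] [Algebra ℂ S] {x : Fin 5 → S}
    (hx : ∀ j, x j * x j = 0) :
    (1 / 2 : ℂ) • ((∑ j, x j) ^ 2 * (x 0 * x 1 + x 0 * x 2 + x 1 * x 2)) -
      (∑ j, x j) * (x 0 * x 1 * x 2 + x 0 * x 2 * x 3 + x 1 * x 2 * x 4) =
    (1 / 6 : ℂ) • (∑ j, x j) ^ 3 * ((3 / 4 : ℂ) • x 0 + (3 / 4 : ℂ) • x 1 - (1 / 4 : ℂ) • x 2 -
      (1 / 4 : ℂ) • x 3 - (1 / 4 : ℂ) • x 4) := by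
  have h2 : ∀ a x : S, x * x = 0 → (a + x) ^ 2 = a ^ 2 + 2 * a * x := fun a x h => by
    linear_combination h
  have h3 : ∀ a x : S, x * x = 0 → (a + x) ^ 3 = a ^ 3 + 3 * a ^ 2 * x := fun a x h => by
    linear_combination (3 * a + x) * h
  have e2 : (∑ j, x j) ^ 2 = 2 * (x 0 * x 1 + (x 0 + x 1) * x 2 + (x 0 + x 1 + x 2) * x 3 +
      (x 0 + x 1 + x 2 + x 3) * x 4) := by
    rw [Fin.sum_univ_five, h2 _ _ (hx 4), h2 _ _ (hx 3), h2 _ _ (hx 2), h2 _ _ (hx 1), pow_two, hx]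
    ring
  have e3 : (∑ j, x j) ^ 3 = 6 * (x 0 * x 1 * x 2 + (x 0 * x 1 + (x 0 + x 1) * x 2) * x 3 +
      (x 0 * x 1 + (x 0 + x 1) * x 2 + (x 0 + x 1 + x 2) * x 3) * x 4) := by
    rw [Fin.sum_univ_five, h3 _ _ (hx 4), h3 _ _ (hx 3), h3 _ _ (hx 2), h3 _ _ (hx 1), pow_succ,
      pow_two, hx, h2 _ _ (hx 3), h2 _ _ (hx 2), h2 _ _ (hx 1), pow_two, hx]
    ring
  have hx2 : ∀ j, x j ^ 2 = 0 := fun j => by rw [pow_two, hx]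
  have key : 12 * ((∑ j, x j) ^ 2 * (x 0 * x 1 + x 0 * x 2 + x 1 * x 2)) -
      24 * ((∑ j, x j) * (x 0 * x 1 * x 2 + x 0 * x 2 * x 3 + x 1 * x 2 * x 4)) =
      (∑ j, x j) ^ 3 * (3 * x 0 + 3 * x 1 - x 2 - x 3 - x 4) := by
    rw [e2, e3, Fin.sum_univ_five]
    ring_nf
    simp only [hx2, zero_mul, mul_zero, add_zero, zero_add, sub_zero]
  -- All scalars are expressed through the single element `1 / 24`, whose only relation needed is
  -- this one; the integral identity `key` then implies the claim.
  have h24 : (24 : S) * algebraMap ℂ S (1 / 24) = 1 := by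
    rw [← map_ofNat (algebraMap ℂ S), ← map_mul]
    norm_num
  have c2 : algebraMap ℂ S (1 / 2) = 12 * algebraMap ℂ S (1 / 24) := by
    rw [← map_ofNat (algebraMap ℂ S), ← map_mul]
    norm_num
  have c6 : algebraMap ℂ S (1 / 6) = 4 * algebraMap ℂ S (1 / 24) := by
    rw [← map_ofNat (algebraMap ℂ S), ← map_mul]
    norm_num
  have c4 : algebraMap ℂ S (1 / 4) = 6 * algebraMap ℂ S (1 / 24) := by
    rw [← map_ofNat (algebraMap ℂ S), ← map_mul]
    norm_num
  have c3 : algebraMap ℂ S (3 / 4) = 18 * algebraMap ℂ S (1 / 24) := by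
    rw [← map_ofNat (algebraMap ℂ S), ← map_mul]
    norm_num
  simp only [Algebra.smul_def, c2, c6, c4, c3]
  generalize algebraMap ℂ S (1 / 24) = t at *
  generalize (∑ j, x j) = y at *
  linear_combination t * key + (y * (x 0 * x 1 * x 2 + x 0 * x 2 * x 3 + x 1 * x 2 * x 4) -
    t * y ^ 3 * (3 * x 0 + 3 * x 1 - x 2 - x 3 - x 4)) * h24

variable {E : Type*} [NormedAddCommGroup E] [NormedSpace ℝ E] {H : Type*} [TopologicalSpace H]
  {I : ModelWithCorners ℝ E H} {M : Type*} [TopologicalSpace M] [ChartedSpace H M]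
  {J : EndField I M} {θ : Fin 5 → ∀ x : M, TangentSpace I x →L[ℝ] ℂ}

theorem coprodSh_five (θ : Fin 5 → ∀ x : M, TangentSpace I x →L[ℝ] ℂ) :
    coprodSh θ 0 = xiSh θ 1 * xiSh θ 2 * xiSh θ 3 * xiSh θ 4 ∧
      coprodSh θ 1 = xiSh θ 0 * xiSh θ 2 * xiSh θ 3 * xiSh θ 4 ∧
      coprodSh θ 2 = xiSh θ 0 * xiSh θ 1 * xiSh θ 3 * xiSh θ 4 ∧
      coprodSh θ 3 = xiSh θ 0 * xiSh θ 1 * xiSh θ 2 * xiSh θ 4 ∧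
      coprodSh θ 4 = xiSh θ 0 * xiSh θ 1 * xiSh θ 2 * xiSh θ 3 := by
  refine ⟨?_, ?_, ?_, ?_, ?_⟩ <;>
  · funext x
    simp [coprodSh, coprod, xiSh, List.ofFn_succ, Fin.succAbove, Pi.mul_apply, mul_assoc]

/-- The differentials of the coframe of the five-dimensional Iwasawa manifold. -/
def fiveDiff (θ : Fin 5 → ∀ x : M, TangentSpace I x →L[ℝ] ℂ) : Fin 5 → ShForm I M :=
  ![0, 0, frameSh θ 0 * frameSh θ 1, frameSh θ 0 * frameSh θ 2, frameSh θ 1 * frameSh θ 2]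

/-- Every monomial of `dω` involves three distinct indices, and the cube of `∑ ξ_j` needs three
more; there are only five. -/
theorem sum_xiSh_pow_mul_five :
    (∑ j, xiSh θ j) * ((∑ j, xiSh θ j) * ((∑ j, xiSh θ j) *
      (delPart θ (fiveDiff θ) + delbarPart θ (fiveDiff θ)))) = 0 := by
  have A := anticomm_frameSh θ
  simp [fiveDiff, Fin.sum_univ_five, conjSh_zero, conjSh_mul, xiSh_eq, delPart, delbarPart, mul_add,
    add_mul, mul_assoc, A.fe, A.fe_mul, A.ee_lt, A.ee_mul, A.ff_lt, A.ff_mul, A.e_sq, A.e_sq_mul,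
    A.f_sq, A.f_sq_mul, smul_smul]

theorem delbarPart_mul_self_five :
    delbarPart θ (fiveDiff θ) * delbarPart θ (fiveDiff θ) = 0 := by
  have A := anticomm_frameSh θ
  simp [fiveDiff, Fin.sum_univ_five, conjSh_zero, conjSh_mul, delbarPart, mul_add,
    add_mul, mul_assoc, A.fe, A.fe_mul, A.ee_lt, A.ee_mul, A.ff_lt, A.ff_mul, A.e_sq, A.e_sq_mul,
    A.f_sq, A.f_sq_mul, smul_smul]

theorem sum_mul_conj_five : ∑ j, fiveDiff θ j * conjSh (fiveDiff θ j) =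
    xiSh θ 0 * xiSh θ 1 + xiSh θ 0 * xiSh θ 2 + xiSh θ 1 * xiSh θ 2 := by
  have A := anticomm_frameSh θ
  simp [fiveDiff, Fin.sum_univ_five, conjSh_zero, conjSh_mul, xiSh_eq,
    mul_assoc, A.fe, A.fe_mul, A.ee_lt, A.ee_mul, A.ff_lt, A.ff_mul, smul_smul]

/-- The factor `∑ ξ_j` matters: `∂ω ∧ ∂̄ω` also has off-diagonal terms, such as `ξ_2` times `θ_0 ∧
θ_4 ∧ conj θ_1 ∧ conj θ_3`. They involve all five indices, so every `ξ_j` annihilates them. -/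
theorem sum_xiSh_mul_delPart_mul_five :
    (∑ j, xiSh θ j) * (delPart θ (fiveDiff θ) * delbarPart θ (fiveDiff θ)) =
      Complex.I • ((∑ j, xiSh θ j) * (xiSh θ 0 * xiSh θ 1 * xiSh θ 2 +
        xiSh θ 0 * xiSh θ 2 * xiSh θ 3 + xiSh θ 1 * xiSh θ 2 * xiSh θ 4)) := by
  have A := anticomm_frameSh θ
  simp [fiveDiff, Fin.sum_univ_five, conjSh_zero, conjSh_mul, xiSh_eq, delPart, delbarPart, mul_add,
    add_mul, mul_assoc, A.fe, A.fe_mul, A.ee_lt, A.ee_mul, A.ff_lt, A.ff_mul, A.e_sq, A.e_sq_mul,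
    A.f_sq, A.f_sq_mul, smul_smul]
  module

/-- An even field of forms as an element of the center. -/
def xiShC (θ : Fin 5 → ∀ x : M, TangentSpace I x →L[ℝ] ℂ) (j : Fin 5) :
    Subalgebra.center ℂ (ShForm I M) :=
  ⟨xiSh θ j, Subalgebra.mem_center_iff.2 fun _ => funext fun _ => (xi_comm _ _).symm⟩

theorem sum_xiSh_pow_mul_sum :
    (1 / 2 : ℂ) • ((∑ j, xiSh θ j) ^ 2 * (xiSh θ 0 * xiSh θ 1 + xiSh θ 0 * xiSh θ 2 +
      xiSh θ 1 * xiSh θ 2)) - (∑ j, xiSh θ j) * (xiSh θ 0 * xiSh θ 1 * xiSh θ 2 +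
      xiSh θ 0 * xiSh θ 2 * xiSh θ 3 + xiSh θ 1 * xiSh θ 2 * xiSh θ 4) =
    (1 / 6 : ℂ) • (∑ j, xiSh θ j) ^ 3 * ((3 / 4 : ℂ) • xiSh θ 0 + (3 / 4 : ℂ) • xiSh θ 1 -
      (1 / 4 : ℂ) • xiSh θ 2 - (1 / 4 : ℂ) • xiSh θ 3 - (1 / 4 : ℂ) • xiSh θ 4) := by
  have h := congrArg Subtype.val (sum_mul_five (x := xiShC θ)
    fun j => Subtype.ext (funext fun x => xi_mul_self (θ j x)))
  have hs : ((∑ j, xiShC θ j : Subalgebra.center ℂ (ShForm I M)) : ShForm I M) =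
      ∑ j, xiSh θ j := AddSubmonoidClass.coe_finsetSum _ _
  rw [← hs]
  exact h

/-- The two terms on the left are `i ω ∧ ∂ω ∧ ∂̄ω` and `(1/2) ω² ∧ i∂∂̄ω`, that is, the Leibniz
expansion of `i∂∂̄ω_3`. -/
theorem smul_five : Complex.I • ((∑ j, xiSh θ j) *
      (delPart θ (fiveDiff θ) * delbarPart θ (fiveDiff θ)) + (1 / 2 : ℂ) • ((∑ j, xiSh θ j) ^ 2 *
        -(Complex.I • ∑ j, fiveDiff θ j * conjSh (fiveDiff θ j)))) =
    (1 / 6 : ℂ) • (∑ j, xiSh θ j) ^ 3 *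
      ∑ j, ((![3 / 4, 3 / 4, -1 / 4, -1 / 4, -1 / 4] j : ℝ) : ℂ) • xiSh θ j := by
  have h : ∑ j, ((![3 / 4, 3 / 4, -1 / 4, -1 / 4, -1 / 4] j : ℝ) : ℂ) • xiSh θ j =
      (3 / 4 : ℂ) • xiSh θ 0 + (3 / 4 : ℂ) • xiSh θ 1 -
      (1 / 4 : ℂ) • xiSh θ 2 - (1 / 4 : ℂ) • xiSh θ 3 - (1 / 4 : ℂ) • xiSh θ 4 := by
    rw [Fin.sum_univ_five]
    simp
    module
  rw [h, ← sum_xiSh_pow_mul_sum, sum_xiSh_mul_delPart_mul_five, sum_mul_conj_five, smul_add,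
    smul_smul, Complex.I_mul_I, neg_one_smul, neg_add_eq_sub, mul_neg, mul_smul_comm]
  congr 1
  rw [smul_neg, smul_neg, smul_comm _ Complex.I, smul_smul, Complex.I_mul_I, neg_one_smul, neg_neg]

variable [I.Boundaryless] [IsManifold I 1 M]

/-- Allows a long product to be built one factor at a time, with every partial product closed. -/
theorem HasD.mul_closed {k l : ℕ} {p q δ : ShForm I M} (hp : HasD k p 0) (hq : HasD l q δ)
    (h : p * δ = 0) : HasD (k + l) (p * q) 0 := by
  have := hp.mul hq
  rwa [h, zero_mul, smul_zero, add_zero] at this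

/-- Each of the five products is closed by itself. Indeed `ξ_0` and `ξ_1` are closed, `dξ_2` is
killed by `ξ_0` or `ξ_1`, `dξ_3` by `ξ_0` or `ξ_2`, and `dξ_4` by `ξ_1` or `ξ_2`; multiplying in
increasing order, a suitable factor is always already present. -/
theorem hasD_sum_coprodSh_five (hd : ∀ j, HasD 1 (frameSh θ j) (fiveDiff θ j)) {r : Fin 5 → ℂ} :
    HasD 8 (∑ j, r j • coprodSh θ j) 0 := by
  have A := anticomm_frameSh θ
  have h0 : HasD 2 (xiSh θ 0) 0 := by
    simpa [fiveDiff, conjSh_zero] using (hd 0).xiSh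
  have h1 : HasD 2 (xiSh θ 1) 0 := by
    simpa [fiveDiff, conjSh_zero] using (hd 1).xiSh
  have h2 := (hd 2).xiSh
  have h3 := (hd 3).xiSh
  have h4 := (hd 4).xiSh
  obtain ⟨p0, p1, p2, p3, p4⟩ := coprodSh_five θ
  have h01 : HasD 4 (xiSh θ 0 * xiSh θ 1) 0 := h0.mul_closed h1 (mul_zero _)
  have h02 : HasD 4 (xiSh θ 0 * xiSh θ 2) 0 := h0.mul_closed h2 <| by
    simp [fiveDiff, conjSh_mul, xiSh_eq, mul_sub, mul_assoc, A.fe_mul, A.ee_mul,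
      A.e_sq_mul, A.f_sq_mul]
  have h12 : HasD 4 (xiSh θ 1 * xiSh θ 2) 0 := h1.mul_closed h2 <| by
    simp [fiveDiff, conjSh_mul, xiSh_eq, mul_sub, mul_assoc, A.fe_mul, A.ee_mul, A.ff_mul,
      A.e_sq_mul, A.f_sq_mul, A.ff_lt, A.f_sq]
  have h123 : HasD 6 (xiSh θ 1 * xiSh θ 2 * xiSh θ 3) 0 := h12.mul_closed h3 <| by
    simp [fiveDiff, conjSh_mul, xiSh_eq, mul_sub, mul_assoc, A.fe_mul, A.ee_mul, A.ff_mul,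
      A.e_sq_mul, A.f_sq_mul, A.ff_lt, A.f_sq]
  have h023 : HasD 6 (xiSh θ 0 * xiSh θ 2 * xiSh θ 3) 0 := h02.mul_closed h3 <| by
    simp [fiveDiff, conjSh_mul, xiSh_eq, mul_sub, mul_assoc, A.fe_mul, A.ee_mul, A.ff_mul,
      A.e_sq_mul, A.f_sq_mul, A.ff_lt, A.f_sq]
  have h013 : HasD 6 (xiSh θ 0 * xiSh θ 1 * xiSh θ 3) 0 := h01.mul_closed h3 <| by
    simp [fiveDiff, conjSh_mul, xiSh_eq, mul_sub, mul_assoc, A.fe_mul, A.ee_mul, A.ff_mul,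
      A.e_sq_mul, A.f_sq_mul, A.ff_lt, A.f_sq]
  have h012 : HasD 6 (xiSh θ 0 * xiSh θ 1 * xiSh θ 2) 0 := h01.mul_closed h2 <| by
    simp [fiveDiff, conjSh_mul, xiSh_eq, mul_sub, mul_assoc, A.fe_mul, A.ee_mul, A.ff_mul,
      A.e_sq_mul, A.f_sq_mul, A.ff_lt, A.f_sq]
  have k0 : HasD 8 (coprodSh θ 0) 0 := p0 ▸ h123.mul_closed h4 (by
    simp [fiveDiff, conjSh_mul, xiSh_eq, mul_sub, mul_assoc, A.fe_mul, A.ee_mul, A.ff_mul,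
      A.e_sq_mul, A.f_sq_mul, A.ff_lt, A.f_sq])
  have k1 : HasD 8 (coprodSh θ 1) 0 := p1 ▸ h023.mul_closed h4 (by
    simp [fiveDiff, conjSh_mul, xiSh_eq, mul_sub, mul_assoc, A.fe_mul, A.ee_mul, A.ff_mul,
      A.e_sq_mul, A.f_sq_mul, A.ff_lt, A.f_sq])
  have k2 : HasD 8 (coprodSh θ 2) 0 := p2 ▸ h013.mul_closed h4 (by
    simp [fiveDiff, conjSh_mul, xiSh_eq, mul_sub, mul_assoc, A.fe_mul, A.ee_mul, A.ff_mul,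
      A.e_sq_mul, A.f_sq_mul, A.ff_lt, A.f_sq])
  have k3 : HasD 8 (coprodSh θ 3) 0 := p3 ▸ h012.mul_closed h4 (by
    simp [fiveDiff, conjSh_mul, xiSh_eq, mul_sub, mul_assoc, A.fe_mul, A.ee_mul, A.ff_mul,
      A.e_sq_mul, A.f_sq_mul, A.ff_lt, A.f_sq])
  have k4 : HasD 8 (coprodSh θ 4) 0 := p4 ▸ h012.mul_closed h3 (by
    simp [fiveDiff, conjSh_mul, xiSh_eq, mul_sub, mul_assoc, A.fe_mul, A.ee_mul, A.ff_mul,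
      A.e_sq_mul, A.f_sq_mul, A.ff_lt, A.f_sq])
  have h := HasD.sum (s := Finset.univ) (k := 8) (a := fun j => r j • coprodSh θ j)
    (b := fun _ => 0) fun j _ => by
      rw [← smul_zero (r j)]
      apply HasD.smul
      fin_cases j
      exacts [k0, k1, k2, k3, k4]
  rwa [Finset.sum_const_zero] at h

theorem IsCoframe.isSplitMetric_five (hc : IsCoframe J θ) {ω : DForm I M 2}
    (hω : ofForm ω = ∑ j, xiSh θ j) (hd : ∀ j, HasD 1 (frameSh θ j) (fiveDiff θ j)) :
    IsSplitMetric J 3 ω ![3 / 4, 3 / 4, -1 / 4, -1 / 4, -1 / 4] := by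
  have A := anticomm_frameSh θ
  have h0 : HasD 1 (frameSh θ 0) 0 := hd 0
  have h1 : HasD 1 (frameSh θ 1) 0 := hd 1
  have h2 : HasD 1 (frameSh θ 2) (frameSh θ 0 * frameSh θ 1) := hd 2
  have h3 : HasD 1 (frameSh θ 3) (frameSh θ 0 * frameSh θ 2) := hd 3
  have h4 : HasD 1 (frameSh θ 4) (frameSh θ 1 * frameSh θ 2) := hd 4
  have hcc : ∀ j, HasD 2 (fiveDiff θ j) 0 := by
    intro j
    fin_cases j
    · exact HasD.zero
    · exact HasD.zero
    · change HasD 2 (frameSh θ 0 * frameSh θ 1) 0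
      simpa using h0.mul h1
    · change HasD 2 (frameSh θ 0 * frameSh θ 2) 0
      simpa [A.e_sq_mul] using h0.mul h2
    · change HasD 2 (frameSh θ 1 * frameSh θ 2) 0
      simpa [A.ee_mul, A.e_sq] using h1.mul h2
  have tc : ∀ j x, ShType (J x) 2 0 (fiveDiff θ j x) := by
    intro j x
    fin_cases j
    exacts [ShType.zero, ShType.zero, hc.shType_frameSh_mul 0 1 x, hc.shType_frameSh_mul 0 2 x,
      hc.shType_frameSh_mul 1 2 x]
  set Ω : ShForm I M := ∑ j, xiSh θ j with hΩ
  set a := delPart θ (fiveDiff θ) with ha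
  set b := delbarPart θ (fiveDiff θ) with hb
  have hcomm : ∀ G : ShForm I M, Ω * G = G * Ω := sum_xiSh_mul_comm θ
  have dΩ : HasD 2 Ω (a + b) := hasD_sum_xiSh hd
  have db : HasD 3 b (-(Complex.I • ∑ j, fiveDiff θ j * conjSh (fiveDiff θ j))) :=
    hasD_delbarPart hd hcc
  have dΩ2 : HasD 4 (Ω ^ 2) ((2 : ℂ) • (Ω * (a + b))) := by
    have h := dΩ.mul dΩ
    rw [neg_one_sq, one_smul, ← hcomm (a + b), ← two_smul ℂ (Ω * (a + b)), ← pow_two Ω] at h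
    exact h
  have dΩ3 : HasD 6 (Ω ^ 3) ((3 : ℂ) • (Ω ^ 2 * (a + b))) := by
    have h := dΩ2.mul dΩ
    rw [← pow_succ, smul_mul_assoc, mul_assoc, ← hcomm (a + b), ← mul_assoc, ← pow_two,
      (by norm_num : (-1 : ℂ) ^ 4 = 1), one_smul] at h
    convert h using 1
    module
  have dΩ4 : HasD 8 (Ω ^ 4) 0 := by
    have h := dΩ3.mul dΩ
    have hz : Ω ^ 3 * (a + b) = 0 := by
      rw [pow_succ, pow_two, mul_assoc, mul_assoc]
      exact sum_xiSh_pow_mul_five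
    rw [← pow_succ, smul_mul_assoc, mul_assoc, ← hcomm (a + b), ← mul_assoc, ← pow_succ, hz,
      smul_zero, smul_zero, add_zero] at h
    exact h
  have e3 : ofForm (metricPow ω 3) = (1 / 6 : ℂ) • Ω ^ 3 := by
    rw [ofForm_metricPow, hω]
    norm_num [Nat.factorial]
  have tΩ : ∀ x, ShType (J x) 2 2 ((Ω ^ 2) x) := by
    intro x
    have h := (ShType.sum fun j (_ : j ∈ Finset.univ) => shType_xi (hc.map_J x j)).pow 2
    have hx : (Ω ^ 2) x = (∑ j, xi (θ j x)) ^ 2 := by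
      rw [Pi.pow_apply, hΩ, Finset.sum_apply]
      rfl
    rw [hx]
    exact h
  have ta := hc.shType_delPart tc
  have tb := hc.shType_delbarPart tc
  have tQ : ∀ x, ShType (J x) 2 2 ((-(Complex.I • ∑ j, fiveDiff θ j * conjSh (fiveDiff θ j))) x) := by
    intro x
    rw [Pi.neg_apply, Pi.smul_apply, Finset.sum_apply]
    have h : ∀ j, ShType (J x) 2 2 ((fiveDiff θ j * conjSh (fiveDiff θ j)) x) := fun j =>
      (tc j x).mul (tc j x).conj
    exact ShType.neg (ShType.smul (ShType.sum fun j _ => h j) _)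
  have tΩ1 : ∀ x, ShType (J x) 1 1 (Ω x) := by
    intro x
    have hx : Ω x = ∑ j, xi (θ j x) := by
      rw [hΩ, Finset.sum_apply]
      rfl
    rw [hx]
    exact ShType.sum fun j _ => shType_xi (hc.map_J x j)
  -- Since `ω_3 = Ω³ / 6`, its derivative is `Ω² ∧ dΩ / 2`. Differentiating the `∂̄`-part gives `Ω ∧
  -- (a + b) ∧ b` besides the term with `db`, and `b ∧ b = 0`.
  refine hc.isSplitMetric hω (b₁ := (1 / 2 : ℂ) • (Ω ^ 2 * a)) (b₂ := (1 / 2 : ℂ) • (Ω ^ 2 * b))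
    (g := Ω * (a * b) + (1 / 2 : ℂ) • (Ω ^ 2 *
      -(Complex.I • ∑ j, fiveDiff θ j * conjSh (fiveDiff θ j)))) ?_ (fun x => ?_) (fun x => ?_)
    ?_ (fun x => ?_) ?_ ?_ ?_
  · rw [e3]
    convert dΩ3.smul (1 / 6 : ℂ) using 1
    rw [mul_add]
    module
  · exact ((tΩ x).mul (ta x)).smul _
  · exact ((tΩ x).mul (tb x)).smul _
  · have h := (dΩ2.mul db).smul (1 / 2 : ℂ)
    convert h using 1
    rw [smul_mul_assoc, mul_assoc, add_mul, delbarPart_mul_self_five, add_zero,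
      (by norm_num : (-1 : ℂ) ^ 4 = 1)]
    module
  · have u1 : ShType (J x) 4 4 ((Ω * (a * b)) x) := (tΩ1 x).mul ((ta x).mul (tb x))
    have u2 : ShType (J x) 4 4 ((Ω ^ 2 *
        -(Complex.I • ∑ j, fiveDiff θ j * conjSh (fiveDiff θ j))) x) := (tΩ x).mul (tQ x)
    exact u1.add (u2.smul _)
  · rw [e3]
    exact smul_five
  · rw [ofForm_metricPow, hω]
    simpa using dΩ4.smul _
  · exact hasD_sum_coprodSh_five hd

end Fivefold

end PSS
end

/-! ### Left-invariant forms on quotients by discrete subgroups -/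

noncomputable section
namespace PSS

section OneForm

variable {E : Type*} [NormedAddCommGroup E] [NormedSpace ℝ E]

theorem contDiffOn_oneForm {η : E → E →L[ℝ] ℂ} {s : Set E} {k : WithTop ℕ∞}
    (h : ContDiffOn ℝ k η s) : ContDiffOn ℝ k (fun y => oneForm (η y)) s :=
  (ContinuousAlternatingMap.ofSubsingletonLIE (𝕜 := ℝ) (E := E) (F := ℂ) (0 : Fin 1)).contDiff.comp_contDiffOn h

theorem toSh_extDeriv_oneForm {η : E → E →L[ℝ] ℂ} {D : E →L[ℝ] E →L[ℝ] ℂ} {y : E}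
    (h : HasFDerivAt η D y) (u v : E) :
    toSh (extDeriv (fun y => oneForm (η y)) y) [u, v] = D u v - D v u := by
  have h1 : HasFDerivAt (fun y => oneForm (η y)) _ y :=
    (ContinuousAlternatingMap.ofSubsingletonLIE (𝕜 := ℝ) (E := E) (F := ℂ)
      (0 : Fin 1)).toContinuousLinearEquiv.hasFDerivAt.comp y h
  have h2 : ∀ u, fderiv ℝ (fun y => oneForm (η y)) y u = oneForm (D u) := fun u => by
    rw [h1.fderiv]
    rfl
  rw [toSh_extDeriv, Sh.alt_cons, Sh.alt_cons, Sh.alt_nil, h2, Sh.ctr_apply, h2]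
  rw [toSh_oneForm_apply, toSh_oneForm_apply, sub_zero]

end OneForm

section Quotient

variable {E : Type*} [NormedAddCommGroup E] [NormedSpace ℝ E] {G : Type*} [TopologicalSpace G]
  [Group G] [IsTopologicalGroup G] [T2Space G] [LocallyCompactSpace G] [ChartedSpace E G]
  {ι : G ≃ₜ E} (hι : ∀ g : G, chartAt E g = ι.toOpenPartialHomeomorph) {Γ : Subgroup G}
  [DiscreteTopology Γ]

include hι

/-- The group has a global chart, so every inverse chart of the quotient is the projection read in
that chart, independently of the centre and also outside the chart's target. -/
theorem extChartAt_quotient_symm (q : LeftQuotient Γ) (y : E) :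
    (extChartAt 𝓘(ℝ, E) q).symm y = quotMap Γ (ι.symm y) := by
  have h : ∀ a : G, (chartAt E a).symm y = ι.symm y := fun a => by
    rw [hι]
    rfl
  have h1 := (isQuotientCoveringMap_quotientMk_of_properlyDiscontinuousSMul
    (G := Γ) (E := G)).isCoveringMap.isLocalHomeomorph
  change (h1.localInverseAt _).symm ((chartAt E _).symm y) = _
  rw [h, h1.localInverseAt_symm]
  rfl

/-- A chart of the quotient chooses a local lift to the group; two lifts of the same point differ by
an element of `Γ`, which stays the same on a neighbourhood. -/
theorem exists_extChartAt_quotient (x : E) :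
    ∃ g : Γ, (fun z => extChartAt 𝓘(ℝ, E) (quotMap Γ (ι.symm x)) (quotMap Γ (ι.symm z))) =ᶠ[𝓝 x]
      fun z => ι (g * ι.symm z) := by
  set q := quotMap Γ (ι.symm x) with hq
  have h1 := (isQuotientCoveringMap_quotientMk_of_properlyDiscontinuousSMul
    (G := Γ) (E := G)).isCoveringMap.isLocalHomeomorph
  obtain ⟨b, hb⟩ : ∃ b : G, chartAt E q = h1.localInverseAt b ≫ₕ chartAt E b := ⟨_, rfl⟩
  have hc : ∀ p, extChartAt 𝓘(ℝ, E) q p = ι (h1.localInverseAt b p) := by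
    intro p
    change chartAt E q p = _
    rw [hb, hι]
    rfl
  have hs : q ∈ (h1.localInverseAt b).source := by
    have h2 := mem_chart_source E q
    rw [hb, OpenPartialHomeomorph.trans_source] at h2
    exact h2.1
  have h3 := h1.apply_localInverseAt_of_mem hs
  obtain ⟨g, hg⟩ := Quotient.exact h3
  refine ⟨g, ?_⟩
  have hg' : (g : G) * ι.symm x = h1.localInverseAt b q := hg
  have hcont : Continuous fun z => (g : G) * ι.symm z := by fun_prop
  have hev := hcont.continuousAt.eventually_mem
    ((h1.localInverseAt b).open_target.mem_nhds (by
      rw [hg']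
      exact (h1.localInverseAt b).map_source hs))
  filter_upwards [hev] with z hz
  rw [hc]
  congr 1
  have h4 : quotMap Γ (ι.symm z) = (h1.localInverseAt b).symm ((g : G) * ι.symm z) := by
    rw [h1.localInverseAt_symm]
    exact (Quotient.sound ⟨g, rfl⟩ :
      (Quotient.mk (MulAction.orbitRel Γ G) ((g : G) * ι.symm z)) = _).symm
  rw [h4, (h1.localInverseAt b).right_inv hz]

theorem extChartAt_self_apply (x : G) : extChartAt 𝓘(ℝ, E) x x = ι x := by
  change chartAt E x x = ι x
  rw [hι]
  rfl

theorem extChartAt_self_symm_apply (x : G) (y : E) :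
    (extChartAt 𝓘(ℝ, E) x).symm y = ι.symm y := by
  change (chartAt E x).symm y = ι.symm y
  rw [hι]
  rfl

variable {DL : G → E → E →L[ℝ] E}
  (hL : ∀ a z, HasFDerivAt (fun z => ι (a * ι.symm z)) (DL a z) z)

include hL

theorem exists_hasFDerivAt_quotient (x : E) : ∃ a : G,
    HasFDerivAt (fun z => extChartAt 𝓘(ℝ, E) (quotMap Γ (ι.symm x)) (quotMap Γ (ι.symm z)))
      (DL a x) x ∧
    extChartAt 𝓘(ℝ, E) (quotMap Γ (ι.symm x)) (quotMap Γ (ι.symm x)) = ι (a * ι.symm x) := by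
  obtain ⟨g, hg⟩ := exists_extChartAt_quotient hι (Γ := Γ) x
  exact ⟨g, (hL g x).congr_of_eventuallyEq hg, hg.self_of_nhds⟩

variable {n : ℕ} {η : Fin n → E → E →L[ℝ] ℂ}
  (hη : ∀ j a z v, η j (ι (a * ι.symm z)) (DL a z v) = η j z v)

/-- The functionals induced on a quotient by left-invariant functionals. -/
def quotFunctional (η : Fin n → E → E →L[ℝ] ℂ) (j : Fin n) (q : LeftQuotient Γ) :
    TangentSpace 𝓘(ℝ, E) q →L[ℝ] ℂ := η j (extChartAt 𝓘(ℝ, E) q q)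

include hη

theorem quotFunctional_comp_mfderiv (j : Fin n) (q : LeftQuotient Γ) (y v : E) :
    quotFunctional η j ((extChartAt 𝓘(ℝ, E) q).symm y)
      (mfderiv 𝓘(ℝ, E) 𝓘(ℝ, E) (extChartAt 𝓘(ℝ, E) q).symm y v) = η j y v := by
  have h : (extChartAt 𝓘(ℝ, E) q).symm = fun y => quotMap Γ (ι.symm y) :=
    funext (extChartAt_quotient_symm hι q)
  rw [h]
  obtain ⟨a, h1, h2⟩ := exists_hasFDerivAt_quotient hι hL (Γ := Γ) y
  have h3 : HasMFDerivAt 𝓘(ℝ, E) 𝓘(ℝ, E) (fun y => quotMap Γ (ι.symm y)) y (DL a y) :=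
    ⟨(continuous_quotient_mk'.comp ι.symm.continuous).continuousAt, h1.hasFDerivWithinAt⟩
  rw [h3.mfderiv, quotFunctional, h2]
  exact hη j a y v

theorem pullback_quotFunctional (j : Fin n) (x : G) :
    pullback (I := 𝓘(ℝ, E)) (quotMap Γ) (fun q => oneForm (quotFunctional η j q)) x =
      oneForm (V := E) (η j (ι x)) := by
  obtain ⟨a, h1, h2⟩ := exists_hasFDerivAt_quotient hι hL (Γ := Γ) (ι x)
  rw [ι.symm_apply_apply] at h1 h2
  have h3 : HasMFDerivAt 𝓘(ℝ, E) 𝓘(ℝ, E) (quotMap Γ) x (DL a (ι x)) := by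
    refine ⟨continuous_quotient_mk'.continuousAt, ?_⟩
    rw [extChartAt_self_apply hι]
    refine h1.hasFDerivWithinAt.congr (fun z _ => ?_) ?_
    · simp only [writtenInExtChartAt, Function.comp_apply, extChartAt_self_symm_apply hι]
    · simp only [writtenInExtChartAt, Function.comp_apply, extChartAt_self_symm_apply hι]
  unfold pullback
  rw [h3.mfderiv]
  ext v
  change quotFunctional η j (quotMap Γ x) (DL a (ι x) (v 0)) = η j (ι x) (v 0)
  rw [quotFunctional, h2]
  have := hη j a (ι x) (v 0)
  rwa [ι.symm_apply_apply] at this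

/-- Invariance absorbs the translation relating two charts, so the induced form has the same
expression `η j` in every chart. Smoothness and structure equations are thereby reduced to calculus
on `E`. -/
theorem localRep_quotFunctional (j : Fin n) (q : LeftQuotient Γ) :
    localRep (I := 𝓘(ℝ, E)) (fun q => oneForm (quotFunctional η j q)) q =
      fun y => oneForm (η j y) := by
  funext y
  ext v
  exact quotFunctional_comp_mfderiv hι hL hη j q y (v 0)

/-- The constants `c` are the structure constants of the coframe; the hypothesis `hc` is the
structure equation evaluated on two vectors, with `dη` as the antisymmetrised derivative. -/
theorem hasD_quotFunctional [IsManifold 𝓘(ℝ, E) 1 (LeftQuotient Γ)]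
    (hsm : ∀ j, ContDiff ℝ ((⊤ : ℕ∞) : WithTop ℕ∞) (η j)) {Dη : Fin n → E → E →L[ℝ] E →L[ℝ] ℂ}
    (hD : ∀ j y, HasFDerivAt (η j) (Dη j y) y) {j : Fin n} {c : Fin n → Fin n → ℂ}
    (hc : ∀ y u v, Dη j y u v - Dη j y v u =
      ∑ k, ∑ l, c k l * (η k y u * η l y v - η k y v * η l y u)) :
    HasD 1 (frameSh (I := 𝓘(ℝ, E)) (quotFunctional (Γ := Γ) η) j) (∑ k, ∑ l, c k l •
      (frameSh (quotFunctional η) k * frameSh (quotFunctional η) l)) := by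
  refine ⟨fun q => oneForm (quotFunctional η j q), fun q => ?_, rfl, funext fun q => ?_⟩
  · rw [localRep_quotFunctional hι hL hη]
    exact contDiffOn_oneForm (hsm j).contDiffOn
  · change toSh (extD _ q) = _
    rw [toSh_extD, localRep_quotFunctional hι hL hη, Finset.sum_apply]
    simp only [Finset.sum_apply]
    set y := extChartAt 𝓘(ℝ, E) q q with hy
    change _ = ∑ k, ∑ l, c k l • (sh1 (η k y) * sh1 (η l y))
    refine (toSh_isHom _).ext (k := 2) ?_ fun v => ?_
    · intro l hl
      simp only [Sh.sum_apply, Sh.smul_apply]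
      refine Finset.sum_eq_zero fun j _ => Finset.sum_eq_zero fun k _ => ?_
      rw [(sh1_isHom _).mul (sh1_isHom _) l hl, mul_zero]
    · have hv : List.ofFn v = [v 0, v 1] := by simp
      rw [hv, toSh_extDeriv_oneForm (hD j y), hc]
      simp only [Sh.sum_apply, Sh.smul_apply, sh1_mul_apply]

end Quotient

end PSS
end

/-! ### Coframes on quotients; the Heisenberg group -/

noncomputable section
namespace PSS

open Complex

section Frame

variable {n : ℕ} {G : Type*} [TopologicalSpace G] [Group G] [IsTopologicalGroup G] [T2Space G]
  [LocallyCompactSpace G] [ChartedSpace (Fin n → ℂ) G]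

/-- Left-invariant functionals on a complex Lie group induce a coframe on a quotient. -/
theorem exists_coframe_quotient {ι : G ≃ₜ (Fin n → ℂ)}
    (hι : ∀ g : G, chartAt (Fin n → ℂ) g = ι.toOpenPartialHomeomorph) {Γ : Subgroup G}
    [DiscreteTopology Γ] [IsManifold 𝓘(ℝ, Fin n → ℂ) 1 (LeftQuotient Γ)]
    {DL : G → (Fin n → ℂ) → (Fin n → ℂ) →L[ℝ] (Fin n → ℂ)}
    (hL : ∀ a z, HasFDerivAt (fun z => ι (a * ι.symm z)) (DL a z) z)
    {η : Fin n → (Fin n → ℂ) → (Fin n → ℂ) →L[ℝ] ℂ}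
    (hη : ∀ j a z v, η j (ι (a * ι.symm z)) (DL a z v) = η j z v)
    (hsm : ∀ j, ContDiff ℝ ((⊤ : ℕ∞) : WithTop ℕ∞) (η j))
    {Dη : Fin n → (Fin n → ℂ) → (Fin n → ℂ) →L[ℝ] (Fin n → ℂ) →L[ℝ] ℂ}
    (hD : ∀ j y, HasFDerivAt (η j) (Dη j y) y) {c : Fin n → Fin n → Fin n → ℂ}
    (hc : ∀ j y u v, Dη j y u v - Dη j y v u =
      ∑ k, ∑ l, c j k l * (η k y u * η l y v - η k y v * η l y u))
    (hlin : ∀ j y v, η j y (I • v) = I * η j y v) (hinj : ∀ y v, (∀ j, η j y v = 0) → v = 0) :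
    ∃ φ : Fin n → DForm 𝓘(ℝ, Fin n → ℂ) (LeftQuotient Γ) 1,
      (∀ j, pullback (I := 𝓘(ℝ, Fin n → ℂ)) (quotMap Γ) (φ j) =
        fun x => oneForm (V := Fin n → ℂ) (η j (ι x))) ∧
      ∃ θ : Fin n → ∀ q : LeftQuotient Γ, TangentSpace 𝓘(ℝ, Fin n → ℂ) q →L[ℝ] ℂ,
        IsCoframe (stdJ (LeftQuotient Γ)) θ ∧ ofForm (stdMetric φ) = ∑ j, xiSh θ j ∧
        ∀ j, HasD 1 (frameSh θ j) (∑ k, ∑ l, c j k l • (frameSh θ k * frameSh θ l)) := by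
  have hd : ∀ j, HasD 1 (frameSh (I := 𝓘(ℝ, Fin n → ℂ)) (quotFunctional (Γ := Γ) η) j) _ :=
    fun j => hasD_quotFunctional hι hL hη hsm hD (hc j)
  refine ⟨fun j q => oneForm (quotFunctional η j q),
    fun j => funext (pullback_quotFunctional hι hL hη j), quotFunctional η,
    ⟨fun q j v => hlin j _ v, fun q v hv => hinj _ v hv, fun q w => ?_, fun j => ⟨_, hd j⟩⟩,
    funext fun q => ?_, hd⟩
  · let f : (Fin n → ℂ) →ₗ[ℝ] (Fin n → ℂ) :=
      LinearMap.pi fun j => (η j (extChartAt 𝓘(ℝ, Fin n → ℂ) q q)).toLinearMap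
    have hf : Function.Injective f := by
      rw [injective_iff_map_eq_zero]
      exact fun v hv => hinj _ v fun j => congrFun hv j
    obtain ⟨v, hv⟩ := (LinearMap.injective_iff_surjective.1 hf) w
    exact ⟨v, fun j => congrFun hv j⟩
  · rw [Finset.sum_apply]
    change toSh (∑ j, _) = _
    rw [toSh_sum]
    exact Finset.sum_congr rfl fun j _ => toSh_xi _

end Frame

theorem HasD.congr {E : Type*} [NormedAddCommGroup E] [NormedSpace ℝ E] {H : Type*}
    [TopologicalSpace H] {I : ModelWithCorners ℝ E H} {M : Type*} [TopologicalSpace M]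
    [ChartedSpace H M] {k : ℕ} {a b b' : ShForm I M} (h : HasD k a b) (hb : b = b') :
    HasD k a b' := hb ▸ h

namespace Heisenberg

instance : IsManifold 𝓘(ℝ, Fin 3 → ℂ) 1 Heisenberg :=
  inferInstanceAs (IsManifold 𝓘(ℝ, Fin 3 → ℂ) 1 (Fin 3 → ℂ))

/-- The coordinates. -/
def coordHomeo : Heisenberg ≃ₜ (Fin 3 → ℂ) := Homeomorph.refl _

theorem contDiff_mulFun (a : Fin 3 → ℂ) : ContDiff ℝ 1 (mulFun a) := by
  refine contDiff_pi.mpr fun j => ?_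
  fin_cases j <;> simp [mulFun] <;> fun_prop

/-- The exterior derivative is taken over the reals, so the underlying real manifold of the quotient
is needed besides the complex one. -/
instance (Γ : Subgroup Heisenberg) [DiscreteTopology Γ] :
    IsManifold 𝓘(ℝ, Fin 3 → ℂ) 1 (LeftQuotient Γ) :=
  isManifold_quotient _ _ fun g => ContDiff.contMDiff (f := mulFun (g : Heisenberg))
    (contDiff_mulFun _)

theorem exists_isSplitMetric (Γ : Subgroup Heisenberg) [DiscreteTopology Γ] :
    ∃ φ : Fin 3 → DForm 𝓘(ℝ, Fin 3 → ℂ) (LeftQuotient Γ) 1,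
      (∀ j, pullback (quotMap Γ) (φ j) = frame j) ∧
      IsSplitMetric (stdJ (LeftQuotient Γ)) 1 (stdMetric φ) ![1 / 2, 1 / 2, -1 / 2] := by
  let η : Fin 3 → (Fin 3 → ℂ) → (Fin 3 → ℂ) →L[ℝ] ℂ := fun j z =>
    ![dz 0, dz 1, dz 2 - (z 0 : ℂ) • dz 1] j
  -- Left translations are affine in these coordinates, so the derivative does not depend on the
  -- point.
  let DL : Heisenberg → (Fin 3 → ℂ) → (Fin 3 → ℂ) →L[ℝ] (Fin 3 → ℂ) := fun a _ =>
    ContinuousLinearMap.pi ![dz 0, dz 1, dz 2 + (a 0 : ℂ) • dz 1]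
  -- Only the third functional varies. Antisymmetrising its derivative gives `-dz_0 ∧ dz_1`, which
  -- fixes the structure constants `c` below.
  let Dη : Fin 3 → (Fin 3 → ℂ) → (Fin 3 → ℂ) →L[ℝ] (Fin 3 → ℂ) →L[ℝ] ℂ := fun j _ =>
    ![0, 0, -(dz 0).smulRight (dz 1)] j
  refine Exists.elim (exists_coframe_quotient (G := Heisenberg) (Γ := Γ)
    (ι := coordHomeo) (fun g => rfl) (DL := DL) (η := η) (Dη := Dη)
    (c := ![0, 0, fun k l => if k = 0 ∧ l = 1 then -1 else 0])
    ?_ ?_ ?_ ?_ ?_ ?_ ?_) ?_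
  rotate_right
  · rintro φ ⟨hφ, θ, hθ, hω, hd⟩
    refine ⟨φ, hφ, hθ.isSplitMetric_heisenberg hω ((hd 0).congr ?_) ((hd 1).congr ?_)
      ((hd 2).congr ?_)⟩
    · simp
    · simp
    · simp [Fin.sum_univ_three]
  · intro a z
    change HasFDerivAt (mulFun a) _ z
    refine hasFDerivAt_pi.2 fun j => ?_
    have h0 := (dz (n := 3) 0).hasFDerivAt (x := z)
    have h1 := (dz (n := 3) 1).hasFDerivAt (x := z)
    have h2 := (dz (n := 3) 2).hasFDerivAt (x := z)
    fin_cases j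
    · exact h0.const_add (a 0)
    · exact h1.const_add (a 1)
    · exact (h2.const_add (a 2)).add (h1.const_mul (a 0))
  · intro j a z v
    change η j (mulFun a z) (DL a z v) = _
    fin_cases j
    · simp [η, DL, dz]
    · simp [η, DL, dz]
    · simp [η, DL, dz, mulFun]
      ring
  · intro j
    fin_cases j
    · exact contDiff_const
    · exact contDiff_const
    · exact contDiff_const.sub ((dz 0).contDiff.smul contDiff_const)
  · intro j y
    fin_cases j
    · exact hasFDerivAt_const _ _
    · exact hasFDerivAt_const _ _
    · exact ((dz 0).hasFDerivAt.smul_const (dz 1)).const_sub (dz 2)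
  · intro j y u v
    fin_cases j
    · simp [Dη]
    · simp [Dη]
    · simp [Dη, Fin.sum_univ_three, η, dz]
      ring
  · intro j y v
    fin_cases j
    · simp [η, dz]
    · simp [η, dz]
    · simp [η, dz]
      ring
  · intro y v h
    have h0 := h 0
    have h1 := h 1
    have h2 := h 2
    simp [η, dz] at h0 h1 h2
    funext j
    fin_cases j
    · exact h0
    · exact h1
    · simpa [h1] using h2

end Heisenberg

end PSS
end

/-! ### The Nakamura group and the five-dimensional Iwasawa group -/

noncomputable section
namespace PSS

open Complex

namespace NakamuraGroup

instance : IsManifold 𝓘(ℝ, Fin 3 → ℂ) 1 NakamuraGroup :=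
  inferInstanceAs (IsManifold 𝓘(ℝ, Fin 3 → ℂ) 1 (Fin 3 → ℂ))

/-- The coordinates. -/
def coordHomeo : NakamuraGroup ≃ₜ (Fin 3 → ℂ) := Homeomorph.refl _

theorem contDiff_mulFun (a : Fin 3 → ℂ) : ContDiff ℝ 1 (mulFun a) := by
  refine contDiff_pi.mpr fun j => ?_
  fin_cases j <;> simp [mulFun] <;> fun_prop

instance (Γ : Subgroup NakamuraGroup) [DiscreteTopology Γ] :
    IsManifold 𝓘(ℝ, Fin 3 → ℂ) 1 (LeftQuotient Γ) :=
  isManifold_quotient _ _ fun g => ContDiff.contMDiff (f := mulFun (g : NakamuraGroup))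
    (contDiff_mulFun _)

theorem exists_isSplitMetric (Γ : Subgroup NakamuraGroup) [DiscreteTopology Γ] :
    ∃ φ : Fin 3 → DForm 𝓘(ℝ, Fin 3 → ℂ) (LeftQuotient Γ) 1,
      (∀ j, pullback (quotMap Γ) (φ j) = frame j) ∧
      IsSplitMetric (stdJ (LeftQuotient Γ)) 1 (stdMetric φ) ![1, 0, 0] := by
  let η : Fin 3 → (Fin 3 → ℂ) → (Fin 3 → ℂ) →L[ℝ] ℂ := fun j z =>
    ![dz 0, Complex.exp (z 0) • dz 1, Complex.exp (-(z 0)) • dz 2] j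
  let DL : NakamuraGroup → (Fin 3 → ℂ) → (Fin 3 → ℂ) →L[ℝ] (Fin 3 → ℂ) := fun a _ =>
    ContinuousLinearMap.pi ![dz 0, Complex.exp (-a 0) • dz 1, Complex.exp (a 0) • dz 2]
  -- Differentiating the exponentials reproduces them, with a factor `dz_0` or `-dz_0`; this is why
  -- the structure constants are `1` and `-1` although the forms vary.
  let Dη : Fin 3 → (Fin 3 → ℂ) → (Fin 3 → ℂ) →L[ℝ] (Fin 3 → ℂ) →L[ℝ] ℂ := fun j y =>
    ![0, (Complex.exp (y 0) • dz 0).smulRight (dz 1),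
      (Complex.exp (-(y 0)) • -dz 0).smulRight (dz 2)] j
  refine Exists.elim (exists_coframe_quotient (G := NakamuraGroup) (Γ := Γ)
    (ι := coordHomeo) (fun g => rfl) (DL := DL) (η := η) (Dη := Dη)
    (c := ![0, fun k l => if k = 0 ∧ l = 1 then 1 else 0,
      fun k l => if k = 0 ∧ l = 2 then -1 else 0])
    ?_ ?_ ?_ ?_ ?_ ?_ ?_) ?_
  rotate_right
  · rintro φ ⟨hφ, θ, hθ, hω, hd⟩
    refine ⟨φ, hφ, hθ.isSplitMetric_nakamura hω ((hd 0).congr ?_) ((hd 1).congr ?_)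
      ((hd 2).congr ?_)⟩
    · simp
    · simp [Fin.sum_univ_three]
    · simp [Fin.sum_univ_three]
  · intro a z
    change HasFDerivAt (mulFun a) _ z
    refine hasFDerivAt_pi.2 fun j => ?_
    have h0 := (dz (n := 3) 0).hasFDerivAt (x := z)
    have h1 := (dz (n := 3) 1).hasFDerivAt (x := z)
    have h2 := (dz (n := 3) 2).hasFDerivAt (x := z)
    fin_cases j
    · exact h0.const_add (a 0)
    · exact (h1.const_mul (Complex.exp (-a 0))).const_add (a 1)
    · exact (h2.const_mul (Complex.exp (a 0))).const_add (a 2)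
  · intro j a z v
    change η j (mulFun a z) (DL a z v) = _
    fin_cases j
    · simp [η, DL, dz]
    · simp [η, DL, dz, mulFun, ← Complex.exp_add, ← mul_assoc]
    · simp [η, DL, dz, mulFun, ← Complex.exp_add, ← mul_assoc]
  · intro j
    fin_cases j
    · exact contDiff_const
    · exact (dz 0).contDiff.cexp.smul contDiff_const
    · exact (dz 0).contDiff.neg.cexp.smul contDiff_const
  · intro j y
    fin_cases j
    · exact hasFDerivAt_const _ _
    · exact (dz 0).hasFDerivAt.cexp.smul_const (dz 1)
    · exact (dz 0).hasFDerivAt.neg.cexp.smul_const (dz 2)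
  · intro j y u v
    fin_cases j
    · simp [Dη]
    · simp [Dη, Fin.sum_univ_three, η, dz]
      ring
    · simp [Dη, Fin.sum_univ_three, η, dz]
      ring
  · intro j y v
    fin_cases j
    · simp [η, dz]
    · simp [η, dz]
      ring
    · simp [η, dz]
      ring
  · intro y v h
    have h0 := h 0
    have h1 := h 1
    have h2 := h 2
    simp [η, dz] at h0 h1 h2
    funext j
    fin_cases j
    exacts [h0, h1, h2]

end NakamuraGroup

namespace I5Group

instance : IsManifold 𝓘(ℝ, Fin 5 → ℂ) 1 I5Group :=
  inferInstanceAs (IsManifold 𝓘(ℝ, Fin 5 → ℂ) 1 (Fin 5 → ℂ))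

/-- The coordinates. -/
def coordHomeo : I5Group ≃ₜ (Fin 5 → ℂ) := Homeomorph.refl _

theorem contDiff_mulFun (a : Fin 5 → ℂ) : ContDiff ℝ 1 (mulFun a) := by
  refine contDiff_pi.mpr fun j => ?_
  fin_cases j <;> simp [mulFun] <;> fun_prop

instance (Γ : Subgroup I5Group) [DiscreteTopology Γ] :
    IsManifold 𝓘(ℝ, Fin 5 → ℂ) 1 (LeftQuotient Γ) :=
  isManifold_quotient _ _ fun g => ContDiff.contMDiff (f := mulFun (g : I5Group))
    (contDiff_mulFun _)

theorem exists_isSplitMetric (Γ : Subgroup I5Group) [DiscreteTopology Γ] :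
    ∃ φ : Fin 5 → DForm 𝓘(ℝ, Fin 5 → ℂ) (LeftQuotient Γ) 1,
      (∀ j, pullback (quotMap Γ) (φ j) = frame j) ∧
      IsSplitMetric (stdJ (LeftQuotient Γ)) 3 (stdMetric φ)
        ![3 / 4, 3 / 4, -1 / 4, -1 / 4, -1 / 4] := by
  let η : Fin 5 → (Fin 5 → ℂ) → (Fin 5 → ℂ) →L[ℝ] ℂ := fun j z =>
    ![dz 0, dz 1, dz 2 + (z 0 : ℂ) • dz 1,
      dz 3 + (z 0 : ℂ) • dz 2 + ((z 0 : ℂ) ^ 2 / 2) • dz 1,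
      dz 4 + (z 1 : ℂ) • dz 2] j
  -- The translations are quadratic in `z` through the last coordinate only. The sum `z 1 • dz 1 + z
  -- 1 • dz 1` is the shape in which the product rule delivers the derivative of the square.
  let DL : I5Group → (Fin 5 → ℂ) → (Fin 5 → ℂ) →L[ℝ] (Fin 5 → ℂ) := fun a z =>
    ContinuousLinearMap.pi ![dz 0, dz 1, dz 2 - (a 0 : ℂ) • dz 1,
      dz 3 - (a 0 : ℂ) • dz 2 + ((a 0 : ℂ) ^ 2 / 2) • dz 1,
      dz 4 - (a 1 : ℂ) • dz 2 + ((a 0 : ℂ) * a 1) • dz 1 +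
        ((a 0 : ℂ) / 2) • (z 1 • dz 1 + z 1 • dz 1)]
  -- Antisymmetrised, the fourth entry is `dz_0 ∧ dz_2 + z_0 dz_0 ∧ dz_1 = η_0 ∧ η_2` and the fifth
  -- is `dz_1 ∧ dz_2 = η_1 ∧ η_2`, because `η_2 = dz_2 + z_0 dz_1`.
  let Dη : Fin 5 → (Fin 5 → ℂ) → (Fin 5 → ℂ) →L[ℝ] (Fin 5 → ℂ) →L[ℝ] ℂ := fun j y =>
    ![0, 0, (dz 0).smulRight (dz 1),
      (dz 0).smulRight (dz 2) + ((2⁻¹ : ℂ) • (y 0 • dz 0 + y 0 • dz 0)).smulRight (dz 1),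
      (dz 1).smulRight (dz 2)] j
  refine Exists.elim (exists_coframe_quotient (G := I5Group) (Γ := Γ)
    (ι := coordHomeo) (fun g => rfl) (DL := DL) (η := η) (Dη := Dη)
    (c := ![0, 0, fun k l => if k = 0 ∧ l = 1 then 1 else 0,
      fun k l => if k = 0 ∧ l = 2 then 1 else 0, fun k l => if k = 1 ∧ l = 2 then 1 else 0])
    ?_ ?_ ?_ ?_ ?_ ?_ ?_) ?_
  rotate_right
  · rintro φ ⟨hφ, θ, hθ, hω, hd⟩
    refine ⟨φ, hφ, hθ.isSplitMetric_five hω fun j => (hd j).congr ?_⟩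
    fin_cases j <;> simp [Fin.sum_univ_five, fiveDiff]
  · intro a z
    change HasFDerivAt (mulFun a) _ z
    refine hasFDerivAt_pi.2 fun j => ?_
    have h0 := (dz (n := 5) 0).hasFDerivAt (x := z)
    have h1 := (dz (n := 5) 1).hasFDerivAt (x := z)
    have h2 := (dz (n := 5) 2).hasFDerivAt (x := z)
    have h3 := (dz (n := 5) 3).hasFDerivAt (x := z)
    have h4 := (dz (n := 5) 4).hasFDerivAt (x := z)
    have h11 : HasFDerivAt (fun z : Fin 5 → ℂ => z 1 ^ 2) (z 1 • dz 1 + z 1 • dz 1) z := by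
      simp only [pow_two]
      exact h1.mul h1
    fin_cases j
    · exact h0.const_add (a 0)
    · exact h1.const_add (a 1)
    · exact (h2.const_add (a 2)).sub (h1.const_mul (a 0))
    · exact ((h3.const_add (a 3)).sub (h2.const_mul (a 0))).add (h1.const_mul (a 0 ^ 2 / 2))
    · exact (((h4.const_add (a 4)).sub (h2.const_mul (a 1))).add (h1.const_mul (a 0 * a 1))).add
        (h11.const_mul (a 0 / 2))
  · intro j a z v
    change η j (mulFun a z) (DL a z v) = _
    fin_cases j
    · simp [η, DL, dz]
    · simp [η, DL, dz]
    · simp [η, DL, dz, mulFun]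
      ring
    · simp [η, DL, dz, mulFun]
      ring
    · simp [η, DL, dz, mulFun]
      ring
  · intro j
    have h0 : ContDiff ℝ ((⊤ : ℕ∞) : WithTop ℕ∞) fun z : Fin 5 → ℂ => z 0 := (dz 0).contDiff
    have h1 : ContDiff ℝ ((⊤ : ℕ∞) : WithTop ℕ∞) fun z : Fin 5 → ℂ => z 1 := (dz 1).contDiff
    fin_cases j
    · exact contDiff_const
    · exact contDiff_const
    · exact contDiff_const.add (h0.smul contDiff_const)
    · exact (contDiff_const.add (h0.smul contDiff_const)).add
        (((h0.pow 2).div_const 2).smul contDiff_const)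
    · exact contDiff_const.add (h1.smul contDiff_const)
  · intro j y
    have h0 : HasFDerivAt (fun z : Fin 5 → ℂ => z 0) (dz 0) y := (dz 0).hasFDerivAt
    have h00 : HasFDerivAt (fun z : Fin 5 → ℂ => z 0 ^ 2 / 2)
        ((2⁻¹ : ℂ) • (y 0 • dz 0 + y 0 • dz 0)) y := by
      simp only [pow_two, div_eq_mul_inv]
      exact (h0.mul h0).mul_const (2⁻¹ : ℂ)
    fin_cases j
    · exact hasFDerivAt_const _ _
    · exact hasFDerivAt_const _ _
    · exact (h0.smul_const (dz 1)).const_add (dz 2)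
    · exact ((h0.smul_const (dz 2)).const_add (dz 3)).add (h00.smul_const (dz 1))
    · exact ((dz 1).hasFDerivAt.smul_const (dz 2)).const_add (dz 4)
  · intro j y u v
    fin_cases j
    · simp [Dη]
    · simp [Dη]
    · simp [Dη, Fin.sum_univ_five, η, dz]
    · simp [Dη, Fin.sum_univ_five, η, dz]
      ring
    · simp [Dη, Fin.sum_univ_five, η, dz]
      ring
  · intro j y v
    fin_cases j
    · simp [η, dz]
    · simp [η, dz]
    · simp [η, dz]
      ring
    · simp [η, dz]
      ring
    · simp [η, dz]
      ring
  · intro y v h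
    have h0 := h 0
    have h1 := h 1
    have h2 := h 2
    have h3 := h 3
    have h4 := h 4
    simp [η, dz] at h0 h1 h2 h3 h4
    rw [h1, mul_zero, add_zero] at h2
    rw [h1, h2] at h3
    rw [h2] at h4
    funext j
    fin_cases j
    exacts [h0, h1, h2, by simpa using h3, by simpa using h4]

end I5Group

end PSS
end

/-! ### The Maurer-Cartan equation for unit quaternions -/

noncomputable section
namespace PSS

section Quat

variable {E : Type*} [NormedAddCommGroup E] [NormedSpace ℝ E]

/-- The conjugation of quaternions as a continuous linear map. -/
def starCLM : ℍ[ℝ] →L[ℝ] ℍ[ℝ] := LinearMap.toContinuousLinearMap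
  { toFun := star
    map_add' := star_add
    map_smul' := fun c a => Quaternion.star_smul c a }

/-- The form `a⁻¹ da` of a function with values in the unit quaternions. -/
def quatForm (a : E → ℍ[ℝ]) (y : E) : E →L[ℝ] ℍ[ℝ] :=
  (ContinuousLinearMap.mul ℝ ℍ[ℝ] (star (a y))).comp (fderiv ℝ a y)

theorem quatForm_apply (a : E → ℍ[ℝ]) (y u : E) :
    quatForm a y u = star (a y) * fderiv ℝ a y u := rfl

theorem star_fderiv {a : E → ℍ[ℝ]} {y : E} (ha : DifferentiableAt ℝ a y) (u : E) :
    fderiv ℝ (fun z => star (a z)) y u = star (fderiv ℝ a y u) := by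
  have h := starCLM.hasFDerivAt.comp y ha.hasFDerivAt
  have h1 : HasFDerivAt (fun z => star (a z)) _ y := h
  rw [h1.fderiv]
  rfl

/-- Differentiating `star a * a = 1` shows that `a⁻¹ da` has imaginary values. -/
theorem star_quatForm {a : E → ℍ[ℝ]} {y : E} (ha : DifferentiableAt ℝ a y)
    (h1 : ∀ᶠ z in 𝓝 y, star (a z) * a z = 1) (u : E) :
    star (quatForm a y u) = -quatForm a y u := by
  have hs : DifferentiableAt ℝ (fun z => star (a z)) y :=
    starCLM.differentiableAt.comp y ha
  have h2 : fderiv ℝ (fun z => star (a z) * a z) y = 0 := by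
    have h3 : (fun z => star (a z) * a z) =ᶠ[𝓝 y] fun _ => 1 := h1
    rw [h3.fderiv_eq]
    simp
  have h4 := congrArg (· u) (fderiv_fun_mul' hs ha)
  rw [h2] at h4
  have h5 : 0 = star (a y) * fderiv ℝ a y u + star (fderiv ℝ a y u) * a y := by
    rw [← star_fderiv ha]
    exact h4
  rw [quatForm_apply, star_mul, star_star]
  exact eq_neg_of_add_eq_zero_right h5.symm

/-- The second derivative of `a` is symmetric and drops out. What is left is the derivative of `star
a` times that of `a`, rewritten through `a⁻¹ da` by means of `star_quatForm`. -/
theorem exists_hasFDerivAt_quatForm {a : E → ℍ[ℝ]} {y : E} (ha : ContDiffAt ℝ 2 a y)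
    (h1 : ∀ᶠ z in 𝓝 y, star (a z) * a z = 1) : ∃ D : E →L[ℝ] E →L[ℝ] ℍ[ℝ],
    HasFDerivAt (quatForm a) D y ∧
      ∀ u v, D u v - D v u = -(quatForm a y u * quatForm a y v - quatForm a y v * quatForm a y u) := by
  have hd : DifferentiableAt ℝ a y := ha.differentiableAt (by norm_num)
  have hf : DifferentiableAt ℝ (fderiv ℝ a) y :=
    (ha.fderiv_right (m := 1) (by norm_num)).differentiableAt (by norm_num)
  have hm : HasFDerivAt (fun z => ContinuousLinearMap.mul ℝ ℍ[ℝ] (star (a z))) _ y :=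
    (ContinuousLinearMap.mul ℝ ℍ[ℝ]).hasFDerivAt.comp y
      (starCLM.hasFDerivAt.comp y hd.hasFDerivAt)
  refine ⟨_, hm.clm_comp hf.hasFDerivAt, fun u v => ?_⟩
  have hsymm := ha.isSymmSndFDerivAt (by simp) u v
  have hst := star_quatForm hd h1
  have h0 := h1.self_of_nhds
  have h0' : a y * star (a y) = 1 := mul_eq_one_comm.1 h0
  have key : ∀ u v, star (fderiv ℝ a y u) * fderiv ℝ a y v =
      -(quatForm a y u * quatForm a y v) := by
    intro u v
    have h3 : star (fderiv ℝ a y u) = -(quatForm a y u * star (a y)) := by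
      rw [← neg_mul, ← hst, quatForm_apply, star_mul, star_star, mul_assoc, h0', mul_one]
    rw [h3, neg_mul, mul_assoc]
    rfl
  simp only [_root_.add_apply]
  change star (a y) * (fderiv ℝ (fderiv ℝ a) y u v) + star (fderiv ℝ a y u) * fderiv ℝ a y v -
    (star (a y) * (fderiv ℝ (fderiv ℝ a) y v u) + star (fderiv ℝ a y v) * fderiv ℝ a y u) = _
  rw [hsymm, key, key]
  abel

end Quat

section MaurerCartan

variable {E : Type*} [NormedAddCommGroup E] [NormedSpace ℝ E] {H : Type*} [TopologicalSpace H]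
  {I : ModelWithCorners ℝ E H} {M : Type*} [TopologicalSpace M] [ChartedSpace H M]

/-- The form `g⁻¹ dg` of a function with values in the unit quaternions. -/
def maurerCartan (I : ModelWithCorners ℝ E H) (g : M → ℍ[ℝ]) (p : M) :
    TangentSpace I p →L[ℝ] ℍ[ℝ] :=
  (ContinuousLinearMap.mul ℝ ℍ[ℝ] (star (g p))).comp (mfderiv I 𝓘(ℝ, ℍ[ℝ]) g p)

variable [I.Boundaryless] [IsManifold I ((⊤ : ℕ∞) : WithTop ℕ∞) M] {g : M → ℍ[ℝ]}
  (hg : ContMDiff I 𝓘(ℝ, ℍ[ℝ]) ((⊤ : ℕ∞) : WithTop ℕ∞) g)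

include hg

theorem contDiffOn_comp_extChartAt_symm (p : M) :
    ContDiffOn ℝ ((⊤ : ℕ∞) : WithTop ℕ∞) (g ∘ (extChartAt I p).symm) (extChartAt I p).target := by
  rw [← contMDiffOn_iff_contDiffOn]
  exact hg.comp_contMDiffOn (contMDiffOn_extChartAt_symm p)

theorem maurerCartan_comp_mfderiv (p : M) {y : E} (hy : y ∈ (extChartAt I p).target) (v : E) :
    maurerCartan I g ((extChartAt I p).symm y) (mfderiv 𝓘(ℝ, E) I (extChartAt I p).symm y v) =
      quatForm (g ∘ (extChartAt I p).symm) y v := by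
  have hs : MDifferentiableAt 𝓘(ℝ, E) I (extChartAt I p).symm y :=
    ((contMDiffOn_extChartAt_symm (n := ((⊤ : ℕ∞) : WithTop ℕ∞)) p).contMDiffAt
      ((isOpen_extChartAt_target p).mem_nhds hy)).mdifferentiableAt (by simp)
  have hgd : MDifferentiableAt I 𝓘(ℝ, ℍ[ℝ]) g ((extChartAt I p).symm y) :=
    hg.mdifferentiableAt (by simp)
  have h := mfderiv_comp y hgd hs
  rw [mfderiv_eq_fderiv] at h
  rw [quatForm_apply, h]
  rfl

theorem localRep_maurerCartan (L : ℍ[ℝ] →L[ℝ] ℂ) (p : M) {y : E}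
    (hy : y ∈ (extChartAt I p).target) :
    localRep (I := I) (fun q => oneForm (L.comp (maurerCartan I g q))) p y =
      oneForm (L.comp (quatForm (g ∘ (extChartAt I p).symm) y)) := by
  ext v
  exact congrArg L (maurerCartan_comp_mfderiv hg p hy (v 0))

/-- For a component `L`, the Maurer-Cartan equation becomes `dL = -2 L₁ ∧ L₂`; the hypothesis `hL`
is the commutator rule of the imaginary units, with `L, L₁, L₂` in cyclic order in the applications.
-/
theorem hasD_maurerCartan [IsManifold I 1 M] (h1 : ∀ p, star (g p) * g p = 1)
    {L L₁ L₂ : ℍ[ℝ] →L[ℝ] ℂ}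
    (hL : ∀ a b : ℍ[ℝ], L (-(a * b - b * a)) = -2 * (L₁ a * L₂ b - L₁ b * L₂ a)) :
    HasD 1 (fun p => sh1 (L.comp (maurerCartan I g p)))
      ((-2 : ℂ) • ((fun p => sh1 (L₁.comp (maurerCartan I g p))) *
        fun p => sh1 (L₂.comp (maurerCartan I g p)))) := by
  have hsm : ∀ p, ContDiffOn ℝ ((⊤ : ℕ∞) : WithTop ℕ∞) (quatForm (g ∘ (extChartAt I p).symm))
      (extChartAt I p).target := by
    intro p
    have h := contDiffOn_comp_extChartAt_symm hg p
    exact (((ContinuousLinearMap.mul ℝ ℍ[ℝ]).contDiff.comp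
      starCLM.contDiff).comp_contDiffOn h).clm_comp
      (h.fderiv_of_isOpen (isOpen_extChartAt_target p) (by simp))
  refine ⟨fun q => oneForm (L.comp (maurerCartan I g q)), fun p => ?_, rfl, funext fun p => ?_⟩
  · refine ContDiffOn.congr (contDiffOn_oneForm ?_) fun y hy => localRep_maurerCartan hg L p hy
    exact contDiffOn_const.clm_comp (hsm p)
  · change toSh (extD _ p) = _
    set y := extChartAt I p p with hy
    have ht : (extChartAt I p).target ∈ 𝓝 y := extChartAt_target_mem_nhds p
    have hev : localRep (I := I) (fun q => oneForm (L.comp (maurerCartan I g q))) p =ᶠ[𝓝 y]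
        fun z => oneForm (L.comp (quatForm (g ∘ (extChartAt I p).symm) z)) := by
      filter_upwards [ht] with z hz using localRep_maurerCartan hg L p hz
    have hval : ∀ L' : ℍ[ℝ] →L[ℝ] ℂ, (sh1 (L'.comp (maurerCartan I g p)) : Sh E) =
        sh1 (L'.comp (quatForm (g ∘ (extChartAt I p).symm) y)) := by
      intro L'
      have e1 := localRep_maurerCartan hg L' p (mem_extChartAt_target p)
      rw [localRep_self] at e1
      exact congrArg toSh e1
    obtain ⟨D, hD, hDD⟩ := exists_hasFDerivAt_quatForm (y := y)
      (((contDiffOn_comp_extChartAt_symm hg p).contDiffAt ht).of_le (by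
        exact WithTop.coe_le_coe.2 le_top)) (Filter.Eventually.of_forall fun z => h1 _)
    have hLD : HasFDerivAt (fun z => L.comp (quatForm (g ∘ (extChartAt I p).symm) z)) _ y :=
      ((ContinuousLinearMap.compL ℝ E ℍ[ℝ] ℂ) L).hasFDerivAt.comp y hD
    rw [toSh_extD, hev.extDeriv_eq, Pi.smul_apply, Pi.mul_apply]
    change _ = (-2 : ℂ) • ((sh1 (L₁.comp (maurerCartan I g p)) : Sh E) *
      (sh1 (L₂.comp (maurerCartan I g p)) : Sh E))
    rw [hval, hval]
    refine (toSh_isHom _).ext (k := 2) ?_ fun v => ?_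
    · intro l hl
      rw [Sh.smul_apply, (sh1_isHom _).mul (sh1_isHom _) l hl, mul_zero]
    · have hv : List.ofFn v = [v 0, v 1] := by simp
      rw [hv, toSh_extDeriv_oneForm hLD, Sh.smul_apply, sh1_mul_apply]
      refine Eq.trans ?_ (hL _ _)
      exact (map_sub L _ _).symm.trans (congrArg L (hDD (v 0) (v 1)))

end MaurerCartan

end PSS
end

/-! ### Threefolds with two closed `ξ_j`: the Calabi-Eckmann pattern -/

noncomputable section
namespace PSS

section

variable {E : Type*} [NormedAddCommGroup E] [NormedSpace ℝ E] {H : Type*} [TopologicalSpace H]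
  {I : ModelWithCorners ℝ E H} {M : Type*} [TopologicalSpace M] [ChartedSpace H M] {n : ℕ}

theorem conjSh_add (a b : ShForm I M) : conjSh (a + b) = conjSh a + conjSh b :=
  funext fun _ => Sh.conj_add _ _

theorem conjSh_smul (c : ℂ) (a : ShForm I M) : conjSh (c • a) = starRingEnd ℂ c • conjSh a :=
  funext fun _ => Sh.conj_smul _ _

theorem conjSh_conjSh (a : ShForm I M) : conjSh (conjSh a) = a := funext fun _ => Sh.conj_conj _

theorem conjSh_xiSh (θ : Fin n → ∀ x : M, TangentSpace I x →L[ℝ] ℂ) (j : Fin n) :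
    conjSh (xiSh θ j) = xiSh θ j := funext fun _ => conj_xi _

end

section

variable {E : Type*} [NormedAddCommGroup E] [NormedSpace ℝ E] {H : Type*} [TopologicalSpace H]
  {I : ModelWithCorners ℝ E H} {M : Type*} [TopologicalSpace M] [ChartedSpace H M]
  {J : EndField I M} {θ : Fin 3 → ∀ x : M, TangentSpace I x →L[ℝ] ℂ} {ω : DForm I M 2}

/-- Two candidates differ by a `(1,1)`-form annihilated by `ω`, and in dimension three `ω ∧ ·` is
injective on such forms. -/
theorem IsCoframe.isRho_unique (hc : IsCoframe J θ) (hω : ofForm ω = ∑ j, xiSh θ j)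
    {ρ ρ' : DForm I M 2} (h : IsRho J 1 ω ρ) (h' : IsRho J 1 ω ρ') : ρ = ρ' := by
  funext x
  have ht : ShType (J x) 1 1 (toSh (ρ x - ρ' x)) := by
    rw [toSh_sub]
    exact ((isOfType_iff rfl _).1 (h.2.1 x)).sub ((isOfType_iff rfl _).1 (h'.2.1 x))
  obtain ⟨d, hd⟩ := exists_sum_of_type (hc.map_J x) (hc.inj x) (hc.surj x) ht
  have hw : toSh (metricPow ω 1 x) * toSh (ρ x) = toSh (metricPow ω 1 x) * toSh (ρ' x) := by
    rw [← toSh_wedge, ← toSh_wedge, ← h.2.2 x, ← h'.2.2 x]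
  have hp : toSh (metricPow ω 1 x) = ∑ j, xi (θ j x) := by
    rw [metricPow, toSh_divPow, ofForm_metric_apply hω x]
    simp
  rw [hp, ← sub_eq_zero, ← mul_sub, ← toSh_sub, hd] at hw
  rw [eq_zero_of_sum_xi_mul_eq_zero (hc.surj x) hw] at hd
  rw [← sub_eq_zero]
  apply toSh_injective
  rw [hd, toSh_zero]
  simp

theorem IsCoframe.isStarRho_unique (hc : IsCoframe J θ) (hω : ofForm ω = ∑ j, xiSh θ j)
    {σ σ' : DForm I M 4} (h : IsStarRho J 1 ω σ) (h' : IsStarRho J 1 ω σ') : σ = σ' := by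
  obtain ⟨ρ, hρ, hs⟩ := h
  obtain ⟨ρ', hρ', hs'⟩ := h'
  obtain rfl := hc.isRho_unique hω hρ hρ'
  exact funext fun x => isHodgeStar_unique (hc.inj x) (hc.surj x) (hs x) (hs' x)

theorem IsCoframe.prod_xiSh_ne_zero [Nonempty M] (hc : IsCoframe J θ) :
    xiSh θ 0 * xiSh θ 1 * xiSh θ 2 ≠ 0 := by
  obtain ⟨x⟩ := ‹Nonempty M›
  exact fun h => prod_xi_ne_zero (hc.surj x) (congrFun h x)

variable [I.Boundaryless] [IsManifold I 1 M] {p q : ℂ} {l : ℝ}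

/-- With `T = p ξ_0 + q ξ_1` closed, `∂̄ω = i T ∧ conj θ_2` and `i∂∂̄ω = -T ∧ conj T = 2l ξ_0 ξ_1`,
whence the eigenvalues `l, l, -l`. Moreover `d⋆ρ = l (ξ_0 + ξ_1) ∧ dξ_2`, and the derivative of its
`∂̄`-part is a multiple of `(ξ_0 + ξ_1) ξ_0 ξ_1 = 0`. -/
theorem IsCoframe.calabiEckmann [Nonempty M] (hc : IsCoframe J θ)
    (hω : ofForm ω = ∑ j, xiSh θ j) (h0 : HasD 2 (xiSh θ 0) 0) (h1 : HasD 2 (xiSh θ 1) 0)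
    (h2 : HasD 1 (frameSh θ 2) (p • xiSh θ 0 + q • xiSh θ 1))
    (hpq : p * starRingEnd ℂ q + q * starRingEnd ℂ p = -(2 * l)) (hne : p + q ≠ 0) :
    IsPluriclosedStarSplit J 1 ω ∧ IsAssociatedFunction J 1 ω (fun _ => 2 * l) ∧
      (IsClosedStarSplit J 1 ω ↔ l = 0) ∧ (l = 0 → IsRho J 1 ω 0 ∧ IsSKT J ω) ∧
      StarRhoHasEigenvalues J 1 ω ![l, l, -l] := by
  have W := anticomm_frameSh θ
  set T : ShForm I M := p • xiSh θ 0 + q • xiSh θ 1 with hT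
  set b₁ : ShForm I M := -(Complex.I • (frameSh θ 2 * conjSh T)) with hb₁
  set b₂ : ShForm I M := Complex.I • (T * conjSh (frameSh θ 2)) with hb₂
  set r : Fin 3 → ℝ := ![l, l, -l] with hr
  have hcT : conjSh T = starRingEnd ℂ p • xiSh θ 0 + starRingEnd ℂ q • xiSh θ 1 := by
    rw [hT, conjSh_add, conjSh_smul, conjSh_smul, conjSh_xiSh, conjSh_xiSh]
  have hdT : HasD 2 T 0 := by simpa using (h0.smul p).add (h1.smul q)
  have hd2 : HasD 2 (xiSh θ 2) (b₁ + b₂) := by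
    refine h2.xiSh.congr ?_
    rw [hb₁, hb₂, smul_sub]
    abel
  have tx : ∀ j x, ShType (J x) 1 1 (xiSh θ j x) := fun j x => shType_xi (hc.map_J x j)
  have tθ : ∀ x, ShType (J x) 1 0 (frameSh θ 2 x) := fun x => shType_oneForm (hc.map_J x 2)
  have tT : ∀ x, ShType (J x) 1 1 (T x) := fun x => ((tx 0 x).smul p).add ((tx 1 x).smul q)
  have t₁ : ∀ x, ShType (J x) 2 1 (b₁ x) := fun x => (((tθ x).mul (tT x).conj).smul _).neg
  have t₂ : ∀ x, ShType (J x) 1 2 (b₂ x) := fun x => ((tT x).mul (tθ x).conj).smul _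
  have hdb : HasD 3 b₂ (Complex.I • (T * conjSh T)) := by
    simpa using (hdT.mul h2.conj).smul Complex.I
  have tg : ∀ x, ShType (J x) 2 2 ((Complex.I • (T * conjSh T)) x) := fun x =>
    ((tT x).mul (tT x).conj).smul _
  have hdω : HasD 2 (∑ j, xiSh θ j) (b₁ + b₂) := by
    rw [Fin.sum_univ_three]
    simpa using (h0.add h1).add hd2
  have h1p : ofForm (metricPow ω 1) = ∑ j, xiSh θ j := by
    rw [ofForm_metricPow, hω]
    simp
  have hTT : T * conjSh T = (-(2 * l) : ℂ) • (xiSh θ 0 * xiSh θ 1) := by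
    have hcomm : xiSh θ 1 * xiSh θ 0 = xiSh θ 0 * xiSh θ 1 := funext fun x => xi_comm _ _
    have s0 : xiSh θ 0 * xiSh θ 0 = 0 := funext fun x => xi_mul_self _
    have s1 : xiSh θ 1 * xiSh θ 1 = 0 := funext fun x => xi_mul_self _
    rw [hcT, hT, ← hpq]
    simp only [add_mul, mul_add, smul_mul_assoc, mul_smul_comm, s0, s1, hcomm]
    module
  have hg : Complex.I • (Complex.I • (T * conjSh T)) =
      ofForm (metricPow ω 1) * ∑ j, (r j : ℂ) • xiSh θ j := by
    have hc01 : xiSh θ 1 * xiSh θ 0 = xiSh θ 0 * xiSh θ 1 := funext fun x => xi_comm _ _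
    have hc02 : xiSh θ 2 * xiSh θ 0 = xiSh θ 0 * xiSh θ 2 := funext fun x => xi_comm _ _
    have hc12 : xiSh θ 2 * xiSh θ 1 = xiSh θ 1 * xiSh θ 2 := funext fun x => xi_comm _ _
    have s : ∀ j, xiSh θ j * xiSh θ j = 0 := fun j => funext fun x => xi_mul_self _
    rw [h1p, hTT, smul_smul, smul_smul, Complex.I_mul_I]
    simp only [hr, Fin.sum_univ_three, Matrix.cons_val, add_mul, mul_add, mul_smul_comm, s, hc01,
      hc02, hc12, Complex.ofReal_neg]
    module
  obtain ⟨ρ, σ, hρ, hσ, -, hstar, heig⟩ := hc.exists_star (m := 1) hω r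
  have hdω' : HasD (2 * 1) (ofForm (metricPow ω 1)) (b₁ + b₂) := by
    rw [h1p]
    exact hdω
  obtain ⟨hrho, hf⟩ := hc.isRho (m := 1) hω hdω' t₁ t₂ hdb tg hg hρ
  have hs : IsStarRho J 1 ω σ := ⟨ρ, hrho, hstar⟩
  have hdσ : HasD 4 (ofForm σ) ((l : ℂ) • ((xiSh θ 0 + xiSh θ 1) * b₁) +
      (l : ℂ) • ((xiSh θ 0 + xiSh θ 1) * b₂)) := by
    obtain ⟨p0, p1, p2⟩ := coprodSh_three θ
    rw [hσ, Fin.sum_univ_three, p0, p1, p2]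
    refine ((((h1.mul hd2).smul (l : ℂ)).add ((h0.mul hd2).smul (l : ℂ))).add
      ((h0.mul h1).smul ((-l : ℝ) : ℂ))).congr ?_
    simp only [zero_mul, mul_zero, smul_zero, zero_add, add_zero, add_mul, mul_add, neg_one_sq,
      one_smul]
    module
  have t : ∀ x, ShType (J x) 2 2 (toSh (σ x)) := hc.shType_coprod (m := 1) hσ
  have hXY : ∀ x, ShType (J x) 1 1 ((xiSh θ 0 + xiSh θ 1) x) := fun x => (tx 0 x).add (tx 1 x)
  have ts₁ : ∀ x, ShType (J x) 3 2 (((l : ℂ) • ((xiSh θ 0 + xiSh θ 1) * b₁)) x) := fun x => by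
    have h : ShType (J x) 3 2 ((xiSh θ 0 + xiSh θ 1) x * b₁ x) := (hXY x).mul (t₁ x)
    exact h.smul _
  have ts₂ : ∀ x, ShType (J x) 2 3 (((l : ℂ) • ((xiSh θ 0 + xiSh θ 1) * b₂)) x) := fun x => by
    have h : ShType (J x) 2 3 ((xiSh θ 0 + xiSh θ 1) x * b₂ x) := (hXY x).mul (t₂ x)
    exact h.smul _
  have hds : HasD 5 ((l : ℂ) • ((xiSh θ 0 + xiSh θ 1) * b₂)) 0 := by
    refine (((h0.add h1).mul hdb).smul (l : ℂ)).congr ?_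
    rw [hTT]
    simp [xiSh_eq, add_mul, mul_assoc, W.fe, W.fe_mul, W.ee_lt, W.ee_mul, W.ff_lt, W.ff_mul,
      W.e_sq, W.e_sq_mul, W.f_sq, W.f_sq_mul]
  refine ⟨isPluriclosedStarSplit_of_hasD hs t hdσ ts₁ ts₂ hds, ?_, ⟨?_, ?_⟩, ?_, σ, hs, heig⟩
  · have hl : ∑ j, r j = l := by simp [hr, Fin.sum_univ_three]
    simp only [hl] at hf
    convert hf using 2
    norm_num
  · rintro ⟨σ', hs', hcl⟩
    obtain rfl := hc.isStarRho_unique hω hs' hs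
    have he := hdσ.extD rfl
    rw [hcl] at he
    -- Wedging `d⋆ρ` with `θ_2` removes its `∂`-part and turns the other into this multiple of the
    -- volume form.
    have hm : (l * (p + q) : ℂ) • (xiSh θ 0 * xiSh θ 1 * xiSh θ 2) = 0 := by
      have h3 := congrArg (frameSh θ 2 * ·) he
      have h4 : ofForm (0 : DForm I M 5) = 0 := funext fun x => toSh_zero
      simp only [h4, mul_zero] at h3
      rw [h3, hb₁, hb₂, hcT, hT]
      simp [xiSh_eq, add_mul, mul_add, mul_assoc, W.fe, W.fe_mul, W.ee_lt, W.ee_mul, W.ff_lt,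
        W.ff_mul, W.e_sq, W.e_sq_mul, W.f_sq, W.f_sq_mul, smul_smul]
      module
    have h := (smul_eq_zero.1 hm).resolve_right hc.prod_xiSh_ne_zero
    exact_mod_cast (mul_eq_zero.1 h).resolve_right hne
  · rintro rfl
    refine ⟨σ, hs, ofForm_injective ((hdσ.extD rfl).trans ?_)⟩
    rw [Complex.ofReal_zero, zero_smul, zero_smul, add_zero]
    exact (funext fun x => toSh_zero).symm
  · rintro rfl
    have hρ0 : ρ = 0 := by
      refine ofForm_injective (hρ.trans ?_)
      have h4 : ofForm (0 : DForm I M 2) = 0 := funext fun x => toSh_zero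
      rw [h4, hr]
      simp [Fin.sum_univ_three]
    refine ⟨hρ0 ▸ hrho, ofForm_injective ?_⟩
    rw [ofForm_del_delbar (p := 1) (q := 1) rfl (fun x => ?_) (hω ▸ hdω) t₁ t₂ hdb tg, hTT]
    · simp only [Complex.ofReal_zero, mul_zero, neg_zero, zero_smul, smul_zero]
      exact (funext fun x => toSh_zero).symm
    · rw [ofForm_metric_apply hω x]
      exact ShType.sum fun j _ => tx j x

end

end PSS
end

/-! ### Components of the Maurer-Cartan form -/

noncomputable section
namespace PSS

/-- `a ↦ a_i` on quaternions `a = a_1 + a_i i + a_j j + a_k k`. -/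
def quatI : ℍ[ℝ] →L[ℝ] ℂ := LinearMap.toContinuousLinearMap
  { toFun := fun a => (a.imI : ℂ)
    map_add' := fun _ _ => by simp
    map_smul' := fun c a => by simp }

/-- `a ↦ a_j` on quaternions `a = a_1 + a_i i + a_j j + a_k k`. -/
def quatJ : ℍ[ℝ] →L[ℝ] ℂ := LinearMap.toContinuousLinearMap
  { toFun := fun a => (a.imJ : ℂ)
    map_add' := fun _ _ => by simp
    map_smul' := fun c a => by simp }

/-- `a ↦ a_1` on quaternions `a = a_1 + a_i i + a_j j + a_k k`. -/
def quatRe : ℍ[ℝ] →L[ℝ] ℂ := LinearMap.toContinuousLinearMap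
  { toFun := fun a => (a.re : ℂ)
    map_add' := fun _ _ => by simp
    map_smul' := fun c a => by simp }

theorem quatI_apply (a : ℍ[ℝ]) : quatI a = a.imI := rfl

theorem quatJ_apply (a : ℍ[ℝ]) : quatJ a = a.imJ := rfl

theorem quatK_apply (a : ℍ[ℝ]) : quatK a = a.imK := rfl

theorem quatIJ_eq : quatIJ = quatI + Complex.I • quatJ := by
  ext a
  change (⟨a.imI, a.imJ⟩ : ℂ) = (a.imI : ℂ) + Complex.I * (a.imJ : ℂ)
  apply Complex.ext <;> simp

section MaurerCartan

variable {E : Type*} [NormedAddCommGroup E] [NormedSpace ℝ E] {H : Type*} [TopologicalSpace H]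
  {I : ModelWithCorners ℝ E H} {M : Type*} [TopologicalSpace M] [ChartedSpace H M]

theorem conjSh_maurerCartan (g : M → ℍ[ℝ]) {L : ℍ[ℝ] →L[ℝ] ℂ}
    (hL : ∀ a, starRingEnd ℂ (L a) = L a) :
    conjSh (fun p => sh1 (L.comp (maurerCartan I g p))) =
      fun p => sh1 (L.comp (maurerCartan I g p)) := by
  funext p
  refine (sh1_conj _).trans (congrArg sh1 ?_)
  ext v
  exact hL _

variable [I.Boundaryless] [IsManifold I ((⊤ : ℕ∞) : WithTop ℕ∞) M] {g : M → ℍ[ℝ]}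
  (hg : ContMDiff I 𝓘(ℝ, ℍ[ℝ]) ((⊤ : ℕ∞) : WithTop ℕ∞) g)

include hg

/-- Complex form of `de_1 = -2 e_2 ∧ e_3` and its cyclic permutations, for `φ = e_1 + i e_2`: `dφ =
2i φ ∧ e_3`, and `φ ∧ conj φ = -2i e_1 ∧ e_2`. -/
theorem hasD_quatIJ_quatK [IsManifold I 1 M] (h1 : ∀ p, star (g p) * g p = 1) :
    HasD 1 (fun p => sh1 (quatIJ.comp (maurerCartan I g p)))
      ((2 * Complex.I) • ((fun p => sh1 (quatIJ.comp (maurerCartan I g p))) *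
        fun p => sh1 (quatK.comp (maurerCartan I g p)))) ∧
    HasD 1 (fun p => sh1 (quatK.comp (maurerCartan I g p)))
      (-(Complex.I • ((fun p => sh1 (quatIJ.comp (maurerCartan I g p))) *
        conjSh fun p => sh1 (quatIJ.comp (maurerCartan I g p))))) := by
  have hI := hasD_maurerCartan hg h1 (L := quatI) (L₁ := quatJ) (L₂ := quatK) fun a b => by
    simp only [quatI_apply, quatJ_apply, quatK_apply, Quaternion.imI_neg, Quaternion.imI_sub,
      Quaternion.imI_mul]
    push_cast
    ring
  have hJ := hasD_maurerCartan hg h1 (L := quatJ) (L₁ := quatK) (L₂ := quatI) fun a b => by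
    simp only [quatI_apply, quatJ_apply, quatK_apply, Quaternion.imJ_neg, Quaternion.imJ_sub,
      Quaternion.imJ_mul]
    push_cast
    ring
  have hK := hasD_maurerCartan hg h1 (L := quatK) (L₁ := quatI) (L₂ := quatJ) fun a b => by
    simp only [quatI_apply, quatJ_apply, quatK_apply, Quaternion.imK_neg, Quaternion.imK_sub,
      Quaternion.imK_mul]
    push_cast
    ring
  have hIJ : (fun p => sh1 (quatIJ.comp (maurerCartan I g p)) : ShForm I M) =
      (fun p => sh1 (quatI.comp (maurerCartan I g p))) +
        Complex.I • fun p => sh1 (quatJ.comp (maurerCartan I g p)) := by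
    funext p
    rw [quatIJ_eq, ContinuousLinearMap.add_comp, ContinuousLinearMap.smul_comp, sh1_add, sh1_smul]
    rfl
  have cI := conjSh_maurerCartan (I := I) g (L := quatI) fun a => Complex.conj_ofReal _
  have cJ := conjSh_maurerCartan (I := I) g (L := quatJ) fun a => Complex.conj_ofReal _
  rw [hIJ, conjSh_add, conjSh_smul, cI, cJ]
  set x : ShForm I M := fun p => sh1 (quatI.comp (maurerCartan I g p))
  set y : ShForm I M := fun p => sh1 (quatJ.comp (maurerCartan I g p))
  set z : ShForm I M := fun p => sh1 (quatK.comp (maurerCartan I g p))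
  have xx : x * x = 0 := funext fun p => sh1_mul_self _
  have yy : y * y = 0 := funext fun p => sh1_mul_self _
  have yx : y * x = -(x * y) := funext fun p => sh1_anticomm _ _
  have zx : z * x = -(x * z) := funext fun p => sh1_anticomm _ _
  refine ⟨(hI.add (hJ.smul Complex.I)).congr ?_, hK.congr ?_⟩
  · simp only [add_mul, smul_mul_assoc, smul_add, smul_smul, zx, mul_assoc, Complex.I_mul_I]
    module
  · simp only [add_mul, mul_add, smul_mul_assoc, mul_smul_comm, smul_add, smul_smul, xx, yy, yx,
      Complex.conj_I, mul_neg, neg_mul, Complex.I_mul_I]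
    simp only [smul_neg, smul_zero, neg_smul, neg_neg]
    module

theorem comp_maurerCartan_apply (L : ℍ[ℝ] →L[ℝ] ℂ) (p : M) [IsManifold I 1 M] (v : E) :
    L (maurerCartan I g p v) = L (quatForm (g ∘ (extChartAt I p).symm) (extChartAt I p p) v) := by
  have e1 := localRep_maurerCartan hg L p (mem_extChartAt_target p)
  rw [localRep_self] at e1
  have e2 : L (maurerCartan I g p v) = toSh (oneForm (L.comp (maurerCartan I g p))) [v] :=
    (toSh_oneForm_apply _ _).symm
  rw [e2]
  exact (congrFun (congrArg toSh e1) [v]).trans (toSh_oneForm_apply _ _)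

theorem re_maurerCartan [IsManifold I 1 M] (h1 : ∀ p, star (g p) * g p = 1) (p : M)
    (v : TangentSpace I p) : (maurerCartan I g p v).re = 0 := by
  have h := comp_maurerCartan_apply hg quatRe p v
  have hd : DifferentiableAt ℝ (g ∘ (extChartAt I p).symm) (extChartAt I p p) :=
    ((contDiffOn_comp_extChartAt_symm hg p).contDiffAt
      (extChartAt_target_mem_nhds p)).differentiableAt (by simp)
  have hs := congrArg (fun a : ℍ[ℝ] => a.re)
    (star_quatForm hd (Filter.Eventually.of_forall fun z => h1 _) v)
  simp only [Quaternion.re_star, Quaternion.re_neg] at hs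
  have h' : (maurerCartan I g p v).re =
      (quatForm (g ∘ (extChartAt I p).symm) (extChartAt I p p) v).re := Complex.ofReal_injective h
  rw [h']
  linarith

/-- The real component vanishes automatically, and multiplication by the unit quaternion `star (g
p)` is invertible. -/
theorem mfderiv_eq_zero_of_maurerCartan [IsManifold I 1 M] (h1 : ∀ p, star (g p) * g p = 1) (p : M)
    (v : TangentSpace I p) (hIJ : quatIJ (maurerCartan I g p v) = 0)
    (hK : quatK (maurerCartan I g p v) = 0) : mfderiv I 𝓘(ℝ, ℍ[ℝ]) g p v = 0 := by
  have h0 : maurerCartan I g p v = 0 := by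
    ext
    · exact re_maurerCartan hg h1 p v
    · exact congrArg Complex.re hIJ
    · exact congrArg Complex.im hIJ
    · exact Complex.ofReal_injective hK
  set d : ℍ[ℝ] := mfderiv I 𝓘(ℝ, ℍ[ℝ]) g p v
  have h2 : star (g p) * d = 0 := h0
  have h3 : g p * star (g p) = 1 := mul_eq_one_comm.1 (h1 p)
  change d = 0
  rw [← one_mul d, ← h3, mul_assoc, h2, mul_zero]

end MaurerCartan

end PSS
end

/-! ### The coframe `φ_t` on `S³ × S³` and its structure equations -/

noncomputable section
namespace PSS
open Complex

theorem IsCoframe.smul {E : Type*} [NormedAddCommGroup E] [NormedSpace ℝ E] {H : Type*}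
    [TopologicalSpace H] {I : ModelWithCorners ℝ E H} {M : Type*} [TopologicalSpace M]
    [ChartedSpace H M] {J : EndField I M} {n : ℕ} {θ : Fin n → ∀ x : M, TangentSpace I x →L[ℝ] ℂ}
    [I.Boundaryless] [IsManifold I 1 M] (hc : IsCoframe J θ) {c : ℂ} (h : c ≠ 0) :
    IsCoframe J fun j x => c • θ j x where
  map_J x j v := by
    change c * θ j x (J x v) = Complex.I * (c * θ j x v)
    rw [hc.map_J]
    ring
  inj x v hv := hc.inj x v fun j => (mul_eq_zero.1 (hv j)).resolve_left h
  surj x w := by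
    obtain ⟨v, hv⟩ := hc.surj x fun j => c⁻¹ * w j
    refine ⟨v, fun j => ?_⟩
    change c * θ j x v = w j
    rw [hv, mul_inv_cancel_left₀ h]
  smooth j := by
    obtain ⟨b, hb⟩ := hc.smooth j
    refine ⟨c • b, ?_⟩
    have h' : frameSh (fun j x => c • θ j x) j = c • frameSh θ j := funext fun x => sh1_smul _ _
    rw [h']
    exact hb.smul c

theorem star_mul_self_S3 (x : S3) : star (x : ℍ[ℝ]) * x = 1 := by
  rw [Quaternion.star_mul_self, Quaternion.normSq_eq_norm_mul_self]
  simp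

theorem contMDiff_fst_S3 : ContMDiff modelS3S3 𝓘(ℝ, ℍ[ℝ]) ((⊤ : ℕ∞) : WithTop ℕ∞)
    fun q : S3 × S3 => (q.1 : ℍ[ℝ]) := contMDiff_coe_sphere.comp contMDiff_fst

theorem contMDiff_snd_S3 : ContMDiff modelS3S3 𝓘(ℝ, ℍ[ℝ]) ((⊤ : ℕ∞) : WithTop ℕ∞)
    fun q : S3 × S3 => (q.2 : ℍ[ℝ]) := contMDiff_coe_sphere.comp contMDiff_snd

/-- The vanishing components make the derivative of the inclusion of each sphere vanish on `v`, and
these inclusions are immersions. -/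
theorem maurerCartan_injective {p : S3 × S3} {v : TangentSpace modelS3S3 p}
    (h₁ : quatIJ (maurerCartan₁ p v) = 0) (h₂ : quatK (maurerCartan₁ p v) = 0)
    (h₃ : quatIJ (maurerCartan₂ p v) = 0) (h₄ : quatK (maurerCartan₂ p v) = 0) : v = 0 := by
  have e₁ := mfderiv_eq_zero_of_maurerCartan contMDiff_fst_S3 (fun q => star_mul_self_S3 q.1) p v
    h₁ h₂
  have e₂ := mfderiv_eq_zero_of_maurerCartan contMDiff_snd_S3 (fun q => star_mul_self_S3 q.2) p v
    h₃ h₄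
  have hs : ∀ x : S3, MDifferentiableAt (𝓡 3) 𝓘(ℝ, ℍ[ℝ]) (fun y : S3 => (y : ℍ[ℝ])) x := fun x =>
    (contMDiff_coe_sphere (m := 1)).mdifferentiableAt (by simp)
  have f₁ := mfderiv_comp_apply (I := modelS3S3) p (hs p.1) mdifferentiableAt_fst v
  have f₂ := mfderiv_comp_apply (I := modelS3S3) p (hs p.2) mdifferentiableAt_snd v
  rw [mfderiv_fst] at f₁
  rw [mfderiv_snd] at f₂
  have g₁ : v.1 = 0 := injective_mvfderiv_subtypeVal_sphere p.1
    ((f₁.symm.trans e₁).trans (map_zero (mfderiv (𝓡 3) 𝓘(ℝ, ℍ[ℝ]) _ p.1)).symm)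
  have g₂ : v.2 = 0 := injective_mvfderiv_subtypeVal_sphere p.2
    ((f₂.symm.trans e₂).trans (map_zero (mfderiv (𝓡 3) 𝓘(ℝ, ℍ[ℝ]) _ p.2)).symm)
  exact Prod.ext g₁ g₂

theorem ceFunctional_two_apply (t : ℂ) (p : S3 × S3) (v : TangentSpace modelS3S3 p) :
    ceFunctional t 2 p v = (1 - t) * quatK (maurerCartan₁ p v) +
      I * (1 + t) * quatK (maurerCartan₂ p v) := by
  change quatK (maurerCartan₁ p v) + I * quatK (maurerCartan₂ p v) -
    t * starRingEnd ℂ (quatK (maurerCartan₁ p v) + I * quatK (maurerCartan₂ p v)) = _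
  simp only [map_add, map_mul, conj_I, quatK_apply, conj_ofReal]
  ring

theorem one_sub_sq_ne_zero {t : ℂ} (ht : ‖t‖ < 1) : (1 - (‖t‖ : ℂ) ^ 2) ≠ 0 := by
  have h : 1 - ‖t‖ ^ 2 ≠ 0 := by nlinarith [norm_nonneg t]
  exact_mod_cast h

/-- The third components `a`, `b` of the two factors are real, so the equation for `φ_t³` and its
conjugate form a linear system in them; eliminating either unknown leaves the nonzero factor `1 -
|t|²`. -/
theorem ceFunctional_injective {t : ℂ} (ht : ‖t‖ < 1) {p : S3 × S3} {v : TangentSpace modelS3S3 p}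
    (h : ∀ j, ceFunctional t j p v = 0) : v = 0 := by
  have h2 := (ceFunctional_two_apply t p v).symm.trans (h 2)
  have hN := one_sub_sq_ne_zero ht
  rw [← mul_conj'] at hN
  set a : ℝ := (maurerCartan₁ p v).imK
  set b : ℝ := (maurerCartan₂ p v).imK
  have h2' : (1 - t) * (a : ℂ) + I * (1 + t) * (b : ℂ) = 0 := h2
  have h3 := congrArg (starRingEnd ℂ) h2'
  simp only [map_add, map_mul, map_sub, map_one, map_zero, conj_I, conj_ofReal] at h3
  have ha : (1 - t * starRingEnd ℂ t) * (2 * (a : ℂ)) = 0 := by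
    linear_combination (1 + starRingEnd ℂ t) * h2' + (1 + t) * h3
  have hb : (1 - t * starRingEnd ℂ t) * (2 * I * (b : ℂ)) = 0 := by
    linear_combination (1 - starRingEnd ℂ t) * h2' - (1 - t) * h3
  refine maurerCartan_injective (h 0) ?_ (h 1) ?_
  · exact (mul_eq_zero.1 ((mul_eq_zero.1 ha).resolve_left hN)).resolve_left two_ne_zero
  · exact (mul_eq_zero.1 ((mul_eq_zero.1 hb).resolve_left hN)).resolve_left
      (mul_ne_zero two_ne_zero I_ne_zero)

theorem exists_equiv_ceFunctional {t : ℂ} (ht : ‖t‖ < 1) (p : S3 × S3) :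
    ∃ e : TangentSpace modelS3S3 p ≃L[ℝ] (Fin 3 → ℂ), ∀ v j, e v j = ceFunctional t j p v := by
  let Ψ : TangentSpace modelS3S3 p →L[ℝ] (Fin 3 → ℂ) :=
    ContinuousLinearMap.pi fun j => ceFunctional t j p
  -- The same map, with its source written as the model space so that the dimension can be computed:
  -- both sides have real dimension six, and injectivity suffices.
  let Φ : EuclideanSpace ℝ (Fin 3) × EuclideanSpace ℝ (Fin 3) →L[ℝ] (Fin 3 → ℂ) := Ψ
  have hi : Function.Injective Φ := by
    rw [injective_iff_map_eq_zero]
    exact fun v hv => ceFunctional_injective ht fun j => congrFun hv j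
  have hf : Module.finrank ℝ (EuclideanSpace ℝ (Fin 3) × EuclideanSpace ℝ (Fin 3)) =
      Module.finrank ℝ (Fin 3 → ℂ) := by
    rw [Module.finrank_prod, finrank_euclideanSpace, Module.finrank_pi_fintype]
    simp [Complex.finrank_real_complex]
  have hs : Function.Surjective Φ.toLinearMap :=
    (LinearMap.injective_iff_surjective_of_finrank_eq_finrank hf).1 hi
  exact ⟨(LinearEquiv.ofBijective Φ.toLinearMap ⟨hi, hs⟩).toContinuousLinearEquiv, fun v j => rfl⟩

theorem ceFunctional_ceJ {t : ℂ} (ht : ‖t‖ < 1) (p : S3 × S3) (j : Fin 3)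
    (v : TangentSpace modelS3S3 p) :
    ceFunctional t j p (ceJ t p v) = I * ceFunctional t j p v := by
  obtain ⟨e, he⟩ := exists_equiv_ceFunctional ht p
  have hΦ : (ContinuousLinearMap.pi fun j => ceFunctional t j p :
      TangentSpace modelS3S3 p →L[ℝ] (Fin 3 → ℂ)) = e := by
    ext v j
    exact (he v j).symm
  have hJ : ceJ t p v = e.symm (I • e v) := by
    change (ContinuousLinearMap.pi fun j => ceFunctional t j p :
      TangentSpace modelS3S3 p →L[ℝ] (Fin 3 → ℂ)).inverse (I •
      (ContinuousLinearMap.pi fun j => ceFunctional t j p :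
      TangentSpace modelS3S3 p →L[ℝ] (Fin 3 → ℂ)) v) = _
    rw [hΦ, ContinuousLinearMap.inverse_equiv]
    rfl
  rw [← he, ← he, hJ, e.apply_symm_apply]
  rfl

theorem ceJ_ceJ {t : ℂ} (ht : ‖t‖ < 1) (p : S3 × S3) (v : TangentSpace modelS3S3 p) :
    ceJ t p (ceJ t p v) = -v := by
  rw [← sub_eq_zero, sub_neg_eq_add]
  refine ceFunctional_injective ht fun j => ?_
  rw [map_add, ceFunctional_ceJ ht, ceFunctional_ceJ ht, ← mul_assoc, I_mul_I]
  ring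

/-- The third component of the form `x⁻¹ dx` of the first factor. -/
def thirdSh₁ : ShForm modelS3S3 (S3 × S3) := fun p => sh1 (quatK.comp (maurerCartan₁ p))

/-- The third component of the form `y⁻¹ dy` of the second factor. -/
def thirdSh₂ : ShForm modelS3S3 (S3 × S3) := fun p => sh1 (quatK.comp (maurerCartan₂ p))

theorem frameSh_ceFunctional_two (t : ℂ) :
    frameSh (ceFunctional t) 2 = (1 - t) • thirdSh₁ + (I * (1 + t)) • thirdSh₂ := by
  funext p
  have h : ceFunctional t 2 p = (1 - t) • quatK.comp (maurerCartan₁ p) +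
      (I * (1 + t)) • quatK.comp (maurerCartan₂ p) := by
    ext v
    exact ceFunctional_two_apply t p v
  rw [frameSh, h, sh1_add, sh1_smul, sh1_smul]
  rfl

theorem conjSh_frameSh_ceFunctional_two (t : ℂ) : conjSh (frameSh (ceFunctional t) 2) =
    (1 - starRingEnd ℂ t) • thirdSh₁ - (I * (1 + starRingEnd ℂ t)) • thirdSh₂ := by
  have c₁ : conjSh thirdSh₁ = thirdSh₁ := conjSh_maurerCartan _ fun a => conj_ofReal _
  have c₂ : conjSh thirdSh₂ = thirdSh₂ := conjSh_maurerCartan _ fun a => conj_ofReal _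
  rw [frameSh_ceFunctional_two, conjSh_add, conjSh_smul, conjSh_smul, c₁, c₂]
  simp only [map_add, map_mul, map_sub, map_one, conj_I]
  module

/-- Solves the system formed by `φ_t³` and its conjugate for the real form `e_3`; this is the source
of the denominators `1 - |t|²` in the structure equations. -/
theorem thirdSh₁_eq {t : ℂ} (ht : ‖t‖ < 1) : (2 : ℂ) • thirdSh₁ = (1 - (‖t‖ : ℂ) ^ 2)⁻¹ •
    ((starRingEnd ℂ t + 1) • frameSh (ceFunctional t) 2 +
      (t + 1) • conjSh (frameSh (ceFunctional t) 2)) := by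
  rw [eq_inv_smul_iff₀ (one_sub_sq_ne_zero ht), ← mul_conj', conjSh_frameSh_ceFunctional_two,
    frameSh_ceFunctional_two]
  module

theorem thirdSh₂_eq {t : ℂ} (ht : ‖t‖ < 1) : (2 * I) • thirdSh₂ = (1 - (‖t‖ : ℂ) ^ 2)⁻¹ •
    ((1 - starRingEnd ℂ t) • frameSh (ceFunctional t) 2 +
      (t - 1) • conjSh (frameSh (ceFunctional t) 2)) := by
  rw [eq_inv_smul_iff₀ (one_sub_sq_ne_zero ht), ← mul_conj', conjSh_frameSh_ceFunctional_two,
    frameSh_ceFunctional_two]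
  module

theorem hasD_ceFunctional_zero {t : ℂ} (ht : ‖t‖ < 1) : HasD 1 (frameSh (ceFunctional t) 0)
    (((starRingEnd ℂ t + 1) / (1 - (‖t‖ : ℂ) ^ 2) * I) •
      (frameSh (ceFunctional t) 0 * frameSh (ceFunctional t) 2) +
    ((t + 1) / (1 - (‖t‖ : ℂ) ^ 2) * I) •
      (frameSh (ceFunctional t) 0 * conjSh (frameSh (ceFunctional t) 2))) := by
  have h := (hasD_quatIJ_quatK contMDiff_fst_S3 fun q => star_mul_self_S3 q.1).1
  refine HasD.congr (a := frameSh (ceFunctional t) 0) h ?_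
  change (2 * I) • (frameSh (ceFunctional t) 0 * thirdSh₁) = _
  rw [mul_comm (2 : ℂ), mul_smul, ← mul_smul_comm, thirdSh₁_eq ht]
  simp only [mul_smul_comm, mul_add, smul_add, smul_smul]
  congr 2 <;> ring

theorem hasD_ceFunctional_one {t : ℂ} (ht : ‖t‖ < 1) : HasD 1 (frameSh (ceFunctional t) 1)
    (((1 - starRingEnd ℂ t) / (1 - (‖t‖ : ℂ) ^ 2)) •
      (frameSh (ceFunctional t) 1 * frameSh (ceFunctional t) 2) +
    ((t - 1) / (1 - (‖t‖ : ℂ) ^ 2)) •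
      (frameSh (ceFunctional t) 1 * conjSh (frameSh (ceFunctional t) 2))) := by
  have h := (hasD_quatIJ_quatK contMDiff_snd_S3 fun q => star_mul_self_S3 q.2).1
  refine HasD.congr (a := frameSh (ceFunctional t) 1) h ?_
  change (2 * I) • (frameSh (ceFunctional t) 1 * thirdSh₂) = _
  rw [← mul_smul_comm, thirdSh₂_eq ht]
  simp only [mul_smul_comm, mul_add, smul_add, smul_smul]
  congr 2 <;> ring

theorem hasD_ceFunctional_two (t : ℂ) : HasD 1 (frameSh (ceFunctional t) 2)
    (((t - 1) * I) • (frameSh (ceFunctional t) 0 * conjSh (frameSh (ceFunctional t) 0)) +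
      (t + 1) • (frameSh (ceFunctional t) 1 * conjSh (frameSh (ceFunctional t) 1))) := by
  have h₁ : HasD 1 thirdSh₁
      (-(I • (frameSh (ceFunctional t) 0 * conjSh (frameSh (ceFunctional t) 0)))) :=
    (hasD_quatIJ_quatK contMDiff_fst_S3 fun q => star_mul_self_S3 q.1).2
  have h₂ : HasD 1 thirdSh₂
      (-(I • (frameSh (ceFunctional t) 1 * conjSh (frameSh (ceFunctional t) 1)))) :=
    (hasD_quatIJ_quatK contMDiff_snd_S3 fun q => star_mul_self_S3 q.2).2
  rw [frameSh_ceFunctional_two]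
  refine ((h₁.smul (1 - t)).add (h₂.smul (I * (1 + t)))).congr ?_
  simp only [smul_neg, smul_smul]
  have hI : I * (1 + t) * I = -(1 + t) := by
    linear_combination (1 + t) * I_mul_I
  rw [hI]
  module

theorem isCoframe_ceFunctional {t : ℂ} (ht : ‖t‖ < 1) : IsCoframe (ceJ t) (ceFunctional t) where
  map_J := ceFunctional_ceJ ht
  inj _ _ := ceFunctional_injective ht
  surj p w := by
    obtain ⟨e, he⟩ := exists_equiv_ceFunctional ht p
    exact ⟨e.symm w, fun j => by rw [← he, e.apply_symm_apply]⟩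
  smooth j := by
    fin_cases j
    exacts [⟨_, hasD_ceFunctional_zero ht⟩, ⟨_, hasD_ceFunctional_one ht⟩,
      ⟨_, hasD_ceFunctional_two t⟩]

end PSS
end

/-! ### The metric `ω_t` -/

noncomputable section
namespace PSS
open Complex

theorem IsCoframe.del_delbar_oneForm {E : Type*} [NormedAddCommGroup E] [NormedSpace ℝ E]
    {H : Type*} [TopologicalSpace H] {I : ModelWithCorners ℝ E H} {M : Type*} [TopologicalSpace M]
    [ChartedSpace H M] {J : EndField I M} {n : ℕ} {θ : Fin n → ∀ x : M, TangentSpace I x →L[ℝ] ℂ}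
    [I.Boundaryless] [IsManifold I 1 M] (hc : IsCoframe J θ) {j : Fin n} {β γ : DForm I M 2} {b c : ShForm I M}
    (h : HasD 1 (frameSh θ j) (b + c)) (hβ : ofForm β = b) (hγ : ofForm γ = c)
    (tb : ∀ x, ShType (J x) 2 0 (b x)) (tc : ∀ x, ShType (J x) 1 1 (c x)) :
    extD (fun x => oneForm (θ j x)) = β + γ ∧ del J (fun x => oneForm (θ j x)) = β ∧
      delbar J (fun x => oneForm (θ j x)) = γ := by
  subst hβ hγ
  have hd : extD (fun x => oneForm (θ j x)) = β + γ := by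
    refine ofForm_injective ((h.extD rfl).trans ?_)
    exact funext fun x => (toSh_add _ _).symm
  exact ⟨hd, del_delbar_of_type (p := 1) (q := 0) rfl (fun x => shType_oneForm (hc.map_J x j))
    tb tc hd⟩

/-- The unitary coframe `φ_t^j / √2`. -/
def ceUnitary (t : ℂ) (j : Fin 3) (p : S3 × S3) : TangentSpace modelS3S3 p →L[ℝ] ℂ :=
  ((√2 : ℝ) : ℂ)⁻¹ • ceFunctional t j p

theorem frameSh_ceUnitary (t : ℂ) (j : Fin 3) :
    frameSh (ceUnitary t) j = ((√2 : ℝ) : ℂ)⁻¹ • frameSh (ceFunctional t) j :=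
  funext fun _ => sh1_smul _ _

theorem inv_sqrt_two_mul : ((√2 : ℝ) : ℂ)⁻¹ * ((√2 : ℝ) : ℂ)⁻¹ = 1 / 2 := by
  rw [← mul_inv, sqrt_two_sq, one_div]

theorem conj_inv_sqrt_two : starRingEnd ℂ ((√2 : ℝ) : ℂ)⁻¹ = ((√2 : ℝ) : ℂ)⁻¹ := by
  rw [map_inv₀, conj_ofReal]

theorem xiSh_ceUnitary (t : ℂ) (j : Fin 3) :
    xiSh (ceUnitary t) j = (1 / 2 : ℂ) • xiSh (ceFunctional t) j := by
  rw [xiSh_eq, xiSh_eq, frameSh_ceUnitary, conjSh_smul, conj_inv_sqrt_two, smul_mul_assoc,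
    mul_smul_comm]
  simp only [smul_smul]
  congr 1
  linear_combination I * inv_sqrt_two_mul

theorem frameSh_mul_conj_ceFunctional (t : ℂ) (j : Fin 3) :
    frameSh (ceFunctional t) j * conjSh (frameSh (ceFunctional t) j) =
      (-2 * I) • xiSh (ceUnitary t) j := by
  rw [xiSh_ceUnitary, xiSh_eq, smul_smul, smul_smul]
  have h : -2 * I * (1 / 2) * I = 1 := by linear_combination -I_mul_I
  rw [h, one_smul]

theorem ofForm_ceMetric (t : ℂ) : ofForm (ceMetric t) = ∑ j, xiSh (ceUnitary t) j := by
  simp only [xiSh_ceUnitary, ← Finset.smul_sum]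
  funext p
  refine (toSh_smul _ _).trans (congrArg _ ?_)
  rw [stdMetric, toSh_sum, Finset.sum_apply]
  exact Finset.sum_congr rfl fun j _ => toSh_xi _

/-- The coefficients of `∂φ_t¹` and `∂̄φ_t¹` are opposite conjugates of each other, reflecting
`dφ_t¹ = 2i φ_t¹ ∧ e_3` with `e_3` real, so the contributions of `φ_t¹` and of its conjugate cancel.
-/
theorem hasD_xiSh_ceUnitary_zero {t : ℂ} (ht : ‖t‖ < 1) : HasD 2 (xiSh (ceUnitary t) 0) 0 := by
  have W := anticomm_frameSh (ceFunctional t)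
  rw [xiSh_ceUnitary]
  refine ((hasD_ceFunctional_zero ht).xiSh.smul (1 / 2)).congr ?_
  simp [conjSh_add, conjSh_smul, conjSh_mul, conjSh_conjSh, add_mul, mul_add, mul_assoc, W.fe,
    W.fe_mul, W.ff_lt, W.ee_lt, map_div₀]
  module

theorem hasD_xiSh_ceUnitary_one {t : ℂ} (ht : ‖t‖ < 1) : HasD 2 (xiSh (ceUnitary t) 1) 0 := by
  have W := anticomm_frameSh (ceFunctional t)
  rw [xiSh_ceUnitary]
  refine ((hasD_ceFunctional_one ht).xiSh.smul (1 / 2)).congr ?_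
  simp [conjSh_add, conjSh_smul, conjSh_mul, conjSh_conjSh, add_mul, mul_add, mul_assoc, W.fe,
    W.fe_mul, W.ff_lt, W.ee_lt, map_div₀]
  module

theorem hasD_ceUnitary_two (t : ℂ) : HasD 1 (frameSh (ceUnitary t) 2)
    ((2 * ((√2 : ℝ) : ℂ)⁻¹ * (t - 1)) • xiSh (ceUnitary t) 0 +
      (-(2 * ((√2 : ℝ) : ℂ)⁻¹ * I * (t + 1))) • xiSh (ceUnitary t) 1) := by
  rw [frameSh_ceUnitary]
  refine ((hasD_ceFunctional_two t).smul _).congr ?_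
  rw [frameSh_mul_conj_ceFunctional, frameSh_mul_conj_ceFunctional]
  simp only [smul_add, smul_smul]
  congr 2
  · linear_combination (-2 * ((√2 : ℝ) : ℂ)⁻¹ * (t - 1)) * I_mul_I
  · ring

theorem isCoframe_ceUnitary {t : ℂ} (ht : ‖t‖ < 1) : IsCoframe (ceJ t) (ceUnitary t) :=
  (isCoframe_ceFunctional ht).smul (inv_ne_zero sqrt_two_ne)

theorem calabiEckmann_metric {t : ℂ} (ht : ‖t‖ < 1) :
    IsHermitianMetric (ceJ t) (ceMetric t) ∧
      IsPluriclosedStarSplit (ceJ t) 1 (ceMetric t) ∧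
      IsAssociatedFunction (ceJ t) 1 (ceMetric t) (fun _ => 8 * t.im) ∧
      (IsClosedStarSplit (ceJ t) 1 (ceMetric t) ↔ t.im = 0) ∧
      (t.im = 0 → IsRho (ceJ t) 1 (ceMetric t) 0 ∧ IsSKT (ceJ t) (ceMetric t)) ∧
      StarRhoHasEigenvalues (ceJ t) 1 (ceMetric t) ![4 * t.im, 4 * t.im, -(4 * t.im)] := by
  have hc := isCoframe_ceUnitary ht
  have hs := inv_sqrt_two_mul
  -- The condition `p + q ≠ 0`: it fails only when `t - 1 = i (t + 1)`, that is for `t = i`, which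
  -- lies outside the open disc.
  have hne : 2 * ((√2 : ℝ) : ℂ)⁻¹ * (t - 1) + -(2 * ((√2 : ℝ) : ℂ)⁻¹ * I * (t + 1)) ≠ 0 := by
    intro h
    have hsn : (2 * ((√2 : ℝ) : ℂ)⁻¹) ≠ 0 := mul_ne_zero two_ne_zero (inv_ne_zero sqrt_two_ne)
    have h1 : t - 1 - I * (t + 1) = 0 := by
      refine (mul_eq_zero.1 ?_).resolve_left hsn
      linear_combination h
    have h2 : t = I := by
      linear_combination (1 / 2 : ℂ) * (1 + I) * h1 + (1 / 2 : ℂ) * (t + 1) * I_mul_I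
    rw [h2, norm_I] at ht
    exact lt_irrefl _ ht
  have him : t - starRingEnd ℂ t = 2 * t.im * I := by
    rw [sub_conj]
    push_cast
    rfl
  -- For `p = √2 (t - 1)` and `q = -√2 i (t + 1)`, one finds `p conj q + q conj p = 4i (t - conj t)
  -- = -8 Im t`, which forces `l = 4 Im t`.
  obtain ⟨h₁, h₂, h₃, h₄, h₅⟩ := hc.calabiEckmann (l := 4 * t.im) (ofForm_ceMetric t)
    (hasD_xiSh_ceUnitary_zero ht) (hasD_xiSh_ceUnitary_one ht) (hasD_ceUnitary_two t) (by
      simp only [map_mul, map_neg, map_sub, map_add, map_one, conj_I, conj_inv_sqrt_two,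
        map_ofNat]
      push_cast
      linear_combination 4 * I * ((t - 1) * (starRingEnd ℂ t + 1) -
        (t + 1) * (starRingEnd ℂ t - 1)) * hs + 4 * I * him + 8 * t.im * I_mul_I) hne
  refine ⟨hc.isHermitianMetric (ofForm_ceMetric t), h₁, ?_, ?_, fun h => h₄ ?_, h₅⟩
  · convert h₂ using 2
    ring
  · rw [h₃]
    simp
  · rw [h, mul_zero]

theorem calabiEckmann_structure {t : ℂ} (ht : ‖t‖ < 1) :
    (∀ j, extD (ceFrame t j) = del (ceJ t) (ceFrame t j) + delbar (ceJ t) (ceFrame t j)) ∧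
      del (ceJ t) (ceFrame t 0) =
        (((starRingEnd ℂ t + 1) / (1 - (‖t‖ : ℂ) ^ 2)) * I) •
          formWedge (ceFrame t 0) (ceFrame t 2) ∧
      delbar (ceJ t) (ceFrame t 0) =
        (((t + 1) / (1 - (‖t‖ : ℂ) ^ 2)) * I) •
          formWedge (ceFrame t 0) (formConj (ceFrame t 2)) ∧
      del (ceJ t) (ceFrame t 1) =
        ((1 - starRingEnd ℂ t) / (1 - (‖t‖ : ℂ) ^ 2)) •
          formWedge (ceFrame t 1) (ceFrame t 2) ∧
      delbar (ceJ t) (ceFrame t 1) =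
        ((t - 1) / (1 - (‖t‖ : ℂ) ^ 2)) •
          formWedge (ceFrame t 1) (formConj (ceFrame t 2)) ∧
      del (ceJ t) (ceFrame t 2) = 0 ∧
      delbar (ceJ t) (ceFrame t 2) =
        ((t - 1) * I) • formWedge (ceFrame t 0) (formConj (ceFrame t 0)) +
          (t + 1) • formWedge (ceFrame t 1) (formConj (ceFrame t 1)) := by
  have hc := isCoframe_ceFunctional ht
  have h20 : ∀ (c : ℂ) (i j : Fin 3), ofForm (c • formWedge (ceFrame t i) (ceFrame t j)) =
      c • (frameSh (ceFunctional t) i * frameSh (ceFunctional t) j) := fun c i j =>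
    funext fun p => (toSh_smul _ _).trans (congrArg _ (toSh_wedge _ _))
  have h11 : ∀ (c : ℂ) (i j : Fin 3), ofForm (c • formWedge (ceFrame t i) (formConj (ceFrame t j))) =
      c • (frameSh (ceFunctional t) i * conjSh (frameSh (ceFunctional t) j)) := fun c i j =>
    funext fun p => (toSh_smul _ _).trans (congrArg _
      ((toSh_wedge _ _).trans (congrArg _ (toSh_conj _))))
  have t1 : ∀ j p, ShType (ceJ t p) 1 0 (frameSh (ceFunctional t) j p) := fun j p =>
    shType_oneForm (hc.map_J p j)
  have t20 : ∀ (c : ℂ) (i j : Fin 3) p, ShType (ceJ t p) 2 0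
      ((c • (frameSh (ceFunctional t) i * frameSh (ceFunctional t) j)) p) := fun c i j p =>
    ((t1 i p).mul (t1 j p)).smul c
  have t11 : ∀ (c : ℂ) (i j : Fin 3) p, ShType (ceJ t p) 1 1
      ((c • (frameSh (ceFunctional t) i * conjSh (frameSh (ceFunctional t) j))) p) := fun c i j p =>
    ((t1 i p).mul (t1 j p).conj).smul c
  obtain ⟨a₀, b₀, c₀⟩ := hc.del_delbar_oneForm (hasD_ceFunctional_zero ht) (h20 _ _ _) (h11 _ _ _)
    (t20 _ _ _) (t11 _ _ _)
  obtain ⟨a₁, b₁, c₁⟩ := hc.del_delbar_oneForm (hasD_ceFunctional_one ht) (h20 _ _ _) (h11 _ _ _)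
    (t20 _ _ _) (t11 _ _ _)
  obtain ⟨a₂, b₂, c₂⟩ := hc.del_delbar_oneForm (b := 0) (β := 0)
    (γ := ((t - 1) * I) • formWedge (ceFrame t 0) (formConj (ceFrame t 0)) +
      (t + 1) • formWedge (ceFrame t 1) (formConj (ceFrame t 1)))
    ((hasD_ceFunctional_two t).congr (zero_add _).symm) (funext fun p => toSh_zero)
    (funext fun p => (toSh_add _ _).trans (congrArg₂ (· + ·) (congrFun (h11 _ _ _) p)
      (congrFun (h11 _ _ _) p))) (fun p => ShType.zero)
    (fun p => (t11 _ _ _ p).add (t11 _ _ _ p))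
  refine ⟨fun j => ?_, b₀, c₀, b₁, c₁, b₂, c₂⟩
  fin_cases j
  exacts [a₀.trans (congrArg₂ _ b₀ c₀).symm, a₁.trans (congrArg₂ _ b₁ c₁).symm,
    a₂.trans (congrArg₂ _ b₂ c₂).symm]

end PSS
end

/-! ### Assembly of the four families -/

open PSS Complex in
theorem proposition2p10 :
    -- the Iwasawa manifold
    (∃ φ : Fin 3 → DForm 𝓘(ℝ, Fin 3 → ℂ) Iwasawa 1,
      (∀ j, pullback (quotMap Heisenberg.gaussianLattice) (φ j) = Heisenberg.frame j) ∧
      IsHermitianMetric (stdJ Iwasawa) (stdMetric φ) ∧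
      IsBalanced 1 (stdMetric φ) ∧
      IsClosedStarSplit (stdJ Iwasawa) 1 (stdMetric φ) ∧
      IsPluriclosedStarSplit (stdJ Iwasawa) 1 (stdMetric φ) ∧
      IsAssociatedFunction (stdJ Iwasawa) 1 (stdMetric φ) (fun _ => 1) ∧
      StarRhoHasEigenvalues (stdJ Iwasawa) 1 (stdMetric φ) ![1 / 2, 1 / 2, -1 / 2]) ∧
    -- Nakamura manifolds
    (∀ (Γ : Subgroup NakamuraGroup) [DiscreteTopology Γ] [CompactSpace (LeftQuotient Γ)],
      ∃ φ : Fin 3 → DForm 𝓘(ℝ, Fin 3 → ℂ) (LeftQuotient Γ) 1,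
        (∀ j, pullback (quotMap Γ) (φ j) = NakamuraGroup.frame j) ∧
        IsHermitianMetric (stdJ (LeftQuotient Γ)) (stdMetric φ) ∧
        IsBalanced 1 (stdMetric φ) ∧
        IsClosedStarSplit (stdJ (LeftQuotient Γ)) 1 (stdMetric φ) ∧
        IsPluriclosedStarSplit (stdJ (LeftQuotient Γ)) 1 (stdMetric φ) ∧
        IsAssociatedFunction (stdJ (LeftQuotient Γ)) 1 (stdMetric φ) (fun _ => 2) ∧
        StarRhoHasEigenvalues (stdJ (LeftQuotient Γ)) 1 (stdMetric φ) ![1, 0, 0]) ∧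
    -- five-dimensional Iwasawa manifolds
    (∀ (Γ : Subgroup I5Group) [DiscreteTopology Γ] [CompactSpace (LeftQuotient Γ)],
      ∃ φ : Fin 5 → DForm 𝓘(ℝ, Fin 5 → ℂ) (LeftQuotient Γ) 1,
        (∀ j, pullback (quotMap Γ) (φ j) = I5Group.frame j) ∧
        IsHermitianMetric (stdJ (LeftQuotient Γ)) (stdMetric φ) ∧
        IsBalanced 3 (stdMetric φ) ∧
        IsClosedStarSplit (stdJ (LeftQuotient Γ)) 3 (stdMetric φ) ∧
        IsPluriclosedStarSplit (stdJ (LeftQuotient Γ)) 3 (stdMetric φ) ∧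
        IsAssociatedFunction (stdJ (LeftQuotient Γ)) 3 (stdMetric φ) (fun _ => 3) ∧
        StarRhoHasEigenvalues (stdJ (LeftQuotient Γ)) 3 (stdMetric φ)
          ![3 / 4, 3 / 4, -1 / 4, -1 / 4, -1 / 4]) ∧
    -- the Calabi-Eckmann manifold and its deformations
    (∀ t : ℂ, ‖t‖ < 1 →
      -- `J_t` is a complex structure with `(1,0)`-coframe `φ_t`, and the structure equations hold
      (∀ p v, ceJ t p (ceJ t p v) = -v) ∧
      (∀ j, IsSmooth (ceFrame t j) ∧ ∀ p, IsOfType (ceJ t p) 1 0 (ceFrame t j p)) ∧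
      (∀ j, extD (ceFrame t j) = del (ceJ t) (ceFrame t j) + delbar (ceJ t) (ceFrame t j)) ∧
      del (ceJ t) (ceFrame t 0) =
        (((starRingEnd ℂ t + 1) / (1 - (‖t‖ : ℂ) ^ 2)) * I) •
          formWedge (ceFrame t 0) (ceFrame t 2) ∧
      delbar (ceJ t) (ceFrame t 0) =
        (((t + 1) / (1 - (‖t‖ : ℂ) ^ 2)) * I) •
          formWedge (ceFrame t 0) (formConj (ceFrame t 2)) ∧
      del (ceJ t) (ceFrame t 1) =
        ((1 - starRingEnd ℂ t) / (1 - (‖t‖ : ℂ) ^ 2)) •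
          formWedge (ceFrame t 1) (ceFrame t 2) ∧
      delbar (ceJ t) (ceFrame t 1) =
        ((t - 1) / (1 - (‖t‖ : ℂ) ^ 2)) •
          formWedge (ceFrame t 1) (formConj (ceFrame t 2)) ∧
      del (ceJ t) (ceFrame t 2) = 0 ∧
      delbar (ceJ t) (ceFrame t 2) =
        ((t - 1) * I) • formWedge (ceFrame t 0) (formConj (ceFrame t 0)) +
          (t + 1) • formWedge (ceFrame t 1) (formConj (ceFrame t 1)) ∧
      -- the properties of the metric `ω_t`
      IsHermitianMetric (ceJ t) (ceMetric t) ∧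
      IsPluriclosedStarSplit (ceJ t) 1 (ceMetric t) ∧
      IsAssociatedFunction (ceJ t) 1 (ceMetric t) (fun _ => 8 * t.im) ∧
      (IsClosedStarSplit (ceJ t) 1 (ceMetric t) ↔ t.im = 0) ∧
      (t.im = 0 → IsRho (ceJ t) 1 (ceMetric t) 0 ∧ IsSKT (ceJ t) (ceMetric t)) ∧
      StarRhoHasEigenvalues (ceJ t) 1 (ceMetric t) ![4 * t.im, 4 * t.im, -(4 * t.im)]) := by
  refine ⟨?_, fun Γ _ _ => ?_, fun Γ _ _ => ?_, fun t ht => ?_⟩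
  · obtain ⟨φ, hφ, h⟩ := Heisenberg.exists_isSplitMetric Heisenberg.gaussianLattice
    refine ⟨φ, hφ, h.hermitian, h.balanced, h.closed, h.pluriclosed, ?_, h.eigenvalues⟩
    -- The constant is `(n - 1) ∑ r_j = 2 · (1/2)`; in the next two cases it is `2 · 1` and `4 ·
    -- (3/4)`.
    convert h.function using 2
    change (1 : ℝ) = ((1 : ℕ) + 1) * ∑ j : Fin 3, ![(1 / 2 : ℝ), 1 / 2, -1 / 2] j
    norm_num [Fin.sum_univ_succ]
  · obtain ⟨φ, hφ, h⟩ := NakamuraGroup.exists_isSplitMetric Γ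
    refine ⟨φ, hφ, h.hermitian, h.balanced, h.closed, h.pluriclosed, ?_, h.eigenvalues⟩
    convert h.function using 2
    change (2 : ℝ) = ((1 : ℕ) + 1) * ∑ j : Fin 3, ![(1 : ℝ), 0, 0] j
    norm_num [Fin.sum_univ_succ]
  · obtain ⟨φ, hφ, h⟩ := I5Group.exists_isSplitMetric Γ
    refine ⟨φ, hφ, h.hermitian, h.balanced, h.closed, h.pluriclosed, ?_, h.eigenvalues⟩
    convert h.function using 2
    change (3 : ℝ) = ((3 : ℕ) + 1) * ∑ j : Fin 5, ![(3 / 4 : ℝ), 3 / 4, -1 / 4, -1 / 4, -1 / 4] j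
    norm_num [Fin.sum_univ_succ]
  · have hc := isCoframe_ceFunctional ht
    obtain ⟨h₁, h₂, h₃, h₄, h₅, h₆, h₇⟩ := calabiEckmann_structure ht
    refine ⟨ceJ_ceJ ht, fun j => ⟨?_, fun p => ?_⟩, h₁, h₂, h₃, h₄, h₅, h₆, h₇,
      calabiEckmann_metric ht⟩
    · obtain ⟨b, hb⟩ := hc.smooth j
      exact hb.isSmooth rfl
    · exact (isOfType_iff rfl _).2 (shType_oneForm (hc.map_J p j))
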